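/- Let $s_0>0$. For $|z|<1$ define $Q_n(z)$ by $$P(z,q)=1+\sum_{n\ge1}Q_n(z)q^n=\prod_{m\ge1}\frac{1}{(1-zq^m)^{m^{s_0-1}}}\qquad(|q|<1),$$ let $\mathrm{Li}_s(z)=\sum_{m\ge1}z^m/m^s$, and for relatively prime integers $0<h\le k$ put $$L_{h,k}(z)=\frac1k\sqrt[s_0+1]{\Gamma(s_0+1)\,\mathrm{Li}_{s_0+1}(z^k)},$$ with the principal branch ($\arg\in(-\pi,\pi]$) for all roots and powers. On $D=(-1,1)$ let the phase $R(p,q)$ be the set of $x\in D$ such that $\Re L_{p,q}(x)>\Re L_{h,k}(x)$ for every $(h,k)$ for which the functions $\Re L_{h,k}$ and $\Re L_{p,q}$ are not identical on $D$. There exists $x^*=x^*(s_0)\in[-1,0]$ such that $R(1,1)=(0,1)\cup(x^*,0)$ and $R(1,2)=(-1,x^*)$, and such that for every compact $X\subset(x^*,0)$, uniformly for $x\in X$ as $n\to\infty$, $$Q_n(x)\sim 2(1-x)^{-\zeta(1-s_0)}\,\Re\, b_n(x),\qquad b_n(x)=\sqrt{\frac{L_{1,1}(x)}{2\pi(s_0+1)n^{\frac{s_0+2}{s_0+1}}}}\;\exp\!\Big(\frac{s_0+1}{s_0}\,n^{\frac{s_0}{s_0+1}}L_{1,1}(x)\Big),$$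 in the following sense: $$Q_n(x)=2(1-x)^{-\zeta(1-s_0)}\,|b_n(x)|\,\big(\cos(\arg b_n(x))+E_n(x)\big)\qquad(n\ge1,\ x\in X),$$ where for every $\sigma_0\in(-1,0)$ there is a constant $C$, depending only on $s_0$, $X$ and $\sigma_0$, with $$|E_n(x)|\le C\,n^{-\mu}\quad(n\ge1,\ x\in X),\qquad \mu=\min\Big(\frac{-\sigma_0}{s_0+1},\frac{s_0}{2s_0+2}\Big).$$ -/

import Mathlib

open Set

noncomputable section

/-- The infinite product `P(z, q) = ∏_{m ≥ 1} (1 - z q ^ m) ^ (-a_m)`, for `z` and `q` in the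
open unit disk; the powers are principal ones. -/
def eulerProduct (a : ℕ → ℝ) (z q : ℂ) : ℂ :=
  ∏' m : ℕ, (1 - z * q ^ (m + 1)) ^ (-(a (m + 1) : ℂ))

/-- `Q_n(z)`: the coefficient of `q ^ n` in the expansion of `P(z, q)` around `q = 0`. -/
def eulerCoeff (a : ℕ → ℝ) (n : ℕ) (z : ℂ) : ℂ :=
  iteratedDeriv n (fun q : ℂ => eulerProduct a z q) 0 / (n.factorial : ℂ)

/-- The sequence `a_m = m ^ (s₀ - 1)`. -/
def powerSeq (s₀ : ℝ) (m : ℕ) : ℝ := (m : ℝ) ^ (s₀ - 1)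

/-- The polylogarithm `Li_s(z) = ∑_{m ≥ 1} z ^ m / m ^ s`, for `|z| < 1`. -/
def polyLog (s z : ℂ) : ℂ := ∑' m : ℕ, z ^ (m + 1) / ((m + 1 : ℕ) : ℂ) ^ s

/-- `L_{h,k}(z) = (1 / k) (Γ(s₀ + 1) Li_{s₀ + 1}(z ^ k)) ^ (1 / (s₀ + 1))` (principal root),
for the sequence `m ^ (s₀ - 1)`; it does not depend on `h`. -/
def powerL (s₀ : ℝ) (_h k : ℕ) (z : ℂ) : ℂ :=
  (1 / (k : ℂ)) *
    (Complex.Gamma ((s₀ : ℂ) + 1) * polyLog ((s₀ : ℂ) + 1) (z ^ k)) ^ (1 / ((s₀ : ℂ) + 1))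

/-- The `(p, q)`-th phase in `D` of a family `L_{h,k}`, indexed by the relatively prime
`0 < h ≤ k`: the points of `D` where `Re L_{p,q}` is larger than the real part of each `L_{h,k}`
that is not equivalent to `L_{p,q}`, two members being equivalent if their real parts agree
on `D`. -/
def phase (L : ℕ → ℕ → ℂ → ℂ) (D : Set ℂ) (p q : ℕ) : Set ℂ :=
  {z | z ∈ D ∧ ∀ h k : ℕ, 0 < h → h ≤ k → Nat.Coprime h k →
    (¬ ∀ u ∈ D, (L h k u).re = (L p q u).re) → (L h k z).re < (L p q z).re}

/-- `√(L_{1,1}(x) / (2π (s₀ + 1) n ^ ((s₀ + 2) / (s₀ + 1)))) *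
exp(((s₀ + 1) / s₀) n ^ (s₀ / (s₀ + 1)) L_{1,1}(x))`, with the principal square root. -/
def saddleTerm (s₀ : ℝ) (n : ℕ) (x : ℝ) : ℂ :=
  (powerL s₀ 1 1 x /
      ((2 * Real.pi * (s₀ + 1) * (n : ℝ) ^ ((s₀ + 2) / (s₀ + 1)) : ℝ) : ℂ)) ^ (1 / 2 : ℂ) *
    Complex.exp ((((s₀ + 1) / s₀ * (n : ℝ) ^ (s₀ / (s₀ + 1)) : ℝ) : ℂ) * powerL s₀ 1 1 x)

end

open Filter Topology MeasureTheory

/-! Write `s` for `s₀` and `F(w) = ∑ m^(s-1) e^(-mw)`, which is `powerExpSeries`. Expanding the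
logarithms gives `log P(x, e^(-w)) = ∑_j x^j/j F(jw)` (`hasSum_eulerLog`). For `s > 1`, Lipschitz'
formula, an instance of Poisson summation, reads `F(w) = Γ(s) ∑_{n ∈ ℤ} (w + 2πin)^(-s)`. Thus `F`
has period `2πi`, its singular part at `0` is `Γ(s) w^(-s)`, and by the functional equation the rest
takes the value `ζ(1-s)` there. Summing over `j`, in a cone around the positive axis `log P = -Λ
w^(-s)/s - ζ(1-s) log(1-x) + O(w)` with `Λ = -Γ(s+1) Li_{s+1}(x)`, which is positive for `x < 0`
(`eulerLog_cone`).

In Cauchy's formula the exponent is then essentially `nw - Λ w^(-s)/s`, with critical points `w = ρ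
e^(±iπ/(s+1))`, `ρ = (Λ/n)^(1/(s+1))`. They lie in the right half-plane exactly when `s > 1`; being
conjugate, they contribute twice a real part. Putting `w = ρv` and `M = nρ` turns the exponent into
`M (v - v^(-s)/s)`, and Laplace's method (`exists_gaussian_approx`) has relative error `O(M^(-1/2) +
ρ)`. These two errors are the source of the two exponents in `μ`.

On the rest of the circle, near `2πi` times a rational of denominator `k`, `r^s log P` looks like
`Γ(s+1) Li_{s+1}(x^k) k^(-s-1) (1+it)^(-s)/s`, or else is small (`eulerLog_dichotomy`). In
`eulerLog_minor`, even `k` reduce to `k = 2`, which loses to the saddle point because `Re L_{1,2} <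
Re L_{1,1}`; odd `k ≥ 3` lose by alternating series bounds; for `k = 1` the function `-Re
(1+it)^(-s)` has its strict maximum over `t ≥ 0` at the saddle point.

The phases come from comparing `Re L_{1,1}` with `Re L_{1,2}` on `(-1,0)`: they cross at most once
because `Li(t)/t` increases and `-Li(-t)/t` decreases (`powerL_re_cross`). If `s ≤ 1` then `Re
L_{1,1} ≤ 0 < Re L_{1,2}` there, so `(x*,0)` is empty and the asymptotic claim is vacuous. -/

/-! ### Lipschitz' formula by Poisson summation. -/

/-- The density `t ^ (s - 1) e ^ (-w t)` on the positive half-line, extended by zero. -/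
noncomputable def gammaKernel (s : ℝ) (w : ℂ) (t : ℝ) : ℂ :=
  if 0 < t then ((t ^ (s - 1) : ℝ) : ℂ) * Complex.exp (-(w * t)) else 0

lemma integrableOn_rpow_mul_exp_neg {s r : ℝ} (hs : 0 < s) (hr : 0 < r) :
    IntegrableOn (fun t : ℝ => t ^ (s - 1) * Real.exp (-(r * t))) (Ioi 0) := by
  have := integrableOn_rpow_mul_exp_neg_mul_rpow (s := s - 1) (p := 1) (b := r) (by linarith)
    one_pos hr
  simpa using this

/-- `∫ t ^ (s - 1) e ^ (-w t) dt = Γ(s) w ^ (-s)` for complex `w` in the right half-plane. -/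
lemma integral_rpow_mul_cexp_neg_mul_Ioi {s : ℝ} (hs : 0 < s) {w : ℂ} (hw : 0 < w.re) :
    ∫ t : ℝ in Ioi 0, ((t ^ (s - 1) : ℝ) : ℂ) * Complex.exp (-(w * t))
      = (Real.Gamma s : ℂ) * w ^ (-(s : ℂ)) := by
  -- As the complex moment generating function of this measure, the integral is analytic in `w`, so
  -- the identity theorem extends the real formula to the half-plane.
  set μ : Measure ℝ := (volume.restrict (Ioi 0)).withDensity
    (fun t => ENNReal.ofReal (t ^ (s - 1))) with hμ
  have hmeas : Measurable (fun t : ℝ => ENNReal.ofReal (t ^ (s - 1))) := by fun_prop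
  have hdens : ∀ g : ℝ → ℂ, ∫ t, g t ∂μ = ∫ t : ℝ in Ioi 0, ((t ^ (s - 1) : ℝ) : ℂ) * g t := by
    intro g
    rw [hμ, integral_withDensity_eq_integral_toReal_smul hmeas (by simp)]
    refine setIntegral_congr_fun measurableSet_Ioi fun t ht => ?_
    rw [ENNReal.toReal_ofReal (Real.rpow_nonneg (le_of_lt ht) _)]
    simp
  have hint : Iio (0 : ℝ) ⊆ ProbabilityTheory.integrableExpSet id μ := by
    intro y hy
    have hy' : 0 < -y := by simpa using hy
    show Integrable _ μ
    rw [hμ, integrable_withDensity_iff_integrable_smul' hmeas (by simp)]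
    refine (integrableOn_rpow_mul_exp_neg hs hy').congr_fun (fun t ht => ?_) measurableSet_Ioi
    simp only [id]
    rw [ENNReal.toReal_ofReal (Real.rpow_nonneg (le_of_lt ht) _)]
    simp
  have hint' : Iio (0 : ℝ) ⊆ interior (ProbabilityTheory.integrableExpSet id μ) :=
    interior_maximal hint isOpen_Iio
  have hopen : IsOpen {z : ℂ | 0 < z.re} := isOpen_lt continuous_const Complex.continuous_re
  have hf : AnalyticOnNhd ℂ (fun z => ProbabilityTheory.complexMGF id μ (-z)) {z : ℂ | 0 < z.re} := by
    refine DifferentiableOn.analyticOnNhd (fun z hz => ?_) hopen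
    have h1 := ProbabilityTheory.hasDerivAt_complexMGF (X := id) (μ := μ) (z := -z)
      (hint' (by simpa using hz))
    exact (h1.differentiableAt.comp z differentiableAt_id.neg).differentiableWithinAt
  have hg : AnalyticOnNhd ℂ (fun z => (Real.Gamma s : ℂ) * z ^ (-(s : ℂ))) {z : ℂ | 0 < z.re} := by
    refine DifferentiableOn.analyticOnNhd (fun z hz => ?_) hopen
    exact ((differentiableAt_id.cpow_const (Or.inl hz)).const_mul _).differentiableWithinAt
  have hval : ∀ z, ProbabilityTheory.complexMGF id μ (-z)
      = ∫ t : ℝ in Ioi 0, ((t ^ (s - 1) : ℝ) : ℂ) * Complex.exp (-(z * t)) := by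
    intro z
    rw [ProbabilityTheory.complexMGF, hdens]
    simp
  have hreal : ∀ r : ℝ, 0 < r → ProbabilityTheory.complexMGF id μ (-(r : ℂ))
      = (Real.Gamma s : ℂ) * (r : ℂ) ^ (-(s : ℂ)) := by
    intro r hr
    rw [hval]
    have := Real.integral_rpow_mul_exp_neg_mul_Ioi hs hr
    have h2 : ∫ t : ℝ in Ioi 0, ((t ^ (s - 1) : ℝ) : ℂ) * Complex.exp (-((r : ℂ) * t))
        = ((∫ t : ℝ in Ioi 0, t ^ (s - 1) * Real.exp (-(r * t)) : ℝ) : ℂ) := by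
      rw [← integral_complex_ofReal]; push_cast; rfl
    rw [h2, this, ← Complex.ofReal_neg, ← Complex.ofReal_cpow hr.le, one_div,
      Real.inv_rpow hr.le, Real.rpow_neg hr.le]
    push_cast; ring
  have key := hf.eqOn_of_preconnected_of_frequently_eq hg
    (convex_halfSpace_re_gt 0).isPreconnected (z₀ := 1) (by simp) ?_
  · rw [← hval]; exact key hw
  · have ht : Tendsto (fun r : ℝ => (r : ℂ)) (𝓝[>] (1 : ℝ)) (𝓝[≠] (1 : ℂ)) := by
      refine tendsto_nhdsWithin_iff.2 ⟨?_, ?_⟩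
      · exact (Complex.continuous_ofReal.tendsto' 1 1 (by simp)).mono_left nhdsWithin_le_nhds
      · filter_upwards [self_mem_nhdsWithin] with r hr
        have : (1 : ℝ) < r := hr
        simp only [mem_compl_iff, mem_singleton_iff]
        intro h
        have : r = 1 := by exact_mod_cast h
        linarith
    refine ht.frequently (Eventually.frequently ?_)
    filter_upwards [self_mem_nhdsWithin] with r hr
    exact hreal r (lt_trans one_pos hr)

lemma continuous_gammaKernel {s : ℝ} (hs : 1 < s) (w : ℂ) : Continuous (gammaKernel s w) := by
  have : gammaKernel s w
      = fun t : ℝ => (((max t 0) ^ (s - 1) : ℝ) : ℂ) * Complex.exp (-(w * t)) := by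
    ext t
    rw [gammaKernel]
    split_ifs with h
    · rw [max_eq_left h.le]
    · rw [max_eq_right (not_lt.1 h), Real.zero_rpow (by linarith)]; simp
  rw [this]
  refine Continuous.mul (Complex.continuous_ofReal.comp ?_) (by fun_prop)
  exact Continuous.rpow_const (by fun_prop) (fun _ => Or.inr (by linarith))

open FourierTransform in
-- The Fourier phase merely shifts `w` by `2πiξ`, so the complex Gamma integral applies.
lemma fourier_gammaKernel {s : ℝ} (hs : 1 < s) {w : ℂ} (hw : 0 < w.re) (ξ : ℝ) :
    𝓕 (gammaKernel s w) ξ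
      = (Real.Gamma s : ℂ) * (w + 2 * Real.pi * Complex.I * ξ) ^ (-(s : ℂ)) := by
  rw [Real.fourier_real_eq_integral_exp_smul]
  rw [← integral_rpow_mul_cexp_neg_mul_Ioi (by linarith) (by simpa using hw),
    ← integral_indicator measurableSet_Ioi]
  congr 1
  ext t
  simp only [gammaKernel, indicator, mem_Ioi]
  split_ifs
  · rw [smul_eq_mul, mul_left_comm, ← Complex.exp_add]
    congr 2
    push_cast
    ring
  · simp

open FourierTransform Asymptotics in
lemma fourier_gammaKernel_isBigO {s : ℝ} (hs : 1 < s) {w : ℂ} (hw : 0 < w.re) :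
    (𝓕 (gammaKernel s w)) =O[cocompact ℝ] (fun x : ℝ => |x| ^ (-s)) := by
  have h1 : ∀ᶠ ξ : ℝ in cocompact ℝ, ‖w‖ ≤ |ξ| ∧ 0 < |ξ| := by
    have := tendsto_norm_cocompact_atTop (E := ℝ)
    exact (this.eventually_ge_atTop ‖w‖).and (this.eventually_gt_atTop 0)
  refine IsBigO.of_bound (Real.Gamma s) ?_
  filter_upwards [h1] with ξ hξ
  rw [fourier_gammaKernel hs hw, norm_mul, Complex.norm_real,
    Real.norm_of_nonneg (Real.Gamma_pos_of_pos (by linarith)).le]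
  refine mul_le_mul_of_nonneg_left ?_ (Real.Gamma_pos_of_pos (by linarith)).le
  rw [← Complex.ofReal_neg, Complex.norm_cpow_real, Real.norm_of_nonneg (by positivity)]
  refine Real.rpow_le_rpow_of_nonpos hξ.2 ?_ (by linarith)
  have h2 : ‖(2 * Real.pi * Complex.I * ξ : ℂ)‖ = 2 * Real.pi * |ξ| := by
    simp [abs_of_pos Real.pi_pos]
  have h3 := norm_sub_norm_le (2 * Real.pi * Complex.I * ξ : ℂ) (-w)
  rw [norm_neg, sub_neg_eq_add, add_comm, h2] at h3
  have := Real.pi_gt_three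
  nlinarith [hξ.1, hξ.2]

open Asymptotics in
lemma gammaKernel_isBigO (s : ℝ) {w : ℂ} (hw : 0 < w.re) :
    gammaKernel s w =O[cocompact ℝ] (fun x : ℝ => |x| ^ (-s)) := by
  rw [cocompact_eq_atBot_atTop, isBigO_sup]
  constructor
  · refine IsBigO.of_bound 0 ?_
    filter_upwards [eventually_lt_atBot (0 : ℝ)] with t ht
    simp [gammaKernel, not_lt.2 ht.le]
  -- The exponent is chosen so that `(s - 1) - (2s - 1) = -s`.
  · have h := (isLittleO_exp_neg_mul_rpow_atTop hw (-(2 * s - 1))).isBigO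
    have h2 : (fun t : ℝ => t ^ (s - 1) * Real.exp (-w.re * t)) =O[atTop]
        (fun t : ℝ => t ^ (s - 1) * t ^ (-(2 * s - 1))) := (isBigO_refl _ _).mul h
    refine (IsBigO.trans ?_ h2).trans ?_
    · refine IsBigO.of_bound 1 ?_
      filter_upwards [eventually_gt_atTop (0 : ℝ)] with t ht
      rw [gammaKernel, if_pos ht, norm_mul, norm_mul, Complex.norm_real, Complex.norm_exp]
      simp
    · refine IsBigO.of_bound 1 ?_
      filter_upwards [eventually_gt_atTop (0 : ℝ)] with t ht
      rw [← Real.rpow_add ht, abs_of_pos ht, one_mul]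
      apply le_of_eq; congr 2; ring

/-- The Dirichlet-type generating series `∑_{m ≥ 1} m ^ (s - 1) e ^ (-m w)`. -/
noncomputable def powerExpSeries (s : ℝ) (w : ℂ) : ℂ :=
  ∑' m : ℕ, (((m + 1 : ℕ) : ℝ) ^ (s - 1) : ℝ) * Complex.exp (-(((m + 1 : ℕ) : ℂ) * w))

/-- Lipschitz' formula. -/
lemma powerExpSeries_eq_tsum_int {s : ℝ} (hs : 1 < s) {w : ℂ} (hw : 0 < w.re) :
    powerExpSeries s w
      = ∑' n : ℤ, (Real.Gamma s : ℂ) * (w + 2 * Real.pi * Complex.I * n) ^ (-(s : ℂ)) := by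
  have h := Real.tsum_eq_tsum_fourier_of_rpow_decay (continuous_gammaKernel hs w) hs
    (gammaKernel_isBigO s hw) (fourier_gammaKernel_isBigO hs hw) 0
  simp only [zero_add, fourier_gammaKernel hs hw] at h
  have h2 : ∑' n : ℤ, gammaKernel s w n = powerExpSeries s w := by
    rw [powerExpSeries, ← (show Function.Injective (fun m : ℕ => ((m + 1 : ℕ) : ℤ)) from
      fun a b h => by simpa using h).tsum_eq]
    · refine tsum_congr fun m => ?_
      rw [gammaKernel, if_pos (by push_cast; positivity)]
      push_cast
      ring_nf
    · intro n hn
      have : 0 < (n : ℝ) := by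
        by_contra hc
        exact hn (by simp [gammaKernel, hc])
      have hn0 : 0 < n := by exact_mod_cast this
      exact ⟨(n - 1).toNat, by simp; omega⟩
  rw [← h2, h]
  refine tsum_congr fun n => ?_
  simp [fourier_apply]

/-! ### The singular part of `powerExpSeries` at the origin, and global bounds. -/

lemma summable_ite_abs_int_rpow {s : ℝ} (hs : 1 < s) :
    Summable (fun n : ℤ => if n = 0 then (0 : ℝ) else |(n : ℝ)| ^ (-s)) := by
  refine Summable.of_nonneg_of_le (fun n => ?_) (fun n => ?_) (Real.summable_abs_int_rpow hs)
  · split_ifs <;> positivity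
  · split_ifs
    · positivity
    · exact le_rfl

lemma one_le_abs_intCast {n : ℤ} (hn : n ≠ 0) : (1 : ℝ) ≤ |(n : ℝ)| := by
  exact_mod_cast Int.one_le_abs hn

/-- The imaginary part has modulus at least `2π|n| - π ≥ |n|`. This yields a summable majorant valid
in the whole strip. -/
lemma abs_int_le_norm_add_two_pi_I {w : ℂ} (hw : |w.im| ≤ Real.pi) {n : ℤ} (hn : n ≠ 0) :
    |(n : ℝ)| ≤ ‖w + 2 * Real.pi * Complex.I * n‖ := by
  refine le_trans ?_ (Complex.abs_im_le_norm _)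
  have h1 : (w + 2 * Real.pi * Complex.I * n).im = 2 * Real.pi * n + w.im := by
    simp; ring
  have h2 : |2 * Real.pi * (n : ℝ)| = 2 * Real.pi * |(n : ℝ)| := by
    rw [abs_mul, abs_of_pos (by positivity)]
  have h3 := abs_sub_abs_le_abs_sub (2 * Real.pi * (n : ℝ)) (-w.im)
  rw [sub_neg_eq_add, abs_neg, h2] at h3
  rw [h1]
  have := Real.pi_gt_three
  have := one_le_abs_intCast hn
  nlinarith

lemma norm_cpow_neg_le_abs_int {s : ℝ} (hs : 0 ≤ s) {w : ℂ} (hw : |w.im| ≤ Real.pi) {n : ℤ}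
    (hn : n ≠ 0) :
    ‖(w + 2 * Real.pi * Complex.I * n) ^ (-(s : ℂ))‖ ≤ |(n : ℝ)| ^ (-s) := by
  rw [← Complex.ofReal_neg, Complex.norm_cpow_real]
  have := one_le_abs_intCast hn
  exact Real.rpow_le_rpow_of_nonpos (by linarith) (abs_int_le_norm_add_two_pi_I hw hn)
    (by linarith)

lemma summable_norm_ite_cpow {s : ℝ} (hs : 1 < s) {w : ℂ} (hw : |w.im| ≤ Real.pi) :
    Summable (fun n : ℤ => ‖if n = 0 then 0 else
      (w + 2 * Real.pi * Complex.I * n) ^ (-(s : ℂ))‖) := by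
  refine Summable.of_nonneg_of_le (fun n => norm_nonneg _) (fun n => ?_)
    (summable_ite_abs_int_rpow hs)
  split_ifs with h
  · simp
  · exact norm_cpow_neg_le_abs_int (by linarith) hw h

/-- The part of Lipschitz' formula that stays regular at `w = 0`. -/
noncomputable def lipschitzTail (s : ℝ) (w : ℂ) : ℂ :=
  (Real.Gamma s : ℂ) * ∑' n : ℤ, if n = 0 then 0 else
    (w + 2 * Real.pi * Complex.I * n) ^ (-(s : ℂ))

lemma powerExpSeries_eq_add_lipschitzTail {s : ℝ} (hs : 1 < s) {w : ℂ} (hw : 0 < w.re)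
    (hw' : |w.im| ≤ Real.pi) :
    powerExpSeries s w = (Real.Gamma s : ℂ) * w ^ (-(s : ℂ)) + lipschitzTail s w := by
  have hsum : Summable (fun n : ℤ => (w + 2 * Real.pi * Complex.I * n) ^ (-(s : ℂ))) := by
    have h1 := (summable_norm_ite_cpow hs hw').of_norm
    have h2 : Summable (fun n : ℤ => if n = 0 then w ^ (-(s : ℂ)) else 0) :=
      summable_of_ne_finset_zero (s := {0}) (fun n hn => by simp at hn; simp [hn])
    refine (h1.add h2).congr fun n => ?_
    split_ifs with h
    · simp [h]
    · simp
  rw [powerExpSeries_eq_tsum_int hs hw, tsum_mul_left, hsum.tsum_eq_add_tsum_ite 0, mul_add,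
    lipschitzTail]
  simp

lemma norm_lipschitzTail_le {s : ℝ} (hs : 1 < s) {w : ℂ} (hw' : |w.im| ≤ Real.pi) :
    ‖lipschitzTail s w‖ ≤ Real.Gamma s * ∑' n : ℤ, if n = 0 then (0 : ℝ) else |(n : ℝ)| ^ (-s) := by
  have hG := Real.Gamma_pos_of_pos (show 0 < s by linarith)
  rw [lipschitzTail, norm_mul, Complex.norm_real, Real.norm_of_nonneg hG.le]
  refine mul_le_mul_of_nonneg_left ?_ hG.le
  refine (norm_tsum_le_tsum_norm (summable_norm_ite_cpow hs hw')).trans ?_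
  refine (summable_norm_ite_cpow hs hw').tsum_le_tsum (fun n => ?_) (summable_ite_abs_int_rpow hs)
  split_ifs with h
  · simp
  · exact norm_cpow_neg_le_abs_int (by linarith) hw' h

lemma ofReal_mul_cpow {r : ℝ} (hr : 0 < r) {z : ℂ} (hz : z ≠ 0) (c : ℂ) :
    ((r : ℂ) * z) ^ c = (r : ℂ) ^ c * z ^ c := by
  have hr' : (r : ℂ) ≠ 0 := by exact_mod_cast hr.ne'
  rw [Complex.cpow_def_of_ne_zero (mul_ne_zero hr' hz), Complex.cpow_def_of_ne_zero hr',
    Complex.cpow_def_of_ne_zero hz, Complex.log_ofReal_mul hr hz, Complex.ofReal_log hr.le, add_mul,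
    Complex.exp_add]

/-- The terms `n` and `-n` combine through `i^(-s) + (-i)^(-s) = 2 cos(πs/2)`, the cosine of the
functional equation. -/
lemma cpow_neg_two_pi_I_add (s : ℝ) (m : ℕ) :
    (2 * Real.pi * Complex.I * ((m : ℂ) + 1)) ^ (-(s : ℂ))
        + (-(2 * Real.pi * Complex.I * ((m : ℂ) + 1))) ^ (-(s : ℂ))
      = 2 * (2 * Real.pi) ^ (-(s : ℂ)) * Complex.cos (Real.pi * s / 2)
        * (1 / ((m : ℂ) + 1) ^ (s : ℂ)) := by
  have hp : 0 < 2 * Real.pi * ((m : ℝ) + 1) := by positivity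
  have h1 : (2 * Real.pi * Complex.I * ((m : ℂ) + 1))
      = ((2 * Real.pi * ((m : ℝ) + 1) : ℝ) : ℂ) * Complex.I := by push_cast; ring
  have h2 : ((2 * Real.pi * ((m : ℝ) + 1) : ℝ) : ℂ) ^ (-(s : ℂ))
      = (2 * Real.pi) ^ (-(s : ℂ)) * (1 / ((m : ℂ) + 1) ^ (s : ℂ)) := by
    have := Complex.mul_cpow_ofReal_nonneg (a := 2 * Real.pi) (b := (m : ℝ) + 1)
      (by positivity) (by positivity) (-(s : ℂ))
    push_cast at this ⊢
    rw [this, Complex.cpow_neg ((m : ℂ) + 1), one_div]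
  rw [h1, ← mul_neg, ofReal_mul_cpow hp Complex.I_ne_zero,
    ofReal_mul_cpow hp (neg_ne_zero.2 Complex.I_ne_zero), h2,
    Complex.cpow_def_of_ne_zero Complex.I_ne_zero,
    Complex.cpow_def_of_ne_zero (neg_ne_zero.2 Complex.I_ne_zero), Complex.log_I,
    Complex.log_neg_I, Complex.cos]
  rw [show (Real.pi : ℂ) / 2 * Complex.I * -(s : ℂ) = -((Real.pi : ℂ) * s / 2) * Complex.I by ring,
    show -((Real.pi : ℂ) / 2) * Complex.I * -(s : ℂ) = (Real.pi : ℂ) * s / 2 * Complex.I by ring]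
  ring

/-- At `w = 0` the tail is `2 (2π)^(-s) Γ(s) cos(πs/2) ζ(s)`, which the functional equation
identifies. -/
lemma lipschitzTail_zero {s : ℝ} (hs : 1 < s) : lipschitzTail s 0 = riemannZeta (1 - (s : ℂ)) := by
  rw [riemannZeta_one_sub, zeta_eq_tsum_one_div_nat_add_one_cpow (by simpa using hs), lipschitzTail]
  · have hsum := (summable_norm_ite_cpow hs (w := 0) (by simp [Real.pi_pos.le])).of_norm
    have h1 := (hsum.comp_injective (i := fun m : ℕ => (m : ℤ) + 1)
      (fun a b h => by simpa using h)).hasSum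
    have h2 := (hsum.comp_injective (i := fun m : ℕ => -((m : ℤ) + 1))
      (fun a b h => by simpa using h)).hasSum
    have h3 := (h1.of_add_one_of_neg_add_one (f := fun n : ℤ => if n = 0 then (0 : ℂ) else
      (0 + 2 * Real.pi * Complex.I * n) ^ (-(s : ℂ))) h2).tsum_eq
    rw [h3, if_pos rfl, add_zero, ← h1.summable.tsum_add h2.summable]
    simp only [Function.comp_def, zero_add]
    have h4 : ∀ m : ℕ, (m : ℤ) + 1 ≠ 0 := fun m => by positivity
    simp only [h4, neg_eq_zero, if_false]
    push_cast
    simp only [mul_neg, cpow_neg_two_pi_I_add]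
    rw [tsum_mul_left, Complex.Gamma_ofReal]
    ring
  · intro n h
    have := congrArg Complex.re h
    simp at this
    have : (0 : ℝ) ≤ n := by positivity
    linarith
  · intro h
    have := congrArg Complex.re h
    simp at this
    linarith

/-- Mean value inequality for each term on the unit ball. The derivative carries the exponent
`-s-1`, so the majorant `|n|^(-s)` still serves. -/
lemma norm_lipschitzTail_sub_le {s : ℝ} (hs : 1 < s) {w : ℂ} (hw : ‖w‖ ≤ 1) :
    ‖lipschitzTail s w - riemannZeta (1 - (s : ℂ))‖
      ≤ Real.Gamma s * (s * ∑' n : ℤ, if n = 0 then (0 : ℝ) else |(n : ℝ)| ^ (-s)) * ‖w‖ := by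
  have hG := Real.Gamma_pos_of_pos (show 0 < s by linarith)
  have hpi := Real.pi_gt_three
  have him : |w.im| ≤ Real.pi := (Complex.abs_im_le_norm w).trans (by linarith)
  have hpt : ∀ n : ℤ, ‖(if n = 0 then 0 else (w + 2 * Real.pi * Complex.I * n) ^ (-(s : ℂ)))
      - (if n = 0 then 0 else (0 + 2 * Real.pi * Complex.I * n) ^ (-(s : ℂ)))‖
      ≤ (s * if n = 0 then (0 : ℝ) else |(n : ℝ)| ^ (-s)) * ‖w‖ := by
    intro n
    split_ifs with h
    · simp
    have hn := one_le_abs_intCast h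
    have him' : ∀ z ∈ Metric.closedBall (0 : ℂ) 1, |z.im| ≤ 1 := fun z hz =>
      (Complex.abs_im_le_norm z).trans (by simpa using hz)
    have hd : ∀ z ∈ Metric.closedBall (0 : ℂ) 1, HasDerivWithinAt
        (fun z => (z + 2 * Real.pi * Complex.I * n) ^ (-(s : ℂ)))
        (-(s : ℂ) * (z + 2 * Real.pi * Complex.I * n) ^ (-(s : ℂ) - 1) * 1)
        (Metric.closedBall (0 : ℂ) 1) z := by
      intro z hz
      refine (((hasDerivAt_id z).add_const _).cpow_const ?_).hasDerivWithinAt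
      right
      have h1 : (z + 2 * Real.pi * Complex.I * n).im = 2 * Real.pi * n + z.im := by simp; ring
      simp only [id]
      rw [h1]
      intro h0
      have h2 : |2 * Real.pi * (n : ℝ)| = |z.im| := by
        rw [show 2 * Real.pi * (n : ℝ) = - z.im by linarith, abs_neg]
      rw [abs_mul, abs_of_pos (by positivity)] at h2
      have := him' z hz
      nlinarith
    have hb : ∀ z ∈ Metric.closedBall (0 : ℂ) 1,
        ‖-(s : ℂ) * (z + 2 * Real.pi * Complex.I * n) ^ (-(s : ℂ) - 1) * 1‖
          ≤ s * |(n : ℝ)| ^ (-s) := by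
      intro z hz
      rw [mul_one, norm_mul, norm_neg, Complex.norm_real, Real.norm_of_nonneg (by linarith)]
      refine mul_le_mul_of_nonneg_left ?_ (by linarith)
      have := norm_cpow_neg_le_abs_int (s := s + 1) (by linarith)
        ((him' z hz).trans (by linarith : (1 : ℝ) ≤ Real.pi)) h
      push_cast at this
      rw [neg_add, ← sub_eq_add_neg] at this
      refine this.trans (Real.rpow_le_rpow_of_exponent_le hn (by linarith))
    have := (convex_closedBall (0 : ℂ) 1).norm_image_sub_le_of_norm_hasDerivWithin_le hd hb
      (x := 0) (y := w) (by simp) (by simpa using hw)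
    simpa using this
  have hs1 := summable_norm_ite_cpow hs him
  have hs0 := summable_norm_ite_cpow hs (w := 0) (by simp [Real.pi_pos.le])
  have hs2 := ((summable_ite_abs_int_rpow hs).mul_left s).mul_right ‖w‖
  rw [← lipschitzTail_zero hs, lipschitzTail, lipschitzTail, ← mul_sub,
    ← hs1.of_norm.tsum_sub hs0.of_norm, norm_mul, Complex.norm_real, Real.norm_of_nonneg hG.le,
    mul_assoc (Real.Gamma s)]
  refine mul_le_mul_of_nonneg_left ?_ hG.le
  rw [← tsum_mul_left, ← tsum_mul_right]
  exact tsum_of_norm_bounded hs2.hasSum hpt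

lemma powerExpSeries_strip {s : ℝ} (hs : 1 < s) : ∃ C : ℝ, 0 ≤ C ∧ ∀ w : ℂ, 0 < w.re →
    |w.im| ≤ Real.pi → ‖powerExpSeries s w - (Real.Gamma s : ℂ) * w ^ (-(s : ℂ))‖ ≤ C := by
  refine ⟨_, (norm_nonneg _).trans (norm_lipschitzTail_le hs (w := 0) (by simp [Real.pi_pos.le])),
    fun w hw hw' => ?_⟩
  rw [powerExpSeries_eq_add_lipschitzTail hs hw hw', add_sub_cancel_left]
  exact norm_lipschitzTail_le hs hw'

lemma summable_powerExpSeries (s : ℝ) {r : ℝ} (hr : 0 < r) :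
    Summable (fun m : ℕ => ((m + 1 : ℕ) : ℝ) ^ (s - 1) * Real.exp (-((m + 1 : ℕ) * r))) := by
  have : Summable (fun m : ℕ => (m : ℝ) ^ (s - 1) * Real.exp (-(m * r))) := by
    refine summable_of_isBigO_nat (Real.summable_nat_rpow.2 (show (-2 : ℝ) < -1 by norm_num)) ?_
    have h := (isLittleO_exp_neg_mul_rpow_atTop hr (-(s + 1))).isBigO
    have h2 : (fun t : ℝ => t ^ (s - 1) * Real.exp (-r * t)) =O[atTop]
        (fun t : ℝ => t ^ (s - 1) * t ^ (-(s + 1))) := (Asymptotics.isBigO_refl _ _).mul h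
    have h3 := h2.comp_tendsto tendsto_natCast_atTop_atTop
    refine (h3.congr_left fun m => ?_).trans ?_
    · simp [mul_comm]
    · refine Asymptotics.IsBigO.of_bound 1 ?_
      filter_upwards [eventually_gt_atTop 0] with m hm
      have : (0 : ℝ) < m := by exact_mod_cast hm
      rw [Function.comp, ← Real.rpow_add this, one_mul]
      apply le_of_eq; congr 2; ring
  exact (summable_nat_add_iff 1).2 this

lemma norm_powerExpSeries_term (s : ℝ) (w : ℂ) (m : ℕ) :
    ‖(((((m + 1 : ℕ) : ℝ) ^ (s - 1) : ℝ) : ℂ)) * Complex.exp (-(((m + 1 : ℕ) : ℂ) * w))‖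
      = ((m + 1 : ℕ) : ℝ) ^ (s - 1) * Real.exp (-((m + 1 : ℕ) * w.re)) := by
  rw [norm_mul, Complex.norm_real, Complex.norm_exp, Real.norm_of_nonneg (by positivity)]
  congr 2
  simp [Complex.mul_re]

lemma norm_powerExpSeries_le_re (s : ℝ) {w : ℂ} (hw : 0 < w.re) :
    ‖powerExpSeries s w‖ ≤ ‖powerExpSeries s (w.re : ℂ)‖ := by
  have h : powerExpSeries s (w.re : ℂ) = ((∑' m : ℕ,
      ((m + 1 : ℕ) : ℝ) ^ (s - 1) * Real.exp (-((m + 1 : ℕ) * w.re)) : ℝ) : ℂ) := by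
    rw [powerExpSeries, Complex.ofReal_tsum]
    push_cast
    rfl
  rw [h, Complex.norm_real]
  refine le_trans ?_ (le_abs_self _)
  exact tsum_of_norm_bounded (summable_powerExpSeries s hw).hasSum
    (fun m => (norm_powerExpSeries_term s w m).le)

/-- Since the coefficients are positive, `|F(w)| ≤ F(Re w)`; hence no condition on `Im w` is needed.
-/
lemma powerExpSeries_bound {s : ℝ} (hs : 1 < s) : ∃ C : ℝ, 0 ≤ C ∧ ∀ w : ℂ, 0 < w.re →
    ‖powerExpSeries s w‖ ≤ Real.Gamma s * w.re ^ (-s) + C := by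
  obtain ⟨C, hC, h⟩ := powerExpSeries_strip hs
  have hG := Real.Gamma_pos_of_pos (show 0 < s by linarith)
  refine ⟨C, hC, fun w hw => (norm_powerExpSeries_le_re s hw).trans ?_⟩
  have h1 := h (w.re : ℂ) (by simpa using hw) (by simp [Real.pi_pos.le])
  have h2 : ‖(Real.Gamma s : ℂ) * (w.re : ℂ) ^ (-(s : ℂ))‖ = Real.Gamma s * w.re ^ (-s) := by
    rw [norm_mul, Complex.norm_real, Real.norm_of_nonneg hG.le, ← Complex.ofReal_neg,
      Complex.norm_cpow_real, Complex.norm_real, Real.norm_of_nonneg hw.le]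
  have h3 := norm_sub_norm_le (powerExpSeries s (w.re : ℂ))
    ((Real.Gamma s : ℂ) * (w.re : ℂ) ^ (-(s : ℂ)))
  rw [h2] at h3
  linarith

/-- The estimate is needed at all points `jw`, so it cannot be restricted to small `w`. For `‖w‖ ≤
1` it is the Lipschitz bound of the tail; for `‖w‖ ≥ 1` the cone keeps `Re w ≥ 1/(1+K)`, every term
is bounded, and a constant is at most that constant times `‖w‖`. -/
lemma powerExpSeries_cone {s : ℝ} (hs : 1 < s) {K : ℝ} (hK : 0 ≤ K) : ∃ C : ℝ, 0 ≤ C ∧ ∀ w : ℂ,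
    0 < w.re → |w.im| ≤ K * w.re →
    ‖powerExpSeries s w - (Real.Gamma s : ℂ) * w ^ (-(s : ℂ)) - riemannZeta (1 - (s : ℂ))‖
      ≤ C * ‖w‖ := by
  obtain ⟨C, hC, h⟩ := powerExpSeries_bound hs
  have hG := Real.Gamma_pos_of_pos (show 0 < s by linarith)
  set S := ∑' n : ℤ, if n = 0 then (0 : ℝ) else |(n : ℝ)| ^ (-s) with hS
  have hS0 : 0 ≤ S := tsum_nonneg fun n => by split_ifs <;> positivity
  set B := Real.Gamma s * (1 / (1 + K)) ^ (-s) + C + Real.Gamma s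
    + ‖riemannZeta (1 - (s : ℂ))‖ with hB
  have hB0 : 0 ≤ B := by positivity
  refine ⟨max (Real.Gamma s * (s * S)) B, le_max_of_le_right hB0, fun w hw hw' => ?_⟩
  by_cases h1 : ‖w‖ ≤ 1
  · rw [powerExpSeries_eq_add_lipschitzTail hs hw
      ((Complex.abs_im_le_norm w).trans (h1.trans (by linarith [Real.pi_gt_three]))),
      add_sub_cancel_left]
    exact (norm_lipschitzTail_sub_le hs h1).trans
      (mul_le_mul_of_nonneg_right (le_max_left _ _) (norm_nonneg _))
  · have h1 : 1 ≤ ‖w‖ := (not_le.1 h1).le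
    have hre : 1 / (1 + K) ≤ w.re := by
      rw [div_le_iff₀ (by positivity)]
      have := Complex.norm_le_abs_re_add_abs_im w
      rw [abs_of_pos hw] at this
      nlinarith
    have h2 : ‖(Real.Gamma s : ℂ) * w ^ (-(s : ℂ))‖ ≤ Real.Gamma s := by
      rw [norm_mul, Complex.norm_real, Real.norm_of_nonneg hG.le, ← Complex.ofReal_neg,
        Complex.norm_cpow_real]
      exact mul_le_of_le_one_right hG.le
        (Real.rpow_le_one_of_one_le_of_nonpos h1 (by linarith))
    have h3 : Real.Gamma s * w.re ^ (-s) ≤ Real.Gamma s * (1 / (1 + K)) ^ (-s) :=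
      mul_le_mul_of_nonneg_left
        (Real.rpow_le_rpow_of_nonpos (by positivity) hre (by linarith)) hG.le
    have h4 := h w hw
    calc _ ≤ ‖powerExpSeries s w‖ + ‖(Real.Gamma s : ℂ) * w ^ (-(s : ℂ))‖
          + ‖riemannZeta (1 - (s : ℂ))‖ := (norm_sub_le _ _).trans (by gcongr; exact norm_sub_le _ _)
      _ ≤ B := by rw [hB]; linarith
      _ ≤ B * ‖w‖ := le_mul_of_one_le_right hB0 h1
      _ ≤ _ := mul_le_mul_of_nonneg_right (le_max_right _ _) (norm_nonneg _)

lemma powerExpSeries_sub_two_pi_I (s : ℝ) (w : ℂ) (n : ℤ) :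
    powerExpSeries s (w - 2 * Real.pi * Complex.I * n) = powerExpSeries s w := by
  refine tsum_congr fun m => ?_
  congr 1
  rw [Complex.exp_eq_exp_iff_exists_int]
  exact ⟨(m + 1) * n, by push_cast; ring⟩

/-! ### The logarithm of the Euler product and Cauchy's formula. -/

/-- The logarithm of the Euler product attached to `m ^ (s - 1)`. -/
noncomputable def eulerLog (s : ℝ) (x q : ℂ) : ℂ :=
  ∑' m : ℕ, ((((m + 1 : ℕ) : ℝ) ^ (s - 1) : ℝ) : ℂ) * -Complex.log (1 - x * q ^ (m + 1))

lemma norm_mul_pow_succ_le {x q : ℂ} {R : ℝ} (hx : ‖x‖ < 1) (hq : ‖q‖ ≤ R) (m : ℕ) :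
    ‖x * q ^ (m + 1)‖ ≤ R ^ (m + 1) := by
  rw [norm_mul, norm_pow]
  have h1 : ‖q‖ ^ (m + 1) ≤ R ^ (m + 1) := pow_le_pow_left₀ (norm_nonneg _) hq _
  exact (mul_le_of_le_one_left (by positivity) hx.le).trans h1

lemma norm_mul_pow_succ_le' {x q : ℂ} (hq : ‖q‖ < 1) (m : ℕ) : ‖x * q ^ (m + 1)‖ ≤ ‖x‖ := by
  rw [norm_mul, norm_pow]
  exact mul_le_of_le_one_right (norm_nonneg _) (pow_le_one₀ (norm_nonneg _) hq.le)

lemma norm_log_one_sub_mul_pow_le {x q : ℂ} {R : ℝ} (hx : ‖x‖ < 1) (hq : ‖q‖ ≤ R) (hR : R < 1)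
    (m : ℕ) : ‖Complex.log (1 - x * q ^ (m + 1))‖ ≤ R ^ (m + 1) * ((1 - ‖x‖)⁻¹ + 1) := by
  have h1 := norm_mul_pow_succ_le hx hq m
  have h2 := norm_mul_pow_succ_le' (x := x) (hq.trans_lt hR) m
  have h3 := Complex.norm_log_one_add_le (z := -(x * q ^ (m + 1)))
    (by rw [norm_neg]; exact h2.trans_lt hx)
  rw [norm_neg, ← sub_eq_add_neg] at h3
  refine h3.trans ?_
  set t := ‖x * q ^ (m + 1)‖
  have ht : 0 ≤ t := norm_nonneg _
  have h4 : (1 - t)⁻¹ ≤ (1 - ‖x‖)⁻¹ := inv_anti₀ (by linarith) (by linarith)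
  have h5 : 0 < (1 - t)⁻¹ := inv_pos.2 (by linarith)
  have h6 : t ^ 2 * (1 - t)⁻¹ / 2 ≤ t * (1 - ‖x‖)⁻¹ := by
    have : t ^ 2 ≤ t := by nlinarith
    have := mul_le_mul this h4 h5.le ht
    have : 0 ≤ t ^ 2 * (1 - t)⁻¹ := by positivity
    linarith
  have h7 : 0 < (1 - ‖x‖)⁻¹ := inv_pos.2 (by linarith)
  calc _ ≤ t * ((1 - ‖x‖)⁻¹ + 1) := by linarith
    _ ≤ _ := mul_le_mul_of_nonneg_right h1 (by positivity)

lemma summable_rpow_mul_pow_succ (s : ℝ) {R : ℝ} (hR0 : 0 < R) (hR : R < 1) :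
    Summable (fun m : ℕ => ((m + 1 : ℕ) : ℝ) ^ (s - 1) * R ^ (m + 1)) := by
  have := summable_powerExpSeries s (r := -Real.log R) (by
    have := Real.log_neg hR0 hR; linarith)
  refine this.congr fun m => ?_
  rw [mul_neg, neg_neg, Real.exp_nat_mul, Real.exp_log hR0]

lemma norm_eulerLog_term_le (s : ℝ) {x q : ℂ} {R : ℝ} (hx : ‖x‖ < 1) (hq : ‖q‖ ≤ R) (hR : R < 1)
    (m : ℕ) : ‖((((m + 1 : ℕ) : ℝ) ^ (s - 1) : ℝ) : ℂ) * -Complex.log (1 - x * q ^ (m + 1))‖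
      ≤ ((m + 1 : ℕ) : ℝ) ^ (s - 1) * R ^ (m + 1) * ((1 - ‖x‖)⁻¹ + 1) := by
  rw [norm_mul, norm_neg, Complex.norm_real, Real.norm_of_nonneg (by positivity), mul_assoc]
  exact mul_le_mul_of_nonneg_left (norm_log_one_sub_mul_pow_le hx hq hR m) (by positivity)

lemma summable_eulerLog (s : ℝ) {x q : ℂ} (hx : ‖x‖ < 1) (hq : ‖q‖ < 1) :
    Summable (fun m : ℕ =>
      ((((m + 1 : ℕ) : ℝ) ^ (s - 1) : ℝ) : ℂ) * -Complex.log (1 - x * q ^ (m + 1))) := by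
  obtain ⟨R, h1, h2⟩ := exists_between hq
  have hR : 0 < R := (norm_nonneg q).trans_lt h1
  exact Summable.of_norm_bounded ((summable_rpow_mul_pow_succ s hR h2).mul_right _)
    (norm_eulerLog_term_le s hx h1.le h2)

lemma one_sub_mul_pow_mem_slitPlane {x q : ℂ} (hx : ‖x‖ < 1) (hq : ‖q‖ < 1) (m : ℕ) :
    1 - x * q ^ (m + 1) ∈ Complex.slitPlane := by
  left
  have h1 := (Complex.abs_re_le_norm _).trans (norm_mul_pow_succ_le' (x := x) hq m)
  have := (abs_le.1 h1).2
  simp only [Complex.sub_re, Complex.one_re]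
  linarith

lemma eulerProduct_powerSeq (s : ℝ) {x q : ℂ} (hx : ‖x‖ < 1) (hq : ‖q‖ < 1) :
    eulerProduct (powerSeq s) x q = Complex.exp (eulerLog s x q) := by
  have h := (summable_eulerLog s hx hq).hasSum.cexp.tprod_eq
  rw [eulerProduct, eulerLog, ← h]
  refine tprod_congr fun m => ?_
  rw [Complex.cpow_def_of_ne_zero (Complex.slitPlane_ne_zero (one_sub_mul_pow_mem_slitPlane hx hq m)),
    powerSeq, Function.comp]
  congr 1
  ring

lemma differentiableOn_eulerLog (s : ℝ) {x : ℂ} (hx : ‖x‖ < 1) :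
    DifferentiableOn ℂ (eulerLog s x) (Metric.ball 0 1) := by
  intro q hq
  rw [mem_ball_zero_iff] at hq
  obtain ⟨R, h1, h2⟩ := exists_between hq
  have hR : 0 < R := (norm_nonneg q).trans_lt h1
  have hd : DifferentiableOn ℂ (eulerLog s x) (Metric.ball 0 R) := by
    refine Complex.differentiableOn_tsum_of_summable_norm
      ((summable_rpow_mul_pow_succ s hR h2).mul_right ((1 - ‖x‖)⁻¹ + 1)) (fun m z hz => ?_)
      Metric.isOpen_ball (fun m z hz => ?_)
    · rw [mem_ball_zero_iff] at hz
      refine (DifferentiableAt.const_mul (DifferentiableAt.neg (DifferentiableAt.clog ?_ ?_)) _).differentiableWithinAt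
      · fun_prop
      · exact one_sub_mul_pow_mem_slitPlane hx (hz.trans h2) m
    · rw [mem_ball_zero_iff] at hz
      exact norm_eulerLog_term_le s hx hz.le h2 m
  exact (hd.differentiableAt (Metric.isOpen_ball.mem_nhds (by simpa using h1))).differentiableWithinAt

open ComplexConjugate in
lemma eulerLog_conj (s : ℝ) {x : ℝ} {q : ℂ} (hx : |x| < 1) (hq : ‖q‖ < 1) :
    eulerLog s x (conj q) = conj (eulerLog s x q) := by
  rw [eulerLog, eulerLog, Complex.conj_tsum]
  refine tsum_congr fun m => ?_
  rw [map_mul, map_neg, Complex.conj_ofReal, ← Complex.log_conj]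
  · simp
  · exact Complex.slitPlane_arg_ne_pi (one_sub_mul_pow_mem_slitPlane (by simpa using hx) hq m)

/-- Expand `-log(1 - x q^m)` and interchange the two absolutely convergent sums. The index `j = 0`
is harmless, since `x^0 / 0 = 0`. -/
lemma hasSum_eulerLog (s : ℝ) {x w : ℂ} (hx : ‖x‖ < 1) (hw : 0 < w.re) :
    HasSum (fun j : ℕ => x ^ j / j * powerExpSeries s (j * w)) (eulerLog s x (Complex.exp (-w))) := by
  have hq : ‖Complex.exp (-w)‖ < 1 := by
    rw [Complex.norm_exp]; simpa using hw
  set f : ℕ × ℕ → ℂ := fun p => ((((p.1 + 1 : ℕ) : ℝ) ^ (s - 1) : ℝ) : ℂ)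
    * ((x * Complex.exp (-w) ^ (p.1 + 1)) ^ p.2 / p.2) with hf
  have hsum : Summable f := by
    have h1 := (summable_powerExpSeries s hw).mul_of_nonneg
      (summable_geometric_of_lt_one (norm_nonneg x) hx) (fun m => by positivity)
      (fun j => by positivity)
    refine Summable.of_norm_bounded h1 fun p => ?_
    simp only [hf]
    rw [norm_mul, Complex.norm_real, Real.norm_of_nonneg (by positivity), mul_assoc]
    refine mul_le_mul_of_nonneg_left ?_ (by positivity)
    rcases Nat.eq_zero_or_pos p.2 with h0 | h0
    · rw [h0]; simp; positivity
    have hj : (1 : ℝ) ≤ p.2 := by exact_mod_cast h0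
    rw [norm_div, Complex.norm_natCast, norm_pow, norm_mul, norm_pow, Complex.norm_exp, mul_pow,
      ← Real.exp_nat_mul]
    refine (div_le_self (by positivity) hj).trans ?_
    rw [mul_comm]
    refine mul_le_mul_of_nonneg_right ?_ (by positivity)
    rw [Complex.neg_re, mul_neg]
    refine (pow_le_pow_of_le_one (Real.exp_pos _).le ?_ h0).trans (by rw [pow_one])
    rw [Real.exp_le_one_iff]
    have : 0 ≤ ((p.1 + 1 : ℕ) : ℝ) * w.re := by positivity
    linarith
  have h1 : HasSum (fun m : ℕ => ((((m + 1 : ℕ) : ℝ) ^ (s - 1) : ℝ) : ℂ)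
      * -Complex.log (1 - x * Complex.exp (-w) ^ (m + 1))) (∑' p, f p) := by
    refine hsum.hasSum.prod_fiberwise fun m => ?_
    simp only [hf]
    exact (Complex.hasSum_taylorSeries_neg_log
      ((norm_mul_pow_succ_le' hq m).trans_lt hx)).mul_left _
  rw [eulerLog, h1.tsum_eq]
  have h2 : HasSum (f ∘ Equiv.prodComm ℕ ℕ) (∑' p, f p) :=
    (Equiv.hasSum_iff _).2 hsum.hasSum
  refine h2.prod_fiberwise fun j => ?_
  have h3 : ∀ m : ℕ, (f ∘ Equiv.prodComm ℕ ℕ) (j, m) = x ^ j / j *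
      (((((m + 1 : ℕ) : ℝ) ^ (s - 1) : ℝ) : ℂ) * Complex.exp (-(((m + 1 : ℕ) : ℂ) * (j * w)))) := by
    intro m
    simp only [hf, Function.comp, Equiv.prodComm_apply, Prod.swap]
    rw [mul_pow, ← Complex.exp_nat_mul, ← Complex.exp_nat_mul]
    rw [show (j : ℂ) * (((m + 1 : ℕ) : ℂ) * -w) = -(((m + 1 : ℕ) : ℂ) * (j * w)) by ring]
    ring
  simp only [h3]
  have hs2 : Summable (fun m : ℕ => x ^ j / j *
      (((((m + 1 : ℕ) : ℝ) ^ (s - 1) : ℝ) : ℂ)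
        * Complex.exp (-(((m + 1 : ℕ) : ℂ) * (j * w))))) := by
    have := h2.summable.prod_factor j
    simpa only [h3] using this
  convert hs2.hasSum using 1
  rw [tsum_mul_left, powerExpSeries]

open ComplexConjugate in
/-- Cauchy's formula for the coefficients of the Euler product, on the circle of radius `e ^ (-r)`,
folded by complex conjugation. -/
lemma eulerCoeff_eq_integral (s : ℝ) {x : ℝ} (hx : |x| < 1) (n : ℕ) {r : ℝ} (hr : 0 < r) :
    eulerCoeff (powerSeq s) n x = ((1 / Real.pi * (∫ θ in (0 : ℝ)..Real.pi,
      Complex.exp (eulerLog s x (Complex.exp (-(r + θ * Complex.I)))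
        + n * (r + θ * Complex.I))).re : ℝ) : ℂ) := by
  have hx' : ‖(x : ℂ)‖ < 1 := by simpa using hx
  set R := Real.exp (-r) with hR
  have hR0 : 0 < R := Real.exp_pos _
  have hR1 : R < 1 := by rw [hR, Real.exp_lt_one_iff]; linarith
  set f : ℂ → ℂ := fun q => Complex.exp (eulerLog s x q) with hf
  have hfd : DifferentiableOn ℂ f (Metric.ball 0 1) := (differentiableOn_eulerLog s hx').cexp
  have hfe : (fun q => eulerProduct (powerSeq s) x q) =ᶠ[𝓝 0] f := by
    filter_upwards [Metric.ball_mem_nhds (0 : ℂ) one_pos] with q hq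
    exact eulerProduct_powerSeq s hx' (by simpa using hq)
  have hdc : DiffContOnCl ℂ f (Metric.ball 0 R) := by
    refine DifferentiableOn.diffContOnCl ?_
    rw [closure_ball _ hR0.ne']
    exact hfd.mono (Metric.closedBall_subset_ball hR1)
  set H : ℝ → ℂ := fun θ => Complex.exp (eulerLog s x (Complex.exp (-(r + θ * Complex.I)))
        + n * (r + θ * Complex.I)) with hH
  have hq : ∀ θ : ℝ, ‖Complex.exp (-(r + θ * Complex.I))‖ < 1 := by
    intro θ
    rw [Complex.norm_exp]
    simpa using hr
  have hHc : Continuous H := by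
    have : Continuous fun θ : ℝ => eulerLog s x (Complex.exp (-(r + θ * Complex.I))) :=
      (differentiableOn_eulerLog s hx').continuousOn.comp_continuous (by fun_prop)
        (fun θ => by simpa using hq θ)
    simp only [hH]
    fun_prop
  have hHconj : ∀ θ : ℝ, H (-θ) = conj (H θ) := by
    intro θ
    simp only [hH]
    rw [← Complex.exp_conj, map_add, ← eulerLog_conj s hx (hq θ), ← Complex.exp_conj]
    simp
  have hHper : Function.Periodic H (2 * Real.pi) := by
    intro θ
    simp only [hH]
    have e1 : Complex.exp (-(r + ((θ + 2 * Real.pi : ℝ) : ℂ) * Complex.I))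
        = Complex.exp (-(r + θ * Complex.I)) := by
      rw [Complex.exp_eq_exp_iff_exists_int]
      exact ⟨-1, by push_cast; ring⟩
    rw [e1, Complex.exp_eq_exp_iff_exists_int]
    exact ⟨n, by push_cast; ring⟩
  have hcirc := hdc.circleIntegral_one_div_sub_center_pow_smul hR0 n
  -- The standard circle map at angle `θ` is `e^(-w)` with `w = r - iθ`, hence the argument `-θ`.
  have hpt : ∀ θ : ℝ, deriv (circleMap 0 R) θ • ((1 / (circleMap 0 R θ - 0) ^ (n + 1)) •
      f (circleMap 0 R θ)) = Complex.I * H (-θ) := by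
    intro θ
    have hz : circleMap 0 R θ = Complex.exp (-(r + ((-θ : ℝ) : ℂ) * Complex.I)) := by
      rw [circleMap, hR, Complex.ofReal_exp, zero_add, ← Complex.exp_add]
      congr 1; push_cast; ring
    have hz0 : circleMap 0 R θ ≠ 0 := by rw [hz]; exact Complex.exp_ne_zero _
    rw [deriv_circleMap, sub_zero, smul_eq_mul, smul_eq_mul]
    have : H (-θ) = f (circleMap 0 R θ) / (circleMap 0 R θ) ^ n := by
      simp only [hH, hf]
      rw [hz, Complex.exp_add, ← Complex.exp_nat_mul, div_eq_mul_inv, ← Complex.exp_neg]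
      congr 2; ring
    rw [this]
    field_simp
    ring
  have hint : (∮ z in C(0, R), (1 / (z - 0) ^ (n + 1)) • f z)
      = Complex.I * ∫ θ in (0 : ℝ)..(2 * Real.pi), H (-θ) := by
    rw [circleIntegral]
    simp only [hpt]
    rw [intervalIntegral.integral_const_mul]
  have hI : ∫ θ in (0 : ℝ)..(2 * Real.pi), H (-θ)
      = ((2 * (∫ θ in (0 : ℝ)..Real.pi, H θ).re : ℝ) : ℂ) := by
    rw [intervalIntegral.integral_comp_neg]
    -- Periodicity moves the interval to `[-π, π]`, whose two halves are complex conjugates of each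
    -- other.
    have h1 := hHper.intervalIntegral_add_eq (-(2 * Real.pi)) (-Real.pi)
    rw [neg_add_cancel, show -Real.pi + 2 * Real.pi = Real.pi by ring] at h1
    rw [neg_zero, h1, ← intervalIntegral.integral_add_adjacent_intervals
      (b := 0) (hHc.intervalIntegrable _ _) (hHc.intervalIntegrable _ _)]
    have h2 : ∫ θ in (-Real.pi)..0, H θ = ∫ θ in (0 : ℝ)..Real.pi, H (-θ) := by
      rw [intervalIntegral.integral_comp_neg, neg_zero]
    rw [h2]
    simp only [hHconj]
    rw [intervalIntegral.integral_of_le Real.pi_pos.le,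
      intervalIntegral.integral_of_le Real.pi_pos.le, integral_conj, add_comm, Complex.add_conj]
  have hpi : (Real.pi : ℂ) ≠ 0 := by exact_mod_cast Real.pi_ne_zero
  have hfac : (n.factorial : ℂ) ≠ 0 := by exact_mod_cast n.factorial_ne_zero
  rw [hint, hI] at hcirc
  rw [eulerCoeff, hfe.iteratedDeriv_eq n]
  rw [smul_eq_mul] at hcirc
  have h3 : iteratedDeriv n f 0 / (n.factorial : ℂ)
      = (2 * Real.pi * Complex.I / n.factorial * iteratedDeriv n f 0) / (2 * Real.pi * Complex.I) := by
    field_simp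
  rw [h3, ← hcirc]
  push_cast
  field_simp

/-! ### Inequalities for the polylogarithm on the real axis. -/

/-- The polylogarithm of real order at a real point. -/
noncomputable def realPolyLog (σ t : ℝ) : ℝ := ∑' m : ℕ, t ^ (m + 1) / ((m + 1 : ℕ) : ℝ) ^ σ

lemma one_le_natCast_succ_rpow {σ : ℝ} (hσ : 0 ≤ σ) (m : ℕ) : 1 ≤ ((m + 1 : ℕ) : ℝ) ^ σ :=
  Real.one_le_rpow (by push_cast; linarith [(Nat.cast_nonneg m : (0 : ℝ) ≤ m)]) hσ

lemma norm_realPolyLog_term_le {σ : ℝ} (hσ : 0 ≤ σ) {t r : ℝ} (ht : |t| ≤ r) (m : ℕ) :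
    ‖t ^ (m + 1) / ((m + 1 : ℕ) : ℝ) ^ σ‖ ≤ r ^ (m + 1) := by
  have h := one_le_natCast_succ_rpow hσ m
  rw [norm_div, norm_pow, Real.norm_of_nonneg (by linarith : 0 ≤ ((m + 1 : ℕ) : ℝ) ^ σ)]
  exact (div_le_self (by positivity) h).trans (pow_le_pow_left₀ (abs_nonneg _) ht _)

lemma summable_pow_succ {r : ℝ} (h0 : 0 ≤ r) (hr : r < 1) : Summable (fun m : ℕ => r ^ (m + 1)) :=
  (summable_nat_add_iff 1).2 (summable_geometric_of_lt_one h0 hr)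

lemma summable_realPolyLog {σ : ℝ} (hσ : 0 ≤ σ) {t : ℝ} (ht : |t| < 1) :
    Summable (fun m : ℕ => t ^ (m + 1) / ((m + 1 : ℕ) : ℝ) ^ σ) :=
  Summable.of_norm_bounded (summable_pow_succ (abs_nonneg t) ht)
    (norm_realPolyLog_term_le hσ le_rfl)

lemma polyLog_ofReal (s x : ℝ) : polyLog ((s : ℂ) + 1) (x : ℂ) = (realPolyLog (s + 1) x : ℂ) := by
  rw [polyLog, realPolyLog, Complex.ofReal_tsum]
  refine tsum_congr fun m => ?_
  rw [Complex.ofReal_div, Complex.ofReal_cpow (by positivity)]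
  push_cast
  rfl

@[simp] lemma realPolyLog_zero (σ : ℝ) : realPolyLog σ 0 = 0 := by simp [realPolyLog]

lemma continuousOn_realPolyLog {σ : ℝ} (hσ : 0 ≤ σ) : ContinuousOn (realPolyLog σ) (Ioo (-1) 1) := by
  intro t ht
  obtain ⟨r, h1, h2⟩ := exists_between (abs_lt.2 ht)
  have hc : ContinuousOn (realPolyLog σ) (Ioo (-r) r) := by
    refine continuousOn_tsum (fun m => by fun_prop)
      (summable_pow_succ ((abs_nonneg t).trans h1.le) h2) (fun m y hy => ?_)
    exact norm_realPolyLog_term_le hσ (abs_lt.2 hy).le m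
  exact (hc.continuousAt (Ioo_mem_nhds (abs_lt.1 h1).1 (abs_lt.1 h1).2)).continuousWithinAt

lemma realPolyLog_eq_mul_tsum (σ t : ℝ) :
    realPolyLog σ t = t * ∑' m : ℕ, t ^ m / ((m + 1 : ℕ) : ℝ) ^ σ := by
  rw [realPolyLog, ← tsum_mul_left]
  exact tsum_congr fun m => by ring

lemma summable_pow_div_rpow {σ : ℝ} (hσ : 0 ≤ σ) {t : ℝ} (ht : |t| < 1) :
    Summable (fun m : ℕ => t ^ m / ((m + 1 : ℕ) : ℝ) ^ σ) := by
  refine Summable.of_norm_bounded (summable_geometric_of_lt_one (abs_nonneg t) ht) fun m => ?_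
  have h := one_le_natCast_succ_rpow hσ m
  rw [norm_div, norm_pow, Real.norm_of_nonneg (by linarith : 0 ≤ ((m + 1 : ℕ) : ℝ) ^ σ)]
  exact div_le_self (by positivity) h

lemma le_realPolyLog {σ : ℝ} (hσ : 0 ≤ σ) {t : ℝ} (ht0 : 0 ≤ t) (ht : t < 1) :
    t ≤ realPolyLog σ t := by
  have h := (summable_realPolyLog hσ (by rwa [abs_of_nonneg ht0])).le_tsum 0
    (fun m _ => by positivity)
  simpa [realPolyLog] using h

/-- `Li_σ(t) / t` is monotone on the positive reals, in a form without division. -/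
lemma mul_realPolyLog_le {σ : ℝ} (hσ : 0 ≤ σ) {t u : ℝ} (ht0 : 0 ≤ t) (htu : t ≤ u) (hu : u < 1) :
    u * realPolyLog σ t ≤ t * realPolyLog σ u := by
  rw [realPolyLog_eq_mul_tsum, realPolyLog_eq_mul_tsum, mul_left_comm]
  refine mul_le_mul_of_nonneg_left ?_ ht0
  refine mul_le_mul_of_nonneg_left ?_ (ht0.trans htu)
  refine (summable_pow_div_rpow hσ (by rw [abs_of_nonneg ht0]; linarith)).tsum_le_tsum
    (fun m => ?_) (summable_pow_div_rpow hσ (by rwa [abs_of_nonneg (ht0.trans htu)]))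
  gcongr

lemma realPolyLog_mono {σ : ℝ} (hσ : 0 ≤ σ) {t u : ℝ} (ht0 : 0 ≤ t) (htu : t ≤ u) (hu : u < 1) :
    realPolyLog σ t ≤ realPolyLog σ u := by
  refine (summable_realPolyLog hσ (by rw [abs_of_nonneg ht0]; linarith)).tsum_le_tsum
    (fun m => ?_) (summable_realPolyLog hσ (by rwa [abs_of_nonneg (ht0.trans htu)]))
  gcongr

lemma neg_realPolyLog_neg (σ t : ℝ) :
    -realPolyLog σ (-t) = ∑' m : ℕ, (-1) ^ m * (t ^ (m + 1) / ((m + 1 : ℕ) : ℝ) ^ σ) := by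
  rw [realPolyLog, ← tsum_neg]
  refine tsum_congr fun m => ?_
  rw [neg_pow]; ring

lemma antitone_pow_div_rpow {σ : ℝ} (hσ : 0 ≤ σ) {t : ℝ} (ht0 : 0 ≤ t) (ht : t ≤ 1) :
    Antitone (fun m : ℕ => t ^ (m + 1) / ((m + 1 : ℕ) : ℝ) ^ σ) := by
  refine antitone_nat_of_succ_le fun m => ?_
  have h1 : t ^ (m + 1 + 1) ≤ t ^ (m + 1) := pow_le_pow_of_le_one ht0 ht (by omega)
  gcongr
  linarith

lemma tendsto_neg_realPolyLog_neg {σ : ℝ} (hσ : 0 ≤ σ) {t : ℝ} (ht0 : 0 ≤ t) (ht : t < 1) :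
    Tendsto (fun n => ∑ m ∈ Finset.range n, (-1) ^ m * (t ^ (m + 1) / ((m + 1 : ℕ) : ℝ) ^ σ))
      atTop (𝓝 (-realPolyLog σ (-t))) := by
  rw [neg_realPolyLog_neg]
  refine Summable.tendsto_sum_tsum_nat ?_
  refine Summable.of_norm ?_
  have := (summable_realPolyLog hσ (t := t) (by rwa [abs_of_nonneg ht0])).norm
  refine this.congr fun m => ?_
  simp

lemma neg_realPolyLog_neg_le {σ : ℝ} (hσ : 0 ≤ σ) {t : ℝ} (ht0 : 0 ≤ t) (ht : t < 1) :
    -realPolyLog σ (-t) ≤ t := by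
  have := (antitone_pow_div_rpow hσ ht0 ht.le).tendsto_le_alternating_series
    (tendsto_neg_realPolyLog_neg hσ ht0 ht) 0
  simpa using this

/-- The alternating series is at least its first two terms `t - t²/2^σ`, and `2^σ ≥ 2`, `t² ≤ t`. -/
lemma half_le_neg_realPolyLog_neg {σ : ℝ} (hσ : 1 ≤ σ) {t : ℝ} (ht0 : 0 ≤ t) (ht : t < 1) :
    t / 2 ≤ -realPolyLog σ (-t) := by
  have h := (antitone_pow_div_rpow (by linarith : 0 ≤ σ) ht0 ht.le).alternating_series_le_tendsto
    (tendsto_neg_realPolyLog_neg (by linarith) ht0 ht) 1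
  simp [Finset.sum_range_succ] at h
  have h2 : (2 : ℝ) ≤ 2 ^ σ := by
    simpa using Real.rpow_le_rpow_of_exponent_le (by norm_num : (1 : ℝ) ≤ 2) hσ
  norm_num at h
  have h3 : t ^ 2 / 2 ^ σ ≤ t / 2 := by
    have : t ^ 2 ≤ t := by nlinarith
    gcongr
  linarith

lemma mul_pow_mul_sub_le_mul_pow_sub {t u : ℝ} (ht0 : 0 ≤ t) (htu : t ≤ u) (j : ℕ) :
    j * t ^ j * (u - t) ≤ t * (u ^ j - t ^ j) := by
  induction j with
  | zero => simp
  | succ j ih =>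
    have h1 : u * (j * t ^ j * (u - t)) ≤ u * (t * (u ^ j - t ^ j)) :=
      mul_le_mul_of_nonneg_left ih (ht0.trans htu)
    have h2 : t * (j * t ^ j * (u - t)) ≤ u * (j * t ^ j * (u - t)) := by
      refine mul_le_mul_of_nonneg_right htu ?_
      have := sub_nonneg.2 htu
      positivity
    push_cast
    ring_nf at h1 h2 ⊢
    linarith

/-- For `j ≥ 1` this says `∫_t^u y^j dy ≤ ∫_t^u y^(j-1) dy`, true as `u ≤ 1`. The code argues
algebraically instead. -/
lemma mul_pow_succ_sub_le {t u : ℝ} (ht0 : 0 ≤ t) (htu : t ≤ u) (hu : u ≤ 1) (j : ℕ) :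
    j * (u ^ (j + 1) - t ^ (j + 1)) ≤ (j + 1) * (u ^ j - t ^ j) := by
  have h1 := mul_pow_mul_sub_le_mul_pow_sub ht0 htu j
  have h2 : 0 ≤ u ^ j - t ^ j := sub_nonneg.2 (pow_le_pow_left₀ ht0 htu j)
  have h3 : 0 ≤ (1 - u) * (u ^ j - t ^ j) := mul_nonneg (by linarith) h2
  have h4 : 0 ≤ (1 - t) * (u ^ j - t ^ j) := mul_nonneg (by linarith) h2
  have h5 : (0 : ℝ) ≤ j * ((1 - u) * (u ^ j - t ^ j)) := by positivity
  have e : (j : ℝ) * (u ^ (j + 1) - t ^ (j + 1)) = j * u * (u ^ j - t ^ j) + j * t ^ j * (u - t) := by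
    ring
  rw [e]
  nlinarith

/-- The numerator grows by a factor at most `(m+2)/(m+1)`, while the denominator grows by
`((m+3)/(m+2))^σ`, which for `σ ≥ 2` is at least as large. Leibniz' criterion can then be applied to
the difference of two alternating series. -/
lemma antitone_pow_sub_div_rpow {σ : ℝ} (hσ : 2 ≤ σ) {t u : ℝ} (ht0 : 0 ≤ t) (htu : t ≤ u)
    (hu : u ≤ 1) :
    Antitone (fun m : ℕ => (u ^ (m + 1) - t ^ (m + 1)) / ((m + 2 : ℕ) : ℝ) ^ σ) := by
  refine antitone_nat_of_succ_le fun m => ?_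
  have hm : (0 : ℝ) ≤ m := Nat.cast_nonneg m
  have hd : 0 ≤ u ^ (m + 1) - t ^ (m + 1) := sub_nonneg.2 (pow_le_pow_left₀ ht0 htu _)
  have h1 := mul_pow_succ_sub_le ht0 htu hu (m + 1)
  push_cast at h1
  have h3 : ((m : ℝ) + 2) / (m + 1) ≤ ((m + 3 : ℝ) / (m + 2)) ^ σ := by
    have : ((m + 3 : ℝ) / (m + 2)) ^ (2 : ℝ) ≤ ((m + 3 : ℝ) / (m + 2)) ^ σ := by
      refine Real.rpow_le_rpow_of_exponent_le ?_ hσ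
      rw [one_le_div (by positivity)]
      linarith
    refine le_trans ?_ this
    rw [Real.rpow_two, div_pow, div_le_div_iff₀ (by positivity) (by positivity)]
    nlinarith
  rw [Real.div_rpow (by positivity) (by positivity), div_le_div_iff₀ (by positivity) (by positivity)]
    at h3
  rw [div_le_div_iff₀ (by positivity) (by positivity)]
  push_cast
  rw [show (m : ℝ) + 1 + 2 = m + 3 by ring]
  have hA : (0 : ℝ) < (m + 2 : ℝ) ^ σ := by positivity
  have hB : (0 : ℝ) < (m + 3 : ℝ) ^ σ := by positivity
  have hm1 : (0 : ℝ) < m + 1 := by positivity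
  refine le_of_mul_le_mul_left ?_ hm1
  calc ((m : ℝ) + 1) * ((u ^ (m + 1 + 1) - t ^ (m + 1 + 1)) * (m + 2 : ℝ) ^ σ)
      = ((m + 1) * (u ^ (m + 1 + 1) - t ^ (m + 1 + 1))) * (m + 2 : ℝ) ^ σ := by ring
    _ ≤ ((m + 1 + 1) * (u ^ (m + 1) - t ^ (m + 1))) * (m + 2 : ℝ) ^ σ :=
        mul_le_mul_of_nonneg_right h1 hA.le
    _ = (u ^ (m + 1) - t ^ (m + 1)) * ((m + 2) * (m + 2 : ℝ) ^ σ) := by ring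
    _ ≤ (u ^ (m + 1) - t ^ (m + 1)) * ((m + 3 : ℝ) ^ σ * (m + 1)) :=
        mul_le_mul_of_nonneg_left h3 hd
    _ = _ := by ring

/-- `-Li_σ(-t) / t` is antitone on `(0, 1)` for `σ ≥ 2`, in a form without division. -/
lemma mul_neg_realPolyLog_neg_le {σ : ℝ} (hσ : 2 ≤ σ) {t u : ℝ} (ht0 : 0 ≤ t) (htu : t ≤ u)
    (hu : u < 1) : t * -realPolyLog σ (-u) ≤ u * -realPolyLog σ (-t) := by
  have hu0 := ht0.trans htu
  have hS : ∀ v : ℝ, 0 ≤ v → v < 1 → Summable (fun m : ℕ => (-v) ^ m / ((m + 1 : ℕ) : ℝ) ^ σ) :=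
    fun v h0 h1 => summable_pow_div_rpow (by linarith) (by rwa [abs_neg, abs_of_nonneg h0])
  have e : ∀ v : ℝ, -realPolyLog σ (-v) = v * ∑' m : ℕ, (-v) ^ m / ((m + 1 : ℕ) : ℝ) ^ σ := by
    intro v
    rw [realPolyLog_eq_mul_tsum]; ring
  rw [e, e, mul_left_comm]
  refine mul_le_mul_of_nonneg_left (mul_le_mul_of_nonneg_left ?_ ht0) hu0
  -- The difference has no term in degree zero; what remains is an alternating series with
  -- decreasing coefficients, so it is non-negative.
  rw [← sub_nonneg, ← (hS t ht0 (by linarith)).tsum_sub (hS u hu0 hu)]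
  have hD := (hS t ht0 (by linarith)).sub (hS u hu0 hu)
  rw [hD.tsum_eq_zero_add]
  have hD' := (summable_nat_add_iff 1).2 hD
  have hterm : ∀ m : ℕ, (-t) ^ (m + 1) / ((m + 1 + 1 : ℕ) : ℝ) ^ σ
      - (-u) ^ (m + 1) / ((m + 1 + 1 : ℕ) : ℝ) ^ σ
      = (-1) ^ m * ((u ^ (m + 1) - t ^ (m + 1)) / ((m + 2 : ℕ) : ℝ) ^ σ) := by
    intro m
    rw [neg_pow t, neg_pow u]; ring
  have ht := hD'.tendsto_sum_tsum_nat
  simp only [hterm] at ht ⊢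
  have := (antitone_pow_sub_div_rpow hσ ht0 htu hu.le).alternating_series_le_tendsto ht 0
  simpa using this

/-! ### The functions `L_{h,k}` at real points, and the two phases. -/

lemma ofReal_powerL_arg (s x : ℝ) (k : ℕ) :
    Complex.Gamma ((s : ℂ) + 1) * polyLog ((s : ℂ) + 1) ((x : ℂ) ^ k)
      = ((Real.Gamma (s + 1) * realPolyLog (s + 1) (x ^ k) : ℝ) : ℂ) := by
  rw [← Complex.ofReal_pow, polyLog_ofReal, ← Complex.ofReal_one, ← Complex.ofReal_add,
    Complex.Gamma_ofReal, ← Complex.ofReal_mul]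

lemma powerL_of_nonneg {s : ℝ} (hs : 0 < s) {x : ℝ} (h k : ℕ)
    (hx : 0 ≤ realPolyLog (s + 1) (x ^ k)) :
    powerL s h k x
      = ((1 / k * (Real.Gamma (s + 1) * realPolyLog (s + 1) (x ^ k)) ^ (1 / (s + 1)) : ℝ) : ℂ) := by
  have hG := (Real.Gamma_pos_of_pos (show 0 < s + 1 by linarith)).le
  rw [powerL, ofReal_powerL_arg, Complex.ofReal_mul (1 / (k : ℝ)), Complex.ofReal_cpow (by positivity)]
  push_cast
  rfl

/-- The principal root of a negative number has argument `π/(s+1)`; this is the same angle as that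
of the saddle point. -/
lemma powerL_of_neg {s : ℝ} (hs : 0 < s) {x : ℝ} (h k : ℕ)
    (hx : realPolyLog (s + 1) (x ^ k) < 0) :
    powerL s h k x = ((1 / k * (Real.Gamma (s + 1) * -realPolyLog (s + 1) (x ^ k)) ^ (1 / (s + 1)) : ℝ) : ℂ)
        * Complex.exp (((Real.pi / (s + 1) : ℝ) : ℂ) * Complex.I) := by
  have hG := Real.Gamma_pos_of_pos (show 0 < s + 1 by linarith)
  have hp : 0 < Real.Gamma (s + 1) * -realPolyLog (s + 1) (x ^ k) := mul_pos hG (by linarith)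
  have e : ((Real.Gamma (s + 1) * realPolyLog (s + 1) (x ^ k) : ℝ) : ℂ)
      = ((Real.Gamma (s + 1) * -realPolyLog (s + 1) (x ^ k) : ℝ) : ℂ) * (-1) := by
    push_cast; ring
  rw [powerL, ofReal_powerL_arg, e, ofReal_mul_cpow hp (by simp),
    Complex.cpow_def_of_ne_zero (by simp : (-1 : ℂ) ≠ 0), Complex.log_neg_one, Complex.ofReal_mul (1 / (k : ℝ)),
    Complex.ofReal_cpow hp.le,
    show (Real.pi : ℂ) * Complex.I * (1 / ((s : ℂ) + 1)) = ((Real.pi / (s + 1) : ℝ) : ℂ) * Complex.I by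
      push_cast; ring]
  push_cast
  rw [mul_assoc]

lemma powerL_re_of_neg {s : ℝ} (hs : 0 < s) {x : ℝ} (h k : ℕ)
    (hx : realPolyLog (s + 1) (x ^ k) < 0) :
    (powerL s h k x).re = 1 / k * (Real.Gamma (s + 1) * -realPolyLog (s + 1) (x ^ k)) ^ (1 / (s + 1))
      * Real.cos (Real.pi / (s + 1)) := by
  rw [powerL_of_neg hs h k hx, Complex.re_ofReal_mul, Complex.exp_ofReal_mul_I_re]

/-- A continuous single crossing of two functions on `(-1, 0)` happens at a threshold. -/
lemma exists_threshold_of_single_crossing {p q : ℝ → ℝ} (hp : ContinuousOn p (Ioo (-1) 0))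
    (hq : ContinuousOn q (Ioo (-1) 0))
    (hcross : ∀ x ∈ Ioo (-1 : ℝ) 0, ∀ y ∈ Ioo (-1 : ℝ) 0, x < y → q x ≤ p x → q y < p y) :
    ∃ c ∈ Icc (-1 : ℝ) 0, ∀ x ∈ Ioo (-1 : ℝ) 0, (q x < p x ↔ c < x) ∧ (p x < q x ↔ x < c) := by
  -- Adjoining `0` makes the set non-empty and yields the threshold `0` when `q < p` never occurs.
  set S : Set ℝ := {x | x ∈ Ioo (-1 : ℝ) 0 ∧ q x < p x} ∪ {0} with hS
  have hSne : S.Nonempty := ⟨0, Or.inr rfl⟩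
  have hSlb : ∀ y ∈ S, (-1 : ℝ) ≤ y := by
    rintro y (hy | rfl)
    · exact hy.1.1.le
    · norm_num
  have hSb : BddBelow S := ⟨-1, hSlb⟩
  have hcm : sInf S ∈ Icc (-1 : ℝ) 0 := ⟨le_csInf hSne hSlb, csInf_le hSb (Or.inr rfl)⟩
  have hgt : ∀ x ∈ Ioo (-1 : ℝ) 0, sInf S < x → q x < p x := by
    intro x hx hcx
    obtain ⟨y, hy, hyx⟩ := exists_lt_of_csInf_lt hSne hcx
    rcases hy with hy | rfl
    · exact hcross y hy.1 x hx hyx hy.2.le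
    · exact absurd hx.2 (not_lt.2 hyx.le)
  have hle : ∀ x ∈ Ioo (-1 : ℝ) 0, q x ≤ p x → sInf S ≤ x := by
    intro x hx hqp
    -- Only `q x ≤ p x` is known, so `x` itself need not be in `S`; but every larger point of the
    -- interval is, by the crossing hypothesis.
    refine le_of_forall_gt_imp_ge_of_dense fun y hy => ?_
    rcases lt_or_ge y 0 with h0 | h0
    · have hy' : y ∈ Ioo (-1 : ℝ) 0 := ⟨hx.1.trans hy, h0⟩
      exact csInf_le hSb (Or.inl ⟨hy', hcross x hx y hy' hy hqp⟩)
    · exact hcm.2.trans h0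
  have hcq : sInf S ∈ Ioo (-1 : ℝ) 0 → q (sInf S) = p (sInf S) := by
    intro hc
    have hpc := hp.continuousAt (Ioo_mem_nhds hc.1 hc.2)
    have hqc := hq.continuousAt (Ioo_mem_nhds hc.1 hc.2)
    refine le_antisymm ?_ ?_
    · refine le_of_tendsto_of_tendsto (b := 𝓝[>] (sInf S)) (hqc.mono_left nhdsWithin_le_nhds)
        (hpc.mono_left nhdsWithin_le_nhds) ?_
      filter_upwards [Ioo_mem_nhdsGT hc.2] with x hx
      exact (hgt x ⟨hc.1.trans hx.1, hx.2⟩ hx.1).le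
    · refine le_of_tendsto_of_tendsto (b := 𝓝[<] (sInf S)) (hpc.mono_left nhdsWithin_le_nhds)
        (hqc.mono_left nhdsWithin_le_nhds) ?_
      filter_upwards [Ioo_mem_nhdsLT hc.1] with x hx
      by_contra hlt
      exact absurd (hle x ⟨hx.1, hx.2.trans hc.2⟩ (not_le.1 hlt).le) (not_le.2 hx.2)
  refine ⟨sInf S, hcm, fun x hx => ⟨⟨fun h => ?_, hgt x hx⟩, ⟨fun h => ?_, fun h => ?_⟩⟩⟩
  · refine lt_of_le_of_ne (hle x hx h.le) fun he => ?_
    rw [← he] at h hx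
    exact absurd (hcq hx) h.ne
  · by_contra hxc
    rcases (not_lt.1 hxc).lt_or_eq with h1 | h1
    · exact absurd (hgt x hx h1) (not_lt.2 h.le)
    · rw [← h1] at h hx
      exact absurd (hcq hx) h.ne'
  · by_contra hlt
    exact absurd (hle x hx (not_lt.1 hlt)) (not_le.2 h)

/-- `Γ(s + 1) Li_{s + 1}(y)`. -/
noncomputable def gammaPolyLog (s y : ℝ) : ℝ := Real.Gamma (s + 1) * realPolyLog (s + 1) y

section
variable {s : ℝ} (hs : 0 < s)
include hs

lemma gammaPolyLog_pos {y : ℝ} (h0 : 0 < y) (h1 : y < 1) : 0 < gammaPolyLog s y :=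
  mul_pos (Real.Gamma_pos_of_pos (by linarith))
    (h0.trans_le (le_realPolyLog (by linarith) h0.le h1))

lemma gammaPolyLog_neg {y : ℝ} (h0 : -1 < y) (h1 : y < 0) : gammaPolyLog s y < 0 := by
  refine mul_neg_of_pos_of_neg (Real.Gamma_pos_of_pos (by linarith)) ?_
  have := half_le_neg_realPolyLog_neg (σ := s + 1) (by linarith) (t := -y) (by linarith) (by linarith)
  rw [neg_neg] at this
  linarith

lemma powerL_re_pos {x : ℝ} (h k : ℕ) (h0 : 0 < x ^ k) (h1 : x ^ k < 1) :
    (powerL s h k x).re = 1 / k * gammaPolyLog s (x ^ k) ^ (1 / (s + 1)) := by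
  have := gammaPolyLog_pos hs h0 h1
  rw [powerL_of_nonneg hs h k, Complex.ofReal_re, gammaPolyLog]
  exact h0.le.trans (le_realPolyLog (by linarith) h0.le h1)

lemma powerL_re_neg {x : ℝ} (h k : ℕ) (h0 : -1 < x ^ k) (h1 : x ^ k < 0) :
    (powerL s h k x).re = 1 / k * (-gammaPolyLog s (x ^ k)) ^ (1 / (s + 1))
      * Real.cos (Real.pi / (s + 1)) := by
  have h2 := gammaPolyLog_neg hs h0 h1
  have hG := Real.Gamma_pos_of_pos (show 0 < s + 1 by linarith)
  rw [powerL_re_of_neg hs h k, gammaPolyLog, mul_neg]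
  exact (pos_iff_neg_of_mul_neg h2).1 hG

/-- On the positive axis `Re L_{1,k}` is strictly decreasing at `k = 1`. -/
lemma powerL_re_lt_of_pos {x : ℝ} (hx0 : 0 < x) (hx1 : x < 1) (h h' : ℕ) {k : ℕ} (hk : 2 ≤ k) :
    (powerL s h k x).re < (powerL s h' 1 x).re := by
  have hk1 : x ^ k ≤ x := by
    simpa using pow_le_pow_of_le_one hx0.le hx1.le (by omega : 1 ≤ k)
  rw [powerL_re_pos hs h k (by positivity) (by linarith), powerL_re_pos hs h' 1 (by simpa) (by simpa)]
  have hp := gammaPolyLog_pos hs (pow_pos hx0 k) (by linarith)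
  have h2 : gammaPolyLog s (x ^ k) ≤ gammaPolyLog s x :=
    mul_le_mul_of_nonneg_left (realPolyLog_mono (by linarith) (by positivity) hk1 hx1)
      (Real.Gamma_pos_of_pos (by linarith)).le
  have h3 : gammaPolyLog s (x ^ k) ^ (1 / (s + 1)) ≤ gammaPolyLog s x ^ (1 / (s + 1)) :=
    Real.rpow_le_rpow hp.le h2 (by positivity)
  have h4 : 0 < gammaPolyLog s (x ^ k) ^ (1 / (s + 1)) := by positivity
  have h5 : (1 : ℝ) / k ≤ 1 / 2 := by
    apply one_div_le_one_div_of_le (by norm_num); exact_mod_cast hk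
  simp only [pow_one, Nat.cast_one, div_one, one_mul]
  nlinarith

lemma powerL_re_two_pos {x : ℝ} (hx0 : -1 < x) (hx1 : x < 0) (h : ℕ) : 0 < (powerL s h 2 x).re := by
  have h1 : x ^ 2 < 1 := by nlinarith
  have h0 : 0 < x ^ 2 := by nlinarith
  rw [powerL_re_pos hs h 2 h0 h1]
  have := gammaPolyLog_pos hs h0 h1
  positivity

/-- With `k = 2j` and `x^k = (x²)^j`, this is the comparison of `j` with `1` at the positive point
`x²`. -/
lemma powerL_re_even_lt {x : ℝ} (hx0 : -1 < x) (hx1 : x < 0) (h h' : ℕ) {k : ℕ} (hk : Even k)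
    (hk2 : 3 ≤ k) : (powerL s h k x).re < (powerL s h' 2 x).re := by
  obtain ⟨j, hj⟩ := hk
  have hj2 : 2 ≤ j := by omega
  have e : ∀ i : ℕ, x ^ (i + i) = (x ^ 2) ^ i := fun i => by rw [← pow_mul]; ring_nf
  have h1 : x ^ 2 < 1 := by nlinarith
  have h0 : 0 < x ^ 2 := by nlinarith
  have := powerL_re_lt_of_pos hs h0 h1 h h' hj2
  rw [powerL_re_pos hs h j (by positivity) (pow_lt_one₀ h0.le h1 (by omega)),
    powerL_re_pos hs h' 1 (by rwa [pow_one]) (by rwa [pow_one])] at this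
  rw [powerL_re_pos hs h k (by rw [hj, e]; positivity)
    (by rw [hj, e]; exact pow_lt_one₀ h0.le h1 (by omega)), powerL_re_pos hs h' 2 h0 h1, hj, e]
  push_cast at this ⊢
  rw [pow_one, div_one, one_mul] at this
  have e2 : 1 / ((j : ℝ) + j) = 1 / 2 * (1 / j) := by
    rw [← two_mul, one_div_mul_one_div]
  rw [e2, mul_assoc]
  exact mul_lt_mul_of_pos_left this (by norm_num)

/-- With `t = -x`: `-Li(-t^k) ≤ t^k ≤ t ≤ 2 (-Li(-t))`. -/
lemma neg_gammaPolyLog_odd_le {x : ℝ} (hx0 : -1 < x) (hx1 : x < 0) {k : ℕ} (hk : Odd k) :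
    -gammaPolyLog s (x ^ k) ≤ 2 * -gammaPolyLog s x := by
  have h1 := half_le_neg_realPolyLog_neg (σ := s + 1) (by linarith) (t := -x) (by linarith) (by linarith)
  have hk0 : k ≠ 0 := hk.pos.ne'
  have h2 := neg_realPolyLog_neg_le (σ := s + 1) (by linarith) (t := (-x) ^ k)
    (pow_nonneg (by linarith) _) (pow_lt_one₀ (by linarith) (by linarith) hk0)
  have h3 : (-x) ^ k ≤ -x := by
    simpa using pow_le_pow_of_le_one (by linarith : 0 ≤ -x) (by linarith) hk.pos
  rw [hk.neg_pow, neg_neg] at h2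
  rw [neg_neg] at h1
  rw [hk.neg_pow] at h3
  have hG := Real.Gamma_pos_of_pos (show 0 < s + 1 by linarith)
  rw [gammaPolyLog, gammaPolyLog, ← mul_neg, ← mul_neg, mul_left_comm]
  refine mul_le_mul_of_nonneg_left ?_ hG.le
  linarith

/-- The factor `2` of the previous bound costs at most `2^(1/(s+1)) ≤ 2` after taking the root,
which the prefactor `1/k ≤ 1/3` outweighs. -/
lemma powerL_re_odd_lt {x : ℝ} (hx0 : -1 < x) (hx1 : x < 0) (h h' : ℕ) {k : ℕ} (hk : Odd k)
    (hk2 : 3 ≤ k) (hc : 0 < Real.cos (Real.pi / (s + 1))) :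
    (powerL s h k x).re < (powerL s h' 1 x).re := by
  have hxk : x ^ k < 0 := hk.pow_neg hx1
  have hxk1 : -1 < x ^ k := by
    have := pow_lt_one₀ (by linarith : 0 ≤ -x) (by linarith) hk.pos.ne'
    rw [hk.neg_pow] at this
    linarith
  rw [powerL_re_neg hs h k hxk1 hxk, powerL_re_neg hs h' 1 (by simpa) (by simpa)]
  refine mul_lt_mul_of_pos_right ?_ hc
  have hn := gammaPolyLog_neg hs hx0 hx1
  have hnk := gammaPolyLog_neg hs hxk1 hxk
  have h2 := Real.rpow_le_rpow (by linarith) (neg_gammaPolyLog_odd_le hs hx0 hx1 hk)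
    (by positivity : 0 ≤ 1 / (s + 1))
  rw [Real.mul_rpow (by norm_num) (by linarith)] at h2
  have h3 : (2 : ℝ) ^ (1 / (s + 1)) ≤ 2 := by
    have := Real.rpow_le_rpow_of_exponent_le (by norm_num : (1 : ℝ) ≤ 2)
      (show 1 / (s + 1) ≤ 1 by rw [div_le_one (by linarith)]; linarith)
    rwa [Real.rpow_one] at this
  have h4 : 0 < (-gammaPolyLog s x) ^ (1 / (s + 1)) := Real.rpow_pos_of_pos (by linarith) _
  have h5 : (1 : ℝ) / k ≤ 1 / 3 := by
    apply one_div_le_one_div_of_le (by norm_num); exact_mod_cast hk2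
  have h6 : 0 ≤ (-gammaPolyLog s (x ^ k)) ^ (1 / (s + 1)) := Real.rpow_nonneg (by linarith) _
  simp only [pow_one, Nat.cast_one, div_one, one_mul]
  calc _ ≤ 1 / 3 * (-gammaPolyLog s (x ^ k)) ^ (1 / (s + 1)) := mul_le_mul_of_nonneg_right h5 h6
    _ ≤ 1 / 3 * (2 * (-gammaPolyLog s x) ^ (1 / (s + 1))) := by
        refine mul_le_mul_of_nonneg_left (h2.trans ?_) (by norm_num)
        exact mul_le_mul_of_nonneg_right h3 h4.le
    _ < _ := by linarith

lemma powerL_re_odd_nonpos {x : ℝ} (hx0 : -1 < x) (hx1 : x < 0) (h : ℕ) {k : ℕ} (hk : Odd k)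
    (hc : Real.cos (Real.pi / (s + 1)) ≤ 0) : (powerL s h k x).re ≤ 0 := by
  have hxk : x ^ k < 0 := hk.pow_neg hx1
  have hxk1 : -1 < x ^ k := by
    have := pow_lt_one₀ (by linarith : 0 ≤ -x) (by linarith) hk.pos.ne'
    rw [hk.neg_pow] at this
    linarith
  rw [powerL_re_neg hs h k hxk1 hxk]
  have hnk := gammaPolyLog_neg hs hxk1 hxk
  have h6 : 0 ≤ (-gammaPolyLog s (x ^ k)) ^ (1 / (s + 1)) := Real.rpow_nonneg (by linarith) _
  exact mul_nonpos_of_nonneg_of_nonpos (by positivity) hc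

lemma powerL_zero (h : ℕ) {k : ℕ} (hk : k ≠ 0) : powerL s h k ((0 : ℝ) : ℂ) = 0 := by
  rw [powerL_of_nonneg hs h k (by simp [hk])]
  simp [hk, Real.zero_rpow (by positivity : (s + 1)⁻¹ ≠ 0)]

lemma continuousOn_gammaPolyLog : ContinuousOn (gammaPolyLog s) (Ioo (-1) 1) :=
  (continuousOn_realPolyLog (by linarith)).const_mul _

lemma continuousOn_powerL_one_re : ContinuousOn (fun x : ℝ => (powerL s 1 1 x).re) (Ioo (-1) 0) := by
  have : ContinuousOn (fun x : ℝ => (-gammaPolyLog s x) ^ (1 / (s + 1))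
      * Real.cos (Real.pi / (s + 1))) (Ioo (-1) 0) := by
    refine ContinuousOn.mul_const (ContinuousOn.rpow_const ?_ fun x hx => Or.inr (by positivity)) _
    exact ((continuousOn_gammaPolyLog hs).mono (Ioo_subset_Ioo_right (by norm_num))).neg
  refine this.congr fun x hx => ?_
  beta_reduce
  rw [powerL_re_neg hs 1 1 (by simpa using hx.1) (by simpa using hx.2)]
  simp

lemma continuousOn_powerL_two_re : ContinuousOn (fun x : ℝ => (powerL s 1 2 x).re) (Ioo (-1) 0) := by
  have : ContinuousOn (fun x : ℝ => 1 / 2 * gammaPolyLog s (x ^ 2) ^ (1 / (s + 1))) (Ioo (-1) 0) := by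
    refine ContinuousOn.const_mul (ContinuousOn.rpow_const ?_ fun x hx => Or.inr (by positivity)) _
    refine (continuousOn_gammaPolyLog hs).comp (by fun_prop) fun x hx => ?_
    have := hx.1; have := hx.2
    constructor <;> nlinarith
  refine this.congr fun x hx => ?_
  have := hx.1; have := hx.2
  beta_reduce
  rw [powerL_re_pos hs 1 2 (by nlinarith) (by nlinarith)]
  simp

/-- Raised to the power `s+1`, the comparison concerns the ratio `Li(x²)/(-Li(x))`. With `t = |x|`
it is `t` times `Li(t²)/t²`, which increases, over `-Li(-t)/t`, which decreases; so it strictly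
increases in `t`, and moving towards `0` favours `L_{1,1}`. -/
lemma powerL_re_cross {x y : ℝ} (hx : x ∈ Ioo (-1 : ℝ) 0) (hy : y ∈ Ioo (-1 : ℝ) 0) (hxy : x < y)
    (h : (powerL s 1 2 x).re ≤ (powerL s 1 1 x).re) :
    (powerL s 1 2 y).re < (powerL s 1 1 y).re := by
  have h2x := powerL_re_two_pos hs hx.1 hx.2 1
  have hc : 0 < Real.cos (Real.pi / (s + 1)) := by
    by_contra hc
    have := powerL_re_odd_nonpos hs hx.1 hx.2 1 odd_one (not_lt.1 hc)
    linarith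
  -- A positive cosine forces `π/(s+1) < π/2`. Then `s + 1 ≥ 2`, as the monotonicity of `-Li(-t)/t`
  -- requires.
  have hs1 : 1 < s := by
    by_contra hs1
    refine absurd hc (not_lt.2 (Real.cos_nonpos_of_pi_div_two_le_of_le ?_ ?_))
    · exact div_le_div_of_nonneg_left Real.pi_pos.le (by linarith) (by linarith)
    · have : Real.pi / (s + 1) ≤ Real.pi := div_le_self Real.pi_pos.le (by linarith)
      linarith [Real.pi_pos]
  set c := Real.cos (Real.pi / (s + 1)) with hcdef
  have hx0 := hx.1
  have hx1 := hx.2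
  have hy0 := hy.1
  have hy1 := hy.2
  have key : ∀ z ∈ Ioo (-1 : ℝ) 0, ∀ a : ℝ, 0 < a →
      ((powerL s 1 2 z).re < a * (powerL s 1 1 z).re ↔
        gammaPolyLog s (z ^ 2) < (2 * c * a) ^ (s + 1) * -gammaPolyLog s z) := by
    intro z hz a ha
    have hz0 := hz.1
    have hz1 := hz.2
    have hzn := gammaPolyLog_neg hs hz0 hz1
    have hzp := gammaPolyLog_pos hs (by nlinarith : 0 < z ^ 2) (by nlinarith)
    rw [powerL_re_pos hs 1 2 (by nlinarith) (by nlinarith), powerL_re_neg hs 1 1 (by simpa) (by simpa),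
      pow_one, ← Real.rpow_lt_rpow_iff (z := 1 / (s + 1)) hzp.le
        (mul_nonneg (by positivity) (by linarith)) (by positivity),
      Real.mul_rpow (by positivity) (by linarith), ← Real.rpow_mul (by positivity),
      mul_one_div_cancel (by positivity), Real.rpow_one]
    push_cast
    constructor <;> intro h <;> nlinarith
  have hGx := gammaPolyLog_neg hs hx0 hx1
  have hGy := gammaPolyLog_neg hs hy0 hy1
  have hG := Real.Gamma_pos_of_pos (show 0 < s + 1 by linarith)
  have m1 := mul_neg_realPolyLog_neg_le (σ := s + 1) (by linarith) (t := -y) (u := -x)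
    (by linarith) (by linarith) (by linarith)
  rw [neg_neg, neg_neg] at m1
  have m2 := mul_realPolyLog_le (σ := s + 1) (by linarith) (t := y ^ 2) (u := x ^ 2)
    (by positivity) (by nlinarith) (by nlinarith)
  have m1' : y * gammaPolyLog s x ≤ x * gammaPolyLog s y := by
    simp only [gammaPolyLog]; nlinarith
  have m2' : x ^ 2 * gammaPolyLog s (y ^ 2) ≤ y ^ 2 * gammaPolyLog s (x ^ 2) := by
    simp only [gammaPolyLog]; nlinarith
  have hT : gammaPolyLog s (x ^ 2) ≤ (2 * c) ^ (s + 1) * -gammaPolyLog s x := by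
    refine not_lt.1 fun hlt => ?_
    have h11 : ¬ (powerL s 1 2 x).re < 1 * (powerL s 1 1 x).re := by
      rw [key x hx 1 one_pos, mul_one]; exact not_lt.2 hlt.le
    have heq : (powerL s 1 2 x).re = (powerL s 1 1 x).re := le_antisymm h (by linarith)
    have hzn := hGx
    have hzp := gammaPolyLog_pos hs (by nlinarith : 0 < x ^ 2) (by nlinarith)
    rw [powerL_re_pos hs 1 2 (by nlinarith) (by nlinarith), powerL_re_neg hs 1 1 (by simpa) (by simpa),
      pow_one] at heq
    rw [← Real.rpow_lt_rpow_iff (z := 1 / (s + 1)) (mul_nonneg (by positivity) (by linarith)) hzp.le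
        (by positivity), Real.mul_rpow (by positivity) (by linarith), ← Real.rpow_mul (by positivity),
      mul_one_div_cancel (by positivity), Real.rpow_one] at hlt
    push_cast at heq
    nlinarith
  have := (key y hy 1 one_pos).2 ?_
  · simpa using this
  rw [mul_one]
  have hA : 0 < (2 * c) ^ (s + 1) := by positivity
  set A := (2 * c) ^ (s + 1)
  have hx2 : 0 < x ^ 2 := by nlinarith
  -- compare both sides after multiplication by `x ^ 2`
  refine lt_of_mul_lt_mul_left (a := x ^ 2) ?_ hx2.le
  have hyG : y ^ 2 * gammaPolyLog s (x ^ 2) ≤ y ^ 2 * (A * -gammaPolyLog s x) :=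
    mul_le_mul_of_nonneg_left hT (by positivity)
  have h3 : y ^ 2 * (A * -gammaPolyLog s x) ≤ (x * y) * (A * -gammaPolyLog s y) := by
    have : 0 ≤ -y * A := mul_nonneg (by linarith) hA.le
    nlinarith [mul_le_mul_of_nonneg_left m1' this]
  have h4 : (x * y) * (A * -gammaPolyLog s y) < x ^ 2 * (A * -gammaPolyLog s y) := by
    refine mul_lt_mul_of_pos_right ?_ (mul_pos hA (by linarith))
    nlinarith
  linarith

lemma exists_phase_threshold : ∃ c ∈ Icc (-1 : ℝ) 0, ∀ x ∈ Ioo (-1 : ℝ) 0,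
    ((powerL s 1 2 x).re < (powerL s 1 1 x).re ↔ c < x) ∧
      ((powerL s 1 1 x).re < (powerL s 1 2 x).re ↔ x < c) :=
  exists_threshold_of_single_crossing (continuousOn_powerL_one_re hs) (continuousOn_powerL_two_re hs)
    fun _ hx _ hy hxy h => powerL_re_cross hs hx hy hxy h

lemma not_equivalent_one_of_two_le {h h' k : ℕ} (hk : 2 ≤ k) :
    ¬ ∀ u ∈ Complex.ofReal '' Ioo (-1 : ℝ) 1, (powerL s h k u).re = (powerL s h' 1 u).re := fun H =>
  (powerL_re_lt_of_pos hs (by norm_num : (0 : ℝ) < 1 / 2) (by norm_num) h h' hk).ne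
    (H _ ⟨1 / 2, ⟨by norm_num, by norm_num⟩, rfl⟩)

lemma phase_one_one {c : ℝ} (hc : c ∈ Icc (-1 : ℝ) 0) (hthr : ∀ x ∈ Ioo (-1 : ℝ) 0,
    ((powerL s 1 2 x).re < (powerL s 1 1 x).re ↔ c < x)) :
    phase (powerL s) (Complex.ofReal '' Ioo (-1 : ℝ) 1) 1 1
      = Complex.ofReal '' (Ioo 0 1 ∪ Ioo c 0) := by
  ext z
  constructor
  · rintro ⟨⟨x, hx, rfl⟩, hz⟩
    have h12 := hz 1 2 one_pos (by norm_num) (by norm_num) (not_equivalent_one_of_two_le hs le_rfl)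
    refine ⟨x, ?_, rfl⟩
    rcases lt_trichotomy x 0 with h0 | h0 | h0
    · exact Or.inr ⟨(hthr x ⟨hx.1, h0⟩).1 h12, h0⟩
    · rw [h0, powerL_zero hs 1 (by norm_num), powerL_zero hs 1 (by norm_num)] at h12
      exact absurd h12 (lt_irrefl _)
    · exact Or.inl ⟨h0, hx.2⟩
  · rintro ⟨x, hx, rfl⟩
    rcases hx with hx | hx
    · refine ⟨⟨x, ⟨by linarith [hx.1], hx.2⟩, rfl⟩, fun h k _ _ _ hne => ?_⟩
      have hk : k ≠ 1 := by rintro rfl; exact hne fun u _ => rfl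
      exact powerL_re_lt_of_pos hs hx.1 hx.2 h 1 (by omega)
    · have hx1 : -1 < x := hc.1.trans_lt hx.1
      refine ⟨⟨x, ⟨hx1, by linarith [hx.2]⟩, rfl⟩, fun h k _ _ _ hne => ?_⟩
      have hk : k ≠ 1 := by rintro rfl; exact hne fun u _ => rfl
      have h12 := (hthr x ⟨hx1, hx.2⟩).2 hx.1
      rcases Nat.even_or_odd k with he | ho
      · rcases (show 2 ≤ k by omega).eq_or_lt with rfl | h2
        · exact h12
        · exact (powerL_re_even_lt hs hx1 hx.2 h 1 he h2).trans h12
      · refine powerL_re_odd_lt hs hx1 hx.2 h 1 ho (by obtain ⟨j, rfl⟩ := ho; omega) ?_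
        by_contra hcos
        have := powerL_re_odd_nonpos hs hx1 hx.2 1 odd_one (not_lt.1 hcos)
        have := powerL_re_two_pos hs hx1 hx.2 1
        linarith

lemma phase_one_two {c : ℝ} (hc : c ∈ Icc (-1 : ℝ) 0) (hthr : ∀ x ∈ Ioo (-1 : ℝ) 0,
    ((powerL s 1 1 x).re < (powerL s 1 2 x).re ↔ x < c)) :
    phase (powerL s) (Complex.ofReal '' Ioo (-1 : ℝ) 1) 1 2 = Complex.ofReal '' Ioo (-1) c := by
  ext z
  constructor
  · rintro ⟨⟨x, hx, rfl⟩, hz⟩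
    have h12 := hz 1 1 one_pos le_rfl (by norm_num)
      (fun H => not_equivalent_one_of_two_le hs (h := 1) (h' := 1) le_rfl fun u hu => (H u hu).symm)
    refine ⟨x, ⟨hx.1, ?_⟩, rfl⟩
    rcases lt_trichotomy x 0 with h0 | h0 | h0
    · exact (hthr x ⟨hx.1, h0⟩).1 h12
    · rw [h0, powerL_zero hs 1 (by norm_num), powerL_zero hs 1 (by norm_num)] at h12
      exact absurd h12 (lt_irrefl _)
    · exact absurd h12 (not_lt.2 (powerL_re_lt_of_pos hs h0 hx.2 1 1 le_rfl).le)
  · rintro ⟨x, hx, rfl⟩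
    have hx1 : x < 0 := hx.2.trans_le hc.2
    refine ⟨⟨x, ⟨hx.1, by linarith⟩, rfl⟩, fun h k hh hhk _ hne => ?_⟩
    have hk : k ≠ 2 := by rintro rfl; exact hne fun u _ => rfl
    have h12 := (hthr x ⟨hx.1, hx1⟩).2 hx.2
    have h2 := powerL_re_two_pos hs hx.1 hx1 1
    rcases Nat.even_or_odd k with he | ho
    · have : 3 ≤ k := by obtain ⟨j, rfl⟩ := he; omega
      exact powerL_re_even_lt hs hx.1 hx1 h 1 he this
    · rcases le_or_gt (Real.cos (Real.pi / (s + 1))) 0 with hcos | hcos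
      · exact (powerL_re_odd_nonpos hs hx.1 hx1 h ho hcos).trans_lt h2
      · rcases (show 1 ≤ k from ho.pos).eq_or_lt with rfl | h3
        · exact h12
        · exact (powerL_re_odd_lt hs hx.1 hx1 h 1 ho (by omega) hcos).trans h12

end

/-! ### The real part of `(1 + it)^(-s)` and its minimum. -/

/-- Polar form: with `φ = arctan t`, `1 + it = e^(iφ)/cos φ`. -/
lemma one_add_mul_I_cpow_neg (s t : ℝ) :
    (1 + (t : ℂ) * Complex.I) ^ (-(s : ℂ))
      = ((Real.cos (Real.arctan t) ^ s : ℝ) : ℂ)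
        * Complex.exp (((-(s * Real.arctan t) : ℝ) : ℂ) * Complex.I) := by
  set φ := Real.arctan t with hφ
  have hc : 0 < Real.cos φ := Real.cos_arctan_pos t
  have h1 : 1 + (t : ℂ) * Complex.I = (((Real.cos φ)⁻¹ : ℝ) : ℂ) * Complex.exp ((φ : ℂ) * Complex.I) := by
    have ht : t = Real.sin φ / Real.cos φ := by rw [← Real.tan_eq_sin_div_cos, hφ, Real.tan_arctan]
    rw [Complex.exp_mul_I, ← Complex.ofReal_cos, ← Complex.ofReal_sin, ht]
    have : (Real.cos φ : ℂ) ≠ 0 := by exact_mod_cast hc.ne'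
    push_cast
    rw [← Complex.ofReal_cos, ← Complex.ofReal_sin]
    field_simp
  have hlog : Complex.log (Complex.exp ((φ : ℂ) * Complex.I)) = φ * Complex.I := by
    have h2 := Real.neg_pi_div_two_lt_arctan t
    have h3 := Real.arctan_lt_pi_div_two t
    have := Real.pi_pos
    apply Complex.log_exp <;> simp <;> linarith
  rw [h1, ofReal_mul_cpow (inv_pos.2 hc) (Complex.exp_ne_zero _),
    Complex.cpow_def_of_ne_zero (Complex.exp_ne_zero _), hlog, ← Complex.ofReal_neg,
    ← Complex.ofReal_cpow (inv_pos.2 hc).le, Real.inv_rpow hc.le, Real.rpow_neg hc.le, inv_inv]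
  congr 2
  push_cast
  ring

lemma one_add_mul_I_cpow_neg_re (s t : ℝ) :
    ((1 + (t : ℂ) * Complex.I) ^ (-(s : ℂ))).re
      = Real.cos (s * Real.arctan t) * Real.cos (Real.arctan t) ^ s := by
  rw [one_add_mul_I_cpow_neg, Complex.re_ofReal_mul, Complex.exp_ofReal_mul_I_re, Real.cos_neg,
    mul_comm]

lemma norm_one_add_mul_I_cpow_neg (s t : ℝ) :
    ‖(1 + (t : ℂ) * Complex.I) ^ (-(s : ℂ))‖ = Real.cos (Real.arctan t) ^ s := by
  rw [one_add_mul_I_cpow_neg, norm_mul, Complex.norm_exp_ofReal_mul_I, mul_one, Complex.norm_real,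
    Real.norm_of_nonneg (Real.rpow_nonneg (Real.cos_arctan_pos t).le _)]

lemma hasDerivAt_neg_cos_mul_cos_rpow (s : ℝ) {φ : ℝ} (hφ : 0 < Real.cos φ) :
    HasDerivAt (fun y => -Real.cos (s * y) * Real.cos y ^ s)
      (s * Real.cos φ ^ (s - 1) * Real.sin ((s + 1) * φ)) φ := by
  have h1 : HasDerivAt (fun y => -Real.cos (s * y)) (Real.sin (s * φ) * s) φ := by
    refine ((hasDerivAt_id φ).const_mul s).cos.neg.congr_deriv ?_
    simp
  have h2 : HasDerivAt (fun y => Real.cos y ^ s) (-Real.sin φ * s * Real.cos φ ^ (s - 1)) φ :=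
    (Real.hasDerivAt_cos φ).rpow_const (Or.inl hφ.ne')
  refine (h1.mul h2).congr_deriv ?_
  have h3 : Real.cos φ ^ s = Real.cos φ ^ (s - 1) * Real.cos φ := by
    rw [← Real.rpow_add_one hφ.ne']; ring_nf
  rw [h3, add_mul, one_mul, Real.sin_add]
  ring

section
variable {s : ℝ} (hs : 1 < s)
include hs

lemma cos_pi_div_pos : 0 < Real.cos (Real.pi / (s + 1)) := by
  have := Real.pi_pos
  apply Real.cos_pos_of_mem_Ioo
  constructor
  · have : 0 < Real.pi / (s + 1) := by positivity
    linarith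
  · exact div_lt_div_of_pos_left this (by norm_num) (by linarith)

lemma pi_div_lt_pi_div_two : Real.pi / (s + 1) < Real.pi / 2 :=
  div_lt_div_of_pos_left Real.pi_pos (by norm_num) (by linarith)

/-- `-cos(s φ) cos(φ) ^ s` has its strict maximum over `[0, π/2)` at `φ = π / (s + 1)`. -/
lemma neg_cos_mul_cos_rpow_lt {φ : ℝ} (h0 : 0 ≤ φ) (h1 : φ < Real.pi / 2)
    (hne : φ ≠ Real.pi / (s + 1)) :
    -Real.cos (s * φ) * Real.cos φ ^ s < Real.cos (Real.pi / (s + 1)) ^ (s + 1) := by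
  set α := Real.pi / (s + 1) with hα
  have hs1 : 0 < s + 1 := by linarith
  have hα0 : 0 < α := div_pos Real.pi_pos hs1
  have hα2 : α < Real.pi / 2 := pi_div_lt_pi_div_two hs
  have hsα : (s + 1) * α = Real.pi := by rw [hα]; field_simp
  have hc : 0 < Real.cos α := cos_pi_div_pos hs
  have hval : -Real.cos (s * α) * Real.cos α ^ s = Real.cos α ^ (s + 1) := by
    rw [show s * α = Real.pi - α by linarith, Real.cos_pi_sub, neg_neg, Real.rpow_add_one hc.ne',
      mul_comm]
  have hcos : ∀ y ∈ Ico 0 (Real.pi / 2), 0 < Real.cos y := fun y hy =>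
    Real.cos_pos_of_mem_Ioo ⟨by linarith [hy.1, Real.pi_pos], hy.2⟩
  have hcont : ContinuousOn (fun y => -Real.cos (s * y) * Real.cos y ^ s) (Ico 0 (Real.pi / 2)) :=
    fun y hy => (hasDerivAt_neg_cos_mul_cos_rpow s (hcos y hy)).continuousAt.continuousWithinAt
  rw [← hval]
  rcases lt_or_gt_of_ne hne with hlt | hgt
  · have hsub : Icc 0 α ⊆ Ico 0 (Real.pi / 2) := fun y hy => ⟨hy.1, hy.2.trans_lt hα2⟩
    refine strictMonoOn_of_deriv_pos (convex_Icc 0 α) (hcont.mono hsub) (fun y hy => ?_)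
      ⟨h0, hlt.le⟩ ⟨hα0.le, le_rfl⟩ hlt
    rw [interior_Icc] at hy
    have hy' := hcos y (hsub (Ioo_subset_Icc_self hy))
    rw [(hasDerivAt_neg_cos_mul_cos_rpow s hy').deriv]
    have : 0 < Real.sin ((s + 1) * y) := by
      apply Real.sin_pos_of_pos_of_lt_pi
      · exact mul_pos hs1 hy.1
      · rw [← hsα]; exact mul_lt_mul_of_pos_left hy.2 hs1
    positivity
  · rcases le_or_gt φ (2 * α) with h2 | h2
    · have hsub : Icc α φ ⊆ Ico 0 (Real.pi / 2) := fun y hy => ⟨hα0.le.trans hy.1, hy.2.trans_lt h1⟩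
      refine strictAntiOn_of_deriv_neg (convex_Icc α φ) (hcont.mono hsub) (fun y hy => ?_)
        ⟨le_rfl, hgt.le⟩ ⟨hgt.le, le_rfl⟩ hgt
      rw [interior_Icc] at hy
      have hy' := hcos y (hsub (Ioo_subset_Icc_self hy))
      rw [(hasDerivAt_neg_cos_mul_cos_rpow s hy').deriv]
      have : Real.sin ((s + 1) * y) < 0 := by
        have e : Real.sin ((s + 1) * y) = -Real.sin ((s + 1) * y - Real.pi) := by
          rw [Real.sin_sub_pi, neg_neg]
        rw [e, neg_lt_zero]
        apply Real.sin_pos_of_pos_of_lt_pi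
        · rw [sub_pos, ← hsα]; exact mul_lt_mul_of_pos_left hy.1 hs1
        · have : (s + 1) * y < (s + 1) * (2 * α) :=
            mul_lt_mul_of_pos_left (hy.2.trans_le h2) hs1
          linarith
      have h3 : 0 < s * Real.cos y ^ (s - 1) := by positivity
      exact mul_neg_of_pos_of_neg h3 this
    -- Beyond `2α` the derivative may change sign again, but the size alone suffices: `cos φ ≤ cos
    -- 2α < cos² α`, and `2s ≥ s + 1`.
    · rw [hval]
      have hcφ := hcos φ ⟨h0, h1⟩
      have hcc : Real.cos φ < Real.cos α ^ (2 : ℝ) := by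
        have h3 : Real.cos φ ≤ Real.cos (2 * α) :=
          Real.cos_le_cos_of_nonneg_of_le_pi (by positivity) (by linarith [Real.pi_pos]) h2.le
        rw [Real.cos_two_mul] at h3
        have h4 : Real.cos α < 1 := by
          rw [← Real.cos_zero]
          exact Real.cos_lt_cos_of_nonneg_of_le_pi le_rfl (by linarith [Real.pi_pos]) hα0
        rw [Real.rpow_two]
        nlinarith
      have hle : -Real.cos (s * φ) ≤ 1 := by linarith [Real.neg_one_le_cos (s * φ)]
      calc -Real.cos (s * φ) * Real.cos φ ^ s ≤ 1 * Real.cos φ ^ s :=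
            mul_le_mul_of_nonneg_right hle (by positivity)
        _ < 1 * (Real.cos α ^ (2 : ℝ)) ^ s := by
            rw [one_mul, one_mul]; exact Real.rpow_lt_rpow hcφ.le hcc (by linarith)
        _ = Real.cos α ^ (2 * s) := by rw [one_mul, ← Real.rpow_mul hc.le]
        _ ≤ _ := Real.rpow_le_rpow_of_exponent_ge hc (Real.cos_le_one α) (by linarith)

lemma neg_re_cpow_lt {t : ℝ} (h0 : 0 ≤ t) (hne : t ≠ Real.tan (Real.pi / (s + 1))) :
    -((1 + (t : ℂ) * Complex.I) ^ (-(s : ℂ))).re < Real.cos (Real.pi / (s + 1)) ^ (s + 1) := by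
  rw [one_add_mul_I_cpow_neg_re, ← neg_mul]
  refine neg_cos_mul_cos_rpow_lt hs (Real.arctan_nonneg.2 h0) (Real.arctan_lt_pi_div_two t)
    fun h => hne ?_
  rw [← h, Real.tan_arctan]

lemma neg_re_cpow_le (t : ℝ) :
    -((1 + (t : ℂ) * Complex.I) ^ (-(s : ℂ))).re ≤ Real.cos (Real.pi / (s + 1)) ^ (s + 1) := by
  have h1 : ((1 + (t : ℂ) * Complex.I) ^ (-(s : ℂ))).re
      = ((1 + ((|t| : ℝ) : ℂ) * Complex.I) ^ (-(s : ℂ))).re := by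
    rcases abs_choice t with h | h
    · rw [h]
    · rw [h, one_add_mul_I_cpow_neg_re, one_add_mul_I_cpow_neg_re, Real.arctan_neg, mul_neg,
        Real.cos_neg, Real.cos_neg]
  rw [h1]
  by_cases h : |t| = Real.tan (Real.pi / (s + 1))
  · have hα : 0 < Real.pi / (s + 1) := div_pos Real.pi_pos (by linarith)
    have hat : Real.arctan |t| = Real.pi / (s + 1) := by
      rw [h]
      exact Real.arctan_tan (by linarith [Real.pi_pos]) (pi_div_lt_pi_div_two hs)
    rw [one_add_mul_I_cpow_neg_re, hat]
    have : s * (Real.pi / (s + 1)) = Real.pi - Real.pi / (s + 1) := by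
      have : s + 1 ≠ 0 := by linarith
      field_simp; ring
    rw [this, Real.cos_pi_sub, Real.rpow_add_one (cos_pi_div_pos hs).ne']
    linarith
  · exact (neg_re_cpow_lt hs (abs_nonneg t) h).le

/-- The strict maximum becomes a uniform gap by compactness: the function tends to `0` at infinity,
and on the remaining compact set its maximum is attained. -/
lemma exists_neg_re_cpow_le_sub {ε : ℝ} (hε : 0 < ε) : ∃ δ > 0, ∀ t : ℝ, 0 ≤ t →
    ε ≤ |t - Real.tan (Real.pi / (s + 1))| →
    -((1 + (t : ℂ) * Complex.I) ^ (-(s : ℂ))).re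
      ≤ Real.cos (Real.pi / (s + 1)) ^ (s + 1) - δ := by
  have hc := cos_pi_div_pos hs
  set c := Real.cos (Real.pi / (s + 1)) ^ (s + 1) with hcdef
  have hc0 : 0 < c := by positivity
  have hcont : Continuous fun t : ℝ => -((1 + (t : ℂ) * Complex.I) ^ (-(s : ℂ))).re := by
    simp only [one_add_mul_I_cpow_neg_re]
    refine Continuous.neg (Continuous.mul (by fun_prop) ?_)
    exact Continuous.rpow_const (by fun_prop) fun t => Or.inl (Real.cos_arctan_pos t).ne'
  have hlim : Tendsto (fun t : ℝ => Real.cos (Real.arctan t) ^ s) atTop (𝓝 0) := by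
    have h1 : Tendsto (fun t : ℝ => Real.cos (Real.arctan t)) atTop (𝓝 0) := by
      have := (Real.continuous_cos.tendsto (Real.pi / 2)).comp
        (Real.tendsto_arctan_atTop.mono_right nhdsWithin_le_nhds)
      rwa [Real.cos_pi_div_two] at this
    have := h1.rpow_const (p := s) (Or.inr (by linarith))
    rwa [Real.zero_rpow (by linarith)] at this
  obtain ⟨T, hT⟩ := eventually_atTop.1 (hlim.eventually_lt_const (half_pos hc0))
  set K : Set ℝ := Icc 0 T ∩ {t | ε ≤ |t - Real.tan (Real.pi / (s + 1))|} with hK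
  have hKc : IsCompact K := isCompact_Icc.inter_right
    (isClosed_le continuous_const (by fun_prop))
  have hbig : ∀ t : ℝ, T ≤ t → -((1 + (t : ℂ) * Complex.I) ^ (-(s : ℂ))).re ≤ c - c / 2 := by
    intro t ht
    have h1 := Complex.abs_re_le_norm ((1 + (t : ℂ) * Complex.I) ^ (-(s : ℂ)))
    rw [norm_one_add_mul_I_cpow_neg] at h1
    have := hT t ht
    have := (abs_le.1 h1).1
    linarith
  rcases K.eq_empty_or_nonempty with hKe | hKne
  · refine ⟨c / 2, by positivity, fun t h0 hε' => hbig t ?_⟩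
    by_contra hlt
    have : t ∈ K := ⟨⟨h0, (not_le.1 hlt).le⟩, hε'⟩
    rw [hKe] at this
    exact this
  · obtain ⟨u, hu, hmax⟩ := hKc.exists_isMaxOn hKne hcont.continuousOn
    have hu' := neg_re_cpow_lt hs hu.1.1 (fun h => by
      have h2 : ε ≤ |u - Real.tan (Real.pi / (s + 1))| := hu.2
      rw [h, sub_self, abs_zero] at h2
      linarith)
    refine ⟨min (c / 2) (c - -((1 + (u : ℂ) * Complex.I) ^ (-(s : ℂ))).re),
      lt_min (by positivity) (by linarith), fun t h0 hε' => ?_⟩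
    rcases le_total T t with h | h
    · have := min_le_left (c / 2) (c - -((1 + (u : ℂ) * Complex.I) ^ (-(s : ℂ))).re)
      linarith [hbig t h]
    · have := min_le_right (c / 2) (c - -((1 + (u : ℂ) * Complex.I) ^ (-(s : ℂ))).re)
      have h3 : -((1 + (t : ℂ) * Complex.I) ^ (-(s : ℂ))).re
        ≤ -((1 + (u : ℂ) * Complex.I) ^ (-(s : ℂ))).re := hmax ⟨⟨h0, h⟩, hε'⟩
      linarith

end

/-! ### The Euler product on the whole circle: a Farey-type dichotomy. -/

lemma norm_rpow_mul_cpow_neg_le {s r d a : ℝ} (hs : 0 < s) {w : ℂ} (hr : 0 < r) (ha : 0 < a)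
    (hd : d = a * r) (hw : d ≤ ‖w‖) :
    ‖((r ^ s : ℝ) : ℂ) * w ^ (-(s : ℂ))‖ ≤ a ^ (-s) := by
  have hd0 : 0 < d := by rw [hd]; positivity
  rw [norm_mul, Complex.norm_real, Real.norm_of_nonneg (by positivity), ← Complex.ofReal_neg,
    Complex.norm_cpow_real]
  calc r ^ s * ‖w‖ ^ (-s) ≤ r ^ s * d ^ (-s) :=
        mul_le_mul_of_nonneg_left (Real.rpow_le_rpow_of_nonpos hd0 hw (by linarith)) (by positivity)
    _ = a ^ (-s) := by
        rw [hd, Real.mul_rpow ha.le hr.le, mul_left_comm, ← Real.rpow_add hr, add_neg_cancel,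
          Real.rpow_zero, mul_one]

lemma rpow_mul_cpow_neg_eq {s r j t : ℝ} (hr : 0 < r) (hj : 0 < j) :
    ((r ^ s : ℝ) : ℂ) * ((j * r : ℝ) * (1 + (t : ℂ) * Complex.I)) ^ (-(s : ℂ))
      = ((j ^ (-s) : ℝ) : ℂ) * (1 + (t : ℂ) * Complex.I) ^ (-(s : ℂ)) := by
  have hz : 1 + (t : ℂ) * Complex.I ≠ 0 := by
    intro h
    have := congrArg Complex.re h
    simp at this
  rw [ofReal_mul_cpow (by positivity) hz, ← mul_assoc, ← Complex.ofReal_neg,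
    ← Complex.ofReal_cpow (by positivity), ← Complex.ofReal_mul, Real.mul_rpow hj.le hr.le,
    mul_left_comm, ← Real.rpow_add hr, add_neg_cancel, Real.rpow_zero, mul_one]

lemma le_norm_ofReal_mul_one_add (a t : ℝ) : a ≤ ‖(a : ℂ) * (1 + (t : ℂ) * Complex.I)‖ := by
  have h : ((a : ℂ) * (1 + (t : ℂ) * Complex.I)).re = a := by simp
  exact h.symm.le.trans (Complex.re_le_norm _)

lemma eventually_mul_rpow_le {s : ℝ} (hs : 0 < s) (C : ℝ) {η : ℝ} (hη : 0 < η) :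
    ∀ᶠ r in 𝓝[>] (0 : ℝ), C * r ^ s ≤ η := by
  have h : Tendsto (fun r : ℝ => C * r ^ s) (𝓝[>] 0) (𝓝 (C * 0)) := by
    refine Tendsto.const_mul C ?_
    have := (Real.continuousAt_rpow_const 0 s (Or.inr hs.le)).tendsto
    rw [Real.zero_rpow hs.ne'] at this
    exact this.mono_left nhdsWithin_le_nhds
  rw [mul_zero] at h
  exact (h.eventually_lt_const hη).mono fun _ h => h.le

lemma exists_pos_mul_rpow_neg_le {s : ℝ} (hs : 0 < s) (C : ℝ) {η : ℝ} (hη : 0 < η) :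
    ∃ T : ℝ, 1 ≤ T ∧ ∀ y, T ≤ y → C * y ^ (-s) ≤ η := by
  have h : Tendsto (fun r : ℝ => C * r ^ (-s)) atTop (𝓝 (C * 0)) :=
    (tendsto_rpow_neg_atTop hs).const_mul C
  rw [mul_zero] at h
  obtain ⟨T, hT⟩ := eventually_atTop.1 ((h.eventually_lt_const hη).mono fun _ h => h.le)
  exact ⟨max T 1, le_max_right _ _, fun y hy => hT y ((le_max_left _ _).trans hy)⟩

/-- Near the unit circle either all the values `F(j w)` are of smaller order than `r ^ (-s)`, or
`w` is close to `2 π i` times a rational number of denominator `k`, and the values with `k ∣ j`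
are governed by the pole there. -/
lemma powerExpSeries_dichotomy {s : ℝ} (hs : 1 < s) {η : ℝ} (hη : 0 < η) :
    ∃ r₀ > 0, ∀ r : ℝ, 0 < r → r < r₀ → ∀ θ : ℝ, |θ| ≤ Real.pi →
      (∀ j : ℕ, 1 ≤ j →
        ‖((r ^ s : ℝ) : ℂ) * powerExpSeries s (j * (r + θ * Complex.I))‖ ≤ η) ∨
      ∃ k : ℕ, 1 ≤ k ∧ ∃ t : ℝ, (k = 1 → t = θ / r) ∧ ∀ j : ℕ, 1 ≤ j →
        ‖((r ^ s : ℝ) : ℂ) * powerExpSeries s (j * (r + θ * Complex.I))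
          - (if k ∣ j then (Real.Gamma s : ℂ) * ((((j : ℝ) ^ (-s) : ℝ) : ℂ)
            * (1 + (t : ℂ) * Complex.I) ^ (-(s : ℂ))) else 0)‖ ≤ η := by
  have hs0 : 0 < s := by linarith
  obtain ⟨C, hC, hstrip⟩ := powerExpSeries_strip hs
  have hG := Real.Gamma_pos_of_pos hs0
  -- At distance at least `T r` from its singularity a pole term is negligible. As `J ≥ T`, this is
  -- automatic for `j ≥ J`, since `Re (jw) = j r`.
  obtain ⟨T, hT1, hT⟩ := exists_pos_mul_rpow_neg_le hs0 (Real.Gamma s) (show 0 < η / 4 by linarith)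
  obtain ⟨J, hJT⟩ := exists_nat_ge T
  have hJ1 : (1 : ℝ) ≤ J := hT1.trans hJT
  have hT0 : 0 < T := by linarith
  have hpi := Real.pi_pos
  -- For `r < π/B`, multiples `a d_k` with `a ≤ J` and `|d_k| ≤ T (2J)^(J-k) r` remain in the strip
  -- of width `π`.
  set B : ℝ := J * (T * (2 * J) ^ J) with hB
  have hB0 : 0 < B := by positivity
  have hev : ∀ᶠ r in 𝓝[>] (0 : ℝ), C * r ^ s ≤ η / 4 ∧ r < Real.pi / B :=
    (eventually_mul_rpow_le hs0 C (by linarith)).and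
      (nhdsWithin_le_nhds (gt_mem_nhds (by positivity)))
  obtain ⟨r₀, hr₀, hr₀'⟩ := (mem_nhdsGT_iff_exists_Ioo_subset).1 hev
  refine ⟨r₀, hr₀, fun r hr hrr θ hθ => ?_⟩
  obtain ⟨hCr, hrB⟩ := hr₀' ⟨hr, hrr⟩
  rw [lt_div_iff₀ hB0] at hrB
  -- the strip estimate, transported by periodicity
  have E1 : ∀ j : ℕ, 1 ≤ j → ∀ n : ℤ, |j * θ - 2 * Real.pi * n| ≤ Real.pi →
      ‖((r ^ s : ℝ) : ℂ) * powerExpSeries s (j * (r + θ * Complex.I))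
        - (Real.Gamma s : ℂ) * (((r ^ s : ℝ) : ℂ)
          * ((j * r : ℝ) + ((j * θ - 2 * Real.pi * n : ℝ) : ℂ) * Complex.I) ^ (-(s : ℂ)))‖ ≤ η / 4 := by
    intro j hj n hn
    have hj0 : (0 : ℝ) < j := by exact_mod_cast hj
    set v : ℂ := (j * r : ℝ) + ((j * θ - 2 * Real.pi * n : ℝ) : ℂ) * Complex.I with hv
    have hre : v.re = j * r := by simp [hv]
    have him : v.im = j * θ - 2 * Real.pi * n := by simp [hv]
    have e1 : powerExpSeries s (j * (r + θ * Complex.I)) = powerExpSeries s v := by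
      rw [← powerExpSeries_sub_two_pi_I s _ n]
      congr 1
      rw [hv]; push_cast; ring
    rw [e1, mul_left_comm, ← mul_sub, norm_mul, Complex.norm_real,
      Real.norm_of_nonneg (by positivity), mul_comm]
    refine (mul_le_mul_of_nonneg_right (hstrip v (by rw [hre]; positivity) (by rwa [him]))
      (by positivity)).trans hCr
  have hsmall : ∀ (w : ℂ) (a : ℝ), T ≤ a → a * r ≤ ‖w‖ →
      ‖(Real.Gamma s : ℂ) * (((r ^ s : ℝ) : ℂ) * w ^ (-(s : ℂ)))‖ ≤ η / 4 := by
    intro w a ha hw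
    rw [norm_mul, Complex.norm_real, Real.norm_of_nonneg hG.le]
    exact (mul_le_mul_of_nonneg_left
      (norm_rpow_mul_cpow_neg_le hs0 hr (by linarith) rfl hw) hG.le).trans (hT a ha)
  -- the nearest multiples of `2 π`
  set N : ℕ → ℤ := fun j => round (j * θ / (2 * Real.pi)) with hN
  set d : ℕ → ℝ := fun j => j * θ - 2 * Real.pi * N j with hd
  have hdmin : ∀ (j : ℕ) (n : ℤ), |d j| ≤ |j * θ - 2 * Real.pi * n| := by
    intro j n
    have h1 := round_le ((j : ℝ) * θ / (2 * Real.pi)) n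
    have e : ∀ m : ℤ, (j : ℝ) * θ - 2 * Real.pi * m = 2 * Real.pi * (j * θ / (2 * Real.pi) - m) := by
      intro m; field_simp
    simp only [hd]
    rw [e, e n, abs_mul (2 * Real.pi), abs_mul (2 * Real.pi)]
    exact mul_le_mul_of_nonneg_left h1 (abs_nonneg _)
  have hdpi : ∀ j : ℕ, |d j| ≤ Real.pi := by
    intro j
    have h1 := abs_sub_round ((j : ℝ) * θ / (2 * Real.pi))
    have e : d j = 2 * Real.pi * (j * θ / (2 * Real.pi) - N j) := by
      simp only [hd]; field_simp
    rw [e, abs_mul, abs_of_pos (by positivity)]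
    calc 2 * Real.pi * |j * θ / (2 * Real.pi) - N j| ≤ 2 * Real.pi * (1 / 2) :=
          mul_le_mul_of_nonneg_left h1 (by positivity)
      _ = Real.pi := by ring
  have hfar : ∀ j : ℕ, 1 ≤ j → (T * r ≤ |d j| ∨ (J : ℝ) ≤ j) →
      ‖((r ^ s : ℝ) : ℂ) * powerExpSeries s (j * (r + θ * Complex.I))‖ ≤ η / 2 := by
    intro j hj hcase
    have hj0 : (0 : ℝ) < j := by exact_mod_cast hj
    have h1 := E1 j hj (N j) (hdpi j)
    set v : ℂ := (j * r : ℝ) + ((j * θ - 2 * Real.pi * N j : ℝ) : ℂ) * Complex.I with hv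
    have h2 : ‖(Real.Gamma s : ℂ) * (((r ^ s : ℝ) : ℂ) * v ^ (-(s : ℂ)))‖ ≤ η / 4 := by
      rcases hcase with hcase | hcase
      · refine hsmall v T le_rfl (hcase.trans ?_)
        have : d j = v.im := by simp [hv, hd]
        rw [this]; exact Complex.abs_im_le_norm v
      · refine hsmall v j (hJT.trans hcase) ?_
        have : (j : ℝ) * r = v.re := by simp [hv]
        rw [this]; exact Complex.re_le_norm v
    have h3 := norm_add_le (((r ^ s : ℝ) : ℂ) * powerExpSeries s (j * (r + θ * Complex.I))
      - (Real.Gamma s : ℂ) * (((r ^ s : ℝ) : ℂ) * v ^ (-(s : ℂ))))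
      ((Real.Gamma s : ℂ) * (((r ^ s : ℝ) : ℂ) * v ^ (-(s : ℂ))))
    rw [sub_add_cancel] at h3
    linarith
  have h2J : (1 : ℝ) ≤ 2 * J := by linarith
  -- The least `k` passing a threshold that shrinks by the factor `2J` at each step: every `b < k`
  -- then has `d_b` more than `2J` times the threshold of `k`, which leaves room for subtracting up
  -- to `J` multiples of `d_k`.
  by_cases hex : ∃ k : ℕ, 1 ≤ k ∧ k ≤ J ∧ |d k| ≤ T * (2 * J) ^ (J - k) * r
  · right
    classical
    set k := Nat.find hex with hk
    obtain ⟨hk1, hkJ, hkd⟩ := Nat.find_spec hex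
    rw [← hk] at hk1 hkJ hkd
    have hkmin : ∀ b : ℕ, 1 ≤ b → b < k → T * (2 * J) ^ (J - b) * r < |d b| := by
      intro b hb hbk
      by_contra hcon
      exact Nat.find_min hex hbk ⟨hb, by omega, not_lt.1 hcon⟩
    have hk0 : (0 : ℝ) < k := by exact_mod_cast hk1
    have hTk : T * (2 * J) ^ (J - k) * r * J < Real.pi := by
      have : (2 * J : ℝ) ^ (J - k) ≤ (2 * J) ^ J := pow_le_pow_right₀ h2J (by omega)
      have : T * (2 * J : ℝ) ^ (J - k) * r * J ≤ T * (2 * J) ^ J * r * J := by gcongr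
      rw [hB] at hrB
      linarith
    refine ⟨k, hk1, d k / (k * r), ?_, fun j hj => ?_⟩
    · intro h1
      have hd1 : |d k| < Real.pi := by
        refine lt_of_le_of_lt ?_ hTk
        refine hkd.trans (le_mul_of_one_le_right (by positivity) hJ1)
      -- For `k = 1`, `|θ| ≤ π` and `|d_1| < π` leave no room for a non-zero multiple of `2π`.
      have hN0 : N k = 0 := by
        by_contra hne
        have h2 := one_le_abs_intCast hne
        have h3 : |2 * Real.pi * (N k : ℝ)| = 2 * Real.pi * |(N k : ℝ)| := by
          rw [abs_mul, abs_of_pos (by positivity)]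
        have h4 : 2 * Real.pi * (N k : ℝ) = θ - d k := by
          simp only [hd, h1]; push_cast; ring
        rw [h4] at h3
        have h5 := abs_sub θ (d k)
        nlinarith
      have : d k = θ := by
        simp only [hd, hN0]
        rw [h1]; simp
      rw [this, h1]; simp
    · have hj0 : (0 : ℝ) < j := by exact_mod_cast hj
      by_cases hjJ : j ≤ J
      · obtain ⟨a, hadef⟩ : ∃ a : ℕ, a = j / k := ⟨_, rfl⟩
        have haJ : (a : ℝ) ≤ J := by
          rw [hadef]; exact_mod_cast (Nat.div_le_self j k).trans hjJ
        by_cases hdvd : k ∣ j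
        · rw [if_pos hdvd]
          obtain ⟨a, ha⟩ := hdvd
          have hakj : (j : ℝ) = k * a := by exact_mod_cast ha
          have haJ' : (a : ℝ) ≤ J := by
            have : a ≤ J := le_trans (by rw [ha]; exact Nat.le_mul_of_pos_left a hk1) hjJ
            exact_mod_cast this
          have e2 : (j : ℝ) * θ - 2 * Real.pi * ((a * N k : ℤ) : ℝ) = a * d k := by
            simp only [hd]; rw [hakj]; push_cast; ring
          have h1 := E1 j hj (a * N k) (by
            rw [e2, abs_mul, Nat.abs_cast]
            calc (a : ℝ) * |d k| ≤ J * (T * (2 * J) ^ (J - k) * r) :=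
                  mul_le_mul haJ' hkd (abs_nonneg _) (by linarith)
              _ ≤ Real.pi := by linarith)
          have e3 : (((j : ℝ) * r : ℝ) : ℂ) + ((j * θ - 2 * Real.pi * ((a * N k : ℤ) : ℝ) : ℝ) : ℂ)
              * Complex.I = ((j * r : ℝ) : ℂ) * (1 + ((d k / (k * r) : ℝ) : ℂ) * Complex.I) := by
            have ha : (a : ℝ) * d k = j * r * (d k / (k * r)) := by
              rw [hakj]; field_simp
            rw [e2, ha]; push_cast; ring
          rw [e3, rpow_mul_cpow_neg_eq hr hj0] at h1
          exact h1.trans (by linarith)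
        · rw [if_neg hdvd, sub_zero]
          have hb1 : 1 ≤ j % k := Nat.one_le_iff_ne_zero.2 fun h => hdvd (Nat.dvd_of_mod_eq_zero h)
          have hbk : j % k < k := Nat.mod_lt _ hk1
          have hb := hkmin _ hb1 hbk
          have hjab : (j : ℝ) = k * a + (j % k : ℕ) := by
            rw [hadef]; exact_mod_cast (Nat.div_add_mod j k).symm
          -- Writing `j = ka + b`, the number `d_j - a d_k` is a distance from `bθ` to a multiple of
          -- `2π`, so `|d_b|` bounds its modulus from below. Hence `d_j` is large.
          have h2 := hdmin (j % k) (N j - a * N k)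
          have e4 : ((j % k : ℕ) : ℝ) * θ - 2 * Real.pi * ((N j - a * N k : ℤ) : ℝ)
              = d j - a * d k := by
            have : ((j % k : ℕ) : ℝ) = j - k * a := by linarith
            rw [this]; simp only [hd]; push_cast; ring
          rw [e4] at h2
          have h3 := abs_sub (d j) (a * d k)
          rw [abs_mul, Nat.abs_cast] at h3
          have h4 : (a : ℝ) * |d k| ≤ J * (T * (2 * J) ^ (J - k) * r) :=
            mul_le_mul haJ hkd (abs_nonneg _) (by linarith)
          have h5 : T * (2 * J) ^ (J - k) * (2 * J) * r ≤ T * (2 * J : ℝ) ^ (J - j % k) * r := by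
            have : (2 * J : ℝ) ^ (J - k) * (2 * J) ≤ (2 * J) ^ (J - j % k) := by
              rw [← pow_succ]; exact pow_le_pow_right₀ h2J (by omega)
            rw [mul_assoc T]
            gcongr
          have h6 : T * r ≤ J * (T * (2 * J : ℝ) ^ (J - k) * r) := by
            have : (1 : ℝ) ≤ (2 * J) ^ (J - k) := one_le_pow₀ h2J
            have h7 : (1 : ℝ) ≤ J * (2 * J) ^ (J - k) := one_le_mul_of_one_le_of_one_le hJ1 this
            have h8 : 0 < T * r := by positivity
            nlinarith
          exact (hfar j hj (Or.inl (by linarith))).trans (by linarith)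
      · have hjJ' : (J : ℝ) ≤ j := by exact_mod_cast (not_le.1 hjJ).le
        have h1 := hfar j hj (Or.inr hjJ')
        have hgood : ‖(if k ∣ j then (Real.Gamma s : ℂ) * ((((j : ℝ) ^ (-s) : ℝ) : ℂ)
            * (1 + ((d k / (k * r) : ℝ) : ℂ) * Complex.I) ^ (-(s : ℂ))) else 0)‖ ≤ η / 4 := by
          split_ifs
          · rw [← rpow_mul_cpow_neg_eq hr hj0]
            refine hsmall _ j (hJT.trans hjJ') ?_
            exact le_norm_ofReal_mul_one_add _ _
          · simp; linarith
        exact (norm_sub_le _ _).trans (by linarith)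
  · left
    intro j hj
    refine (hfar j hj ?_).trans (by linarith)
    rcases le_or_gt j J with h | h
    · left
      have : T * (2 * J) ^ (J - j) * r < |d j| := by
        by_contra hcon
        exact hex ⟨j, hj, h, not_lt.1 hcon⟩
      have h2 : (1 : ℝ) ≤ (2 * J) ^ (J - j) := one_le_pow₀ h2J
      have h8 : 0 < T * r := by positivity
      nlinarith
    · right; exact_mod_cast h.le

lemma norm_pow_div_natCast_le {x ξ : ℝ} (hx : |x| ≤ ξ) (j : ℕ) : ‖(x : ℂ) ^ j / j‖ ≤ ξ ^ j := by
  rw [norm_div, norm_pow, Complex.norm_real, Complex.norm_natCast, Real.norm_eq_abs]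
  rcases Nat.eq_zero_or_pos j with rfl | hj
  · simp
  · exact (div_le_self (by positivity) (by exact_mod_cast hj)).trans
      (pow_le_pow_left₀ (abs_nonneg x) hx j)

lemma Gamma_mul_realPolyLog_eq {s : ℝ} (hs : 0 < s) (y : ℝ) :
    Real.Gamma s * realPolyLog (s + 1) y = gammaPolyLog s y / s := by
  rw [gammaPolyLog, Real.Gamma_add_one hs.ne']
  field_simp

/-- Keeping only multiples of `k` in the Dirichlet expansion reproduces the polylogarithm at `x^k`;
the factor `1/s` is `Γ(s)/Γ(s+1)`. -/
lemma hasSum_multiples {s : ℝ} (hs : 0 < s) {x : ℝ} (hx : |x| < 1) {k : ℕ} (hk : 1 ≤ k) (u : ℂ) :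
    HasSum (fun j : ℕ => (x : ℂ) ^ j / j *
        (if k ∣ j then (Real.Gamma s : ℂ) * ((((j : ℝ) ^ (-s) : ℝ) : ℂ) * u) else 0))
      (((gammaPolyLog s (x ^ k) / s * (k : ℝ) ^ (-(s + 1)) : ℝ) : ℂ) * u) := by
  have hinj : Function.Injective (fun i : ℕ => k * (i + 1)) := fun a b h => by
    have := Nat.eq_of_mul_eq_mul_left hk h
    omega
  refine (hinj.hasSum_iff fun j hj => ?_).1 ?_
  · by_cases hdvd : k ∣ j
    · obtain ⟨a, rfl⟩ := hdvd
      rcases Nat.eq_zero_or_pos a with rfl | ha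
      · simp
      · exact absurd ⟨a - 1, by simp only; rw [Nat.sub_add_cancel ha]⟩ hj
    · rw [if_neg hdvd, mul_zero]
  · have hxk : |x ^ k| < 1 := by
      rw [abs_pow]; exact pow_lt_one₀ (abs_nonneg x) hx (by omega)
    have h1 := (summable_realPolyLog (σ := s + 1) (by linarith) hxk).hasSum
    have h2 := (Complex.hasSum_ofReal.2
      ((h1.mul_left (Real.Gamma s * (k : ℝ) ^ (-(s + 1)))))).mul_right u
    have e : Real.Gamma s * (k : ℝ) ^ (-(s + 1)) * ∑' m : ℕ, (x ^ k) ^ (m + 1) / ((m + 1 : ℕ) : ℝ) ^ (s + 1)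
        = gammaPolyLog s (x ^ k) / s * (k : ℝ) ^ (-(s + 1)) := by
      rw [← Gamma_mul_realPolyLog_eq hs, realPolyLog]; ring
    rw [e] at h2
    refine h2.congr_fun fun i => ?_
    have hk0 : (0 : ℝ) < k := by exact_mod_cast hk
    have hi0 : (0 : ℝ) < (i + 1 : ℕ) := by positivity
    simp only [Function.comp]
    rw [if_pos (Dvd.intro _ rfl)]
    have e2 : ((k * (i + 1) : ℕ) : ℝ) ^ (-s) / ((k * (i + 1) : ℕ) : ℝ)
        = (k : ℝ) ^ (-(s + 1)) / ((i + 1 : ℕ) : ℝ) ^ (s + 1) := by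
      rw [Nat.cast_mul, Real.mul_rpow hk0.le hi0.le, mul_div_mul_comm, ← Real.rpow_sub_one hk0.ne',
        ← Real.rpow_sub_one hi0.ne', show -s - 1 = -(s + 1) by ring, Real.rpow_neg hi0.le,
        div_eq_mul_inv]
    have e3 : (x : ℂ) ^ (k * (i + 1)) / ((k * (i + 1) : ℕ) : ℂ)
        * ((Real.Gamma s : ℂ) * (((((k * (i + 1) : ℕ) : ℝ) ^ (-s) : ℝ) : ℂ) * u))
        = ((Real.Gamma s * x ^ (k * (i + 1))
          * (((k * (i + 1) : ℕ) : ℝ) ^ (-s) / ((k * (i + 1) : ℕ) : ℝ)) : ℝ) : ℂ) * u := by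
      rw [Complex.ofReal_mul, Complex.ofReal_div, Complex.ofReal_mul, Complex.ofReal_pow,
        Complex.ofReal_natCast]
      ring
    rw [e3, e2, pow_mul]
    congr 2
    ring

/-- Since `|x^j/j| ≤ ξ^j`, an error `η` in each model value `g j` sums to at most `η/(1-ξ)`,
uniformly in `x`. -/
lemma norm_rpow_mul_eulerLog_sub_le {s : ℝ} {x ξ : ℝ} (hξ0 : 0 ≤ ξ) (hξ : ξ < 1) (hx : |x| ≤ ξ)
    {w : ℂ} (hw : 0 < w.re) {R η : ℝ} (hη : 0 ≤ η) {g : ℕ → ℂ} {S : ℂ}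
    (hg : HasSum (fun j : ℕ => (x : ℂ) ^ j / j * g j) S)
    (hle : ∀ j : ℕ, 1 ≤ j → ‖(R : ℂ) * powerExpSeries s (j * w) - g j‖ ≤ η) :
    ‖(R : ℂ) * eulerLog s x (Complex.exp (-w)) - S‖ ≤ η * (1 - ξ)⁻¹ := by
  have h1 := (hasSum_eulerLog s (x := (x : ℂ)) (by simpa using hx.trans_lt hξ) hw).mul_left (R : ℂ)
  have h2 := h1.sub hg
  have h3 := (hasSum_geometric_of_lt_one hξ0 hξ).mul_left η
  rw [← h2.tsum_eq]
  refine tsum_of_norm_bounded h3 fun j => ?_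
  rw [mul_left_comm, ← mul_sub, norm_mul]
  rcases Nat.eq_zero_or_pos j with rfl | hj
  · simp; exact hη
  · rw [mul_comm η]
    exact mul_le_mul (norm_pow_div_natCast_le hx j) (hle j hj) (norm_nonneg _) (by positivity)

lemma eulerLog_dichotomy {s : ℝ} (hs : 1 < s) {ξ : ℝ} (hξ0 : 0 ≤ ξ) (hξ : ξ < 1) {η : ℝ}
    (hη : 0 < η) :
    ∃ r₀ > 0, ∀ r : ℝ, 0 < r → r < r₀ → ∀ θ : ℝ, |θ| ≤ Real.pi → ∀ x : ℝ, |x| ≤ ξ →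
      ‖((r ^ s : ℝ) : ℂ) * eulerLog s x (Complex.exp (-(r + θ * Complex.I)))‖ ≤ η ∨
      ∃ k : ℕ, 1 ≤ k ∧ ∃ t : ℝ, (k = 1 → t = θ / r) ∧
        ‖((r ^ s : ℝ) : ℂ) * eulerLog s x (Complex.exp (-(r + θ * Complex.I)))
          - ((gammaPolyLog s (x ^ k) / s * (k : ℝ) ^ (-(s + 1)) : ℝ) : ℂ)
            * (1 + (t : ℂ) * Complex.I) ^ (-(s : ℂ))‖ ≤ η := by
  have hξ1 : 0 < 1 - ξ := by linarith
  obtain ⟨r₀, hr₀, h⟩ := powerExpSeries_dichotomy hs (mul_pos hη hξ1)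
  refine ⟨r₀, hr₀, fun r hr hrr θ hθ x hx => ?_⟩
  have hw : 0 < ((r : ℂ) + θ * Complex.I).re := by simpa using hr
  have e : η * (1 - ξ) * (1 - ξ)⁻¹ = η := by field_simp
  rcases h r hr hrr θ hθ with h1 | ⟨k, hk, t, ht, h1⟩
  · left
    have := norm_rpow_mul_eulerLog_sub_le (s := s) hξ0 hξ hx hw (R := r ^ s) (mul_pos hη hξ1).le
      (g := fun _ => 0) (S := 0) (by simp) (fun j hj => by simpa using h1 j hj)
    rwa [sub_zero, e] at this
  · right
    refine ⟨k, hk, t, ht, ?_⟩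
    have := norm_rpow_mul_eulerLog_sub_le (s := s) hξ0 hξ hx hw (R := r ^ s) (mul_pos hη hξ1).le
      (hasSum_multiples (by linarith) (hx.trans_lt hξ) hk _) h1
    rwa [e] at this

/-- Away from the saddle point the Euler product is exponentially smaller than at the saddle
point, uniformly over the points at which `L_{1,1}` beats `L_{1,2}` by a fixed margin. -/
lemma eulerLog_minor {s : ℝ} (hs : 1 < s) {ξ : ℝ} (hξ0 : 0 ≤ ξ) (hξ : ξ < 1) {κ : ℝ} (hκ : 0 < κ)
    {ε : ℝ} (hε : 0 < ε) :
    ∃ δ > 0, ∃ r₀ > 0, ∀ r : ℝ, 0 < r → r < r₀ → ∀ θ : ℝ, 0 ≤ θ → θ ≤ Real.pi →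
      ε ≤ |θ / r - Real.tan (Real.pi / (s + 1))| → ∀ x : ℝ, -ξ ≤ x → x < 0 →
      κ ≤ -gammaPolyLog s x →
      gammaPolyLog s (x ^ 2) * 2 ^ (-(s + 1))
        ≤ -gammaPolyLog s x * Real.cos (Real.pi / (s + 1)) ^ (s + 1) - κ →
      r ^ s * (eulerLog s x (Complex.exp (-(r + θ * Complex.I)))).re
        ≤ -gammaPolyLog s x * Real.cos (Real.pi / (s + 1)) ^ (s + 1) / s - δ := by
  have hs0 : 0 < s := by linarith
  obtain ⟨δ₁, hδ₁, hG1⟩ := exists_neg_re_cpow_le_sub hs hε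
  have hc := cos_pi_div_pos hs
  set c := Real.cos (Real.pi / (s + 1)) ^ (s + 1) with hcdef
  have hc0 : 0 < c := by positivity
  -- One loss for each case: `k = 1` away from the saddle point, even `k`, and odd `k ≥ 3`. The last
  -- also covers the alternative where the product is small.
  set m := min (κ * δ₁ / s) (min (κ / s) (κ * c / (2 * s))) with hm
  have hm0 : 0 < m := by
    refine lt_min (by positivity) (lt_min (by positivity) (by positivity))
  have hm1 : m ≤ κ * δ₁ / s := min_le_left _ _
  have hm2 : m ≤ κ / s := (min_le_right _ _).trans (min_le_left _ _)
  have hm3 : m ≤ κ * c / (2 * s) := (min_le_right _ _).trans (min_le_right _ _)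
  obtain ⟨r₀, hr₀, hdi⟩ := eulerLog_dichotomy hs hξ0 hξ (half_pos hm0)
  refine ⟨m / 2, half_pos hm0, r₀, hr₀, fun r hr hrr θ hθ0 hθ hεθ x hxξ hx0 hκ1 hκ2 => ?_⟩
  have hx : |x| ≤ ξ := abs_le.2 ⟨hxξ, by linarith⟩
  have hx1 : -1 < x := by linarith
  set Λ := -gammaPolyLog s x with hΛ
  have hΛ0 : 0 < Λ := hκ.trans_le hκ1
  have hκc : κ * c / (2 * s) ≤ Λ * c / (2 * s) := by gcongr
  set z := eulerLog s x (Complex.exp (-(r + θ * Complex.I))) with hz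
  have hre : r ^ s * z.re = (((r ^ s : ℝ) : ℂ) * z).re := by rw [Complex.re_ofReal_mul]
  rw [hre]
  have hhalf : Λ * c / s = Λ * c / (2 * s) + Λ * c / (2 * s) := by field_simp; ring
  rcases hdi r hr hrr θ (abs_le.2 ⟨by linarith [Real.pi_pos], hθ⟩) x hx with h1 | ⟨k, hk, t, ht, h1⟩
  · have := (Complex.re_le_norm _).trans h1
    have : 0 < Λ * c / (2 * s) := by positivity
    linarith
  · have h2 := (Complex.re_le_norm _).trans h1
    rw [Complex.sub_re, Complex.re_ofReal_mul, Complex.re_ofReal_mul, ← hz] at h2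
    set u := ((1 + (t : ℂ) * Complex.I) ^ (-(s : ℂ))).re with hu
    have hu1 : u ≤ 1 := by
      refine (Complex.re_le_norm _).trans ?_
      rw [norm_one_add_mul_I_cpow_neg]
      exact Real.rpow_le_one (Real.cos_arctan_pos t).le (Real.cos_le_one _) hs0.le
    have hu2 : -u ≤ c := neg_re_cpow_le hs t
    suffices hmain : gammaPolyLog s (x ^ k) / s * (k : ℝ) ^ (-(s + 1)) * u ≤ Λ * c / s - m by
      rw [← hre]
      linarith
    rcases Nat.even_or_odd k with he | ho
    · have hk2 : 2 ≤ k := by obtain ⟨j, rfl⟩ := he; omega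
      have hx2 : 0 < x ^ 2 := by nlinarith
      have hx21 : x ^ 2 < 1 := by nlinarith
      obtain ⟨j, rfl⟩ := he
      have e : x ^ (j + j) = (x ^ 2) ^ j := by rw [← pow_mul]; ring_nf
      have hle : (x ^ 2) ^ j ≤ x ^ 2 := by
        simpa using pow_le_pow_of_le_one hx2.le hx21.le (by omega : 1 ≤ j)
      have h3 : gammaPolyLog s (x ^ (j + j)) ≤ gammaPolyLog s (x ^ 2) := by
        rw [e]
        exact mul_le_mul_of_nonneg_left (realPolyLog_mono (by linarith) (by positivity) hle hx21)
          (Real.Gamma_pos_of_pos (by linarith)).le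
      have h4 : 0 < gammaPolyLog s (x ^ (j + j)) := by
        rw [e]; exact gammaPolyLog_pos hs0 (by positivity) (hle.trans_lt hx21)
      have h5 : ((j + j : ℕ) : ℝ) ^ (-(s + 1)) ≤ 2 ^ (-(s + 1)) :=
        Real.rpow_le_rpow_of_nonpos (by norm_num) (by exact_mod_cast hk2) (by linarith)
      have h6 : 0 ≤ ((j + j : ℕ) : ℝ) ^ (-(s + 1)) := by positivity
      calc _ ≤ gammaPolyLog s (x ^ (j + j)) / s * ((j + j : ℕ) : ℝ) ^ (-(s + 1)) * 1 :=
            mul_le_mul_of_nonneg_left hu1 (by positivity)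
        _ ≤ gammaPolyLog s (x ^ 2) / s * 2 ^ (-(s + 1)) := by
            rw [mul_one]
            exact mul_le_mul (by gcongr) h5 h6 (div_nonneg (h4.le.trans h3) hs0.le)
        _ = gammaPolyLog s (x ^ 2) * 2 ^ (-(s + 1)) / s := by ring
        _ ≤ (Λ * c - κ) / s := by gcongr
        _ = Λ * c / s - κ / s := by ring
        _ ≤ _ := by linarith
    · rcases (show 1 ≤ k from hk).eq_or_lt with rfl | hk1
      · have hu3 : -u ≤ c - δ₁ := by
          refine hG1 t ?_ ?_
          · rw [ht rfl]; positivity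
          · rw [ht rfl]; exact hεθ
        have e : gammaPolyLog s (x ^ 1) / s * ((1 : ℕ) : ℝ) ^ (-(s + 1)) * u = Λ / s * (-u) := by
          rw [hΛ]; simp; ring
        rw [e]
        calc Λ / s * (-u) ≤ Λ / s * (c - δ₁) := mul_le_mul_of_nonneg_left hu3 (by positivity)
          _ = Λ * c / s - Λ * δ₁ / s := by ring
          _ ≤ Λ * c / s - κ * δ₁ / s := by gcongr
          _ ≤ _ := by linarith
      · have hk3 : 3 ≤ k := by obtain ⟨j, rfl⟩ := ho; omega
        have hxk : x ^ k < 0 := ho.pow_neg hx0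
        have hxk1 : -1 < x ^ k := by
          have := pow_lt_one₀ (by linarith : 0 ≤ -x) (by linarith) ho.pos.ne'
          rw [ho.neg_pow] at this
          linarith
        have h3 := neg_gammaPolyLog_odd_le hs0 hx1 hx0 ho
        have h4 := gammaPolyLog_neg hs0 hxk1 hxk
        have h5 : (k : ℝ) ^ (-(s + 1)) ≤ 1 / 4 := by
          calc (k : ℝ) ^ (-(s + 1)) ≤ 2 ^ (-(s + 1)) :=
                Real.rpow_le_rpow_of_nonpos (by norm_num) (by exact_mod_cast hk1) (by linarith)
            _ ≤ (2 : ℝ) ^ (-2 : ℝ) :=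
                Real.rpow_le_rpow_of_exponent_le (by norm_num) (by linarith)
            _ = 1 / 4 := by rw [Real.rpow_neg (by norm_num)]; norm_num
        have h6 : 0 ≤ (k : ℝ) ^ (-(s + 1)) := by positivity
        have h7 : 0 ≤ -gammaPolyLog s (x ^ k) / s * (k : ℝ) ^ (-(s + 1)) :=
          mul_nonneg (div_nonneg (by linarith) hs0.le) h6
        have h8 : -gammaPolyLog s (x ^ k) / s * (k : ℝ) ^ (-(s + 1)) ≤ 2 * Λ / s * (1 / 4) :=
          mul_le_mul (by gcongr) h5 h6 (by positivity)
        calc gammaPolyLog s (x ^ k) / s * (k : ℝ) ^ (-(s + 1)) * u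
            = -gammaPolyLog s (x ^ k) / s * (k : ℝ) ^ (-(s + 1)) * (-u) := by ring
          _ ≤ -gammaPolyLog s (x ^ k) / s * (k : ℝ) ^ (-(s + 1)) * c :=
              mul_le_mul_of_nonneg_left hu2 h7
          _ ≤ 2 * Λ / s * (1 / 4) * c := mul_le_mul_of_nonneg_right h8 hc0.le
          _ = Λ * c / (2 * s) := by field_simp; ring
          _ ≤ _ := by linarith

/-! ### The expansion near `q = 1` and the local shape of the saddle point. -/

/-- The behaviour of the Euler product near `q = 1`, in a cone. -/
lemma eulerLog_cone {s : ℝ} (hs : 1 < s) {K : ℝ} (hK : 0 ≤ K) {ξ : ℝ} (hξ0 : 0 ≤ ξ) (hξ : ξ < 1) :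
    ∃ C : ℝ, 0 ≤ C ∧ ∀ x : ℝ, |x| ≤ ξ → ∀ w : ℂ, 0 < w.re → |w.im| ≤ K * w.re →
      ‖eulerLog s x (Complex.exp (-w)) - (((gammaPolyLog s x / s : ℝ) : ℂ) * w ^ (-(s : ℂ))
        - riemannZeta (1 - (s : ℂ)) * Complex.log (1 - x))‖ ≤ C * ‖w‖ := by
  obtain ⟨C, hC, h⟩ := powerExpSeries_cone hs hK
  have hξ1 : 0 < 1 - ξ := by linarith
  refine ⟨C * (1 - ξ)⁻¹, by positivity, fun x hx w hw hw' => ?_⟩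
  have hx1 : |x| < 1 := hx.trans_lt hξ
  have hx' : ‖(x : ℂ)‖ < 1 := by simpa using hx1
  have h1 := hasSum_eulerLog s hx' hw
  have h2 := hasSum_multiples (s := s) (by linarith) hx1 le_rfl (w ^ (-(s : ℂ)))
  simp only [one_dvd, if_true, pow_one, Nat.cast_one, Real.one_rpow, mul_one] at h2
  have h3 := (Complex.hasSum_taylorSeries_neg_log hx').mul_right (riemannZeta (1 - (s : ℂ)))
  have h4 := h1.sub (h2.add h3)
  have h5 := ((hasSum_geometric_of_lt_one hξ0 hξ).mul_left (C * ‖w‖))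
  have e : eulerLog s x (Complex.exp (-w)) - (((gammaPolyLog s x / s : ℝ) : ℂ) * w ^ (-(s : ℂ))
        - riemannZeta (1 - (s : ℂ)) * Complex.log (1 - x))
      = eulerLog s x (Complex.exp (-w)) - (((gammaPolyLog s x / s : ℝ) : ℂ) * w ^ (-(s : ℂ))
        + -Complex.log (1 - x) * riemannZeta (1 - (s : ℂ))) := by ring
  rw [e, ← h4.tsum_eq, mul_right_comm]
  refine tsum_of_norm_bounded h5 fun j => ?_
  rcases Nat.eq_zero_or_pos j with rfl | hj
  · simp; positivity
  have hj0 : (0 : ℝ) < j := by exact_mod_cast hj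
  have hw0 : w ≠ 0 := by rintro rfl; simp at hw
  have h6 := h (j * w) (by simpa using mul_pos hj0 hw) (by
    simp only [Complex.mul_re, Complex.mul_im, Complex.natCast_re, Complex.natCast_im, zero_mul,
      sub_zero, add_zero, abs_mul, Nat.abs_cast]
    rw [mul_left_comm]
    exact mul_le_mul_of_nonneg_left hw' hj0.le)
  have e2 : ((j : ℂ) * w) ^ (-(s : ℂ)) = (((j : ℝ) ^ (-s) : ℝ) : ℂ) * w ^ (-(s : ℂ)) := by
    have := ofReal_mul_cpow hj0 hw0 (-(s : ℂ))
    rw [Complex.ofReal_natCast] at this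
    rw [this, Complex.ofReal_cpow hj0.le]
    push_cast; rfl
  rw [e2] at h6
  have e3 : (x : ℂ) ^ j / j * powerExpSeries s (j * w)
      - ((x : ℂ) ^ j / j * ((Real.Gamma s : ℂ) * ((((j : ℝ) ^ (-s) : ℝ) : ℂ) * w ^ (-(s : ℂ))))
        + (x : ℂ) ^ j / j * riemannZeta (1 - (s : ℂ)))
      = (x : ℂ) ^ j / j * (powerExpSeries s (j * w)
        - (Real.Gamma s : ℂ) * ((((j : ℝ) ^ (-s) : ℝ) : ℂ) * w ^ (-(s : ℂ)))
        - riemannZeta (1 - (s : ℂ))) := by ring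
  rw [e3, norm_mul, norm_div, norm_pow, Complex.norm_real, Complex.norm_natCast, Real.norm_eq_abs]
  rw [norm_mul, Complex.norm_natCast] at h6
  calc |x| ^ j / j * _ ≤ |x| ^ j / j * (C * (j * ‖w‖)) := mul_le_mul_of_nonneg_left h6 (by positivity)
    _ = C * ‖w‖ * |x| ^ j := by field_simp
    _ ≤ C * ‖w‖ * ξ ^ j := by gcongr

/-- The phase function of the saddle point method, normalised to have its saddle point at
`e ^ (i π / (s + 1))`. -/
noncomputable def saddlePhase (s : ℝ) (v : ℂ) : ℂ := v - v ^ (-(s : ℂ)) / s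

/-- The saddle point of `saddlePhase`. -/
noncomputable def saddlePoint (s : ℝ) : ℂ := Complex.exp (((Real.pi / (s + 1) : ℝ) : ℂ) * Complex.I)

lemma hasDerivAt_deriv_saddlePhase (s : ℝ) {v : ℂ} (hv : v ∈ Complex.slitPlane) :
    HasDerivAt (fun v : ℂ => 1 + v ^ (-(s : ℂ) - 1)) (-((s : ℂ) + 1) * v ^ (-(s : ℂ) - 2)) v := by
  refine (((hasDerivAt_id v).cpow_const (c := -(s : ℂ) - 1) hv).const_add 1).congr_deriv ?_
  simp only [id, mul_one]
  rw [show -(s : ℂ) - 1 - 1 = -(s : ℂ) - 2 by ring]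
  ring

section
variable {s : ℝ} (hs : 1 < s)
include hs

lemma saddlePoint_re_pos : 0 < (saddlePoint s).re := by
  rw [saddlePoint, Complex.exp_ofReal_mul_I_re]
  exact cos_pi_div_pos hs

lemma saddlePoint_cpow (z : ℂ) :
    saddlePoint s ^ z = Complex.exp (((Real.pi / (s + 1) : ℝ) : ℂ) * Complex.I * z) := by
  have hα := pi_div_lt_pi_div_two hs
  have hα0 : 0 < Real.pi / (s + 1) := div_pos Real.pi_pos (by linarith)
  have hpi := Real.pi_pos
  rw [saddlePoint, Complex.cpow_def_of_ne_zero (Complex.exp_ne_zero _), Complex.log_exp]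
  · simp only [Complex.mul_im, Complex.ofReal_re, Complex.I_im, Complex.ofReal_im, Complex.I_re]
    linarith
  · simp only [Complex.mul_im, Complex.ofReal_re, Complex.I_im, Complex.ofReal_im, Complex.I_re]
    linarith

/-- This is the critical point equation `1 + v^(-s-1) = 0`. -/
lemma saddlePoint_cpow_neg : saddlePoint s ^ (-(s : ℂ) - 1) = -1 := by
  have h : (s : ℂ) + 1 ≠ 0 := by
    have : s + 1 ≠ 0 := by linarith
    exact_mod_cast this
  rw [saddlePoint_cpow hs,
    show ((Real.pi / (s + 1) : ℝ) : ℂ) * Complex.I * (-(s : ℂ) - 1) = -(Real.pi * Complex.I) by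
      push_cast; field_simp; ring,
    Complex.exp_neg, Complex.exp_pi_mul_I]
  norm_num

lemma saddlePoint_cpow_neg' : saddlePoint s ^ (-(s : ℂ)) = -saddlePoint s := by
  have h0 : saddlePoint s ≠ 0 := Complex.exp_ne_zero _
  have := saddlePoint_cpow_neg hs
  rw [Complex.cpow_sub _ _ h0, Complex.cpow_one, div_eq_iff h0] at this
  rw [this]; ring

lemma saddlePhase_saddlePoint : saddlePhase s (saddlePoint s) = ((s + 1) / s : ℝ) * saddlePoint s := by
  have : (s : ℂ) ≠ 0 := by exact_mod_cast (by linarith : s ≠ 0)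
  rw [saddlePhase, saddlePoint_cpow_neg' hs]
  push_cast
  field_simp
  ring

lemma hasDerivAt_saddlePhase {v : ℂ} (hv : v ∈ Complex.slitPlane) :
    HasDerivAt (saddlePhase s) (1 + v ^ (-(s : ℂ) - 1)) v := by
  have h0 : (s : ℂ) ≠ 0 := by exact_mod_cast (by linarith : s ≠ 0)
  refine ((hasDerivAt_id v).sub (((hasDerivAt_id v).cpow_const (c := -(s : ℂ)) hv).div_const
    (s : ℂ))).congr_deriv ?_
  simp only [id]
  field_simp
  ring

/-- The first derivative vanishes and the second is `(s+1)/v₀`. On the vertical line the increment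
is `iτ`, whose square turns the quadratic term negative. -/
lemma saddlePhase_taylor : ∃ C : ℝ, 0 < C ∧ ∃ ε₀ > 0, ∀ τ : ℝ, |τ| ≤ ε₀ →
    ‖saddlePhase s (saddlePoint s + τ * Complex.I) - saddlePhase s (saddlePoint s)
      + (s + 1) / saddlePoint s * τ ^ 2 / 2‖ ≤ C * |τ| ^ 3 := by
  have hslit : saddlePoint s ∈ Complex.slitPlane := Or.inl (saddlePoint_re_pos hs)
  have h0 : saddlePoint s ≠ 0 := Complex.exp_ne_zero _
  have hev : ∀ᶠ v in 𝓝 (saddlePoint s), v ∈ Complex.slitPlane :=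
    Complex.isOpen_slitPlane.mem_nhds hslit
  have han : AnalyticAt ℂ (saddlePhase s) (saddlePoint s) := by
    rw [Complex.analyticAt_iff_eventually_differentiableAt]
    exact hev.mono fun v hv => (hasDerivAt_saddlePhase hs hv).differentiableAt
  have hd1 : deriv (saddlePhase s) (saddlePoint s) = 0 := by
    rw [(hasDerivAt_saddlePhase hs hslit).deriv, saddlePoint_cpow_neg hs]; ring
  have hd2 : iteratedDeriv 2 (saddlePhase s) (saddlePoint s) = (s + 1) / saddlePoint s := by
    have he : deriv (saddlePhase s) =ᶠ[𝓝 (saddlePoint s)] fun v => 1 + v ^ (-(s : ℂ) - 1) :=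
      hev.mono fun v hv => (hasDerivAt_saddlePhase hs hv).deriv
    rw [iteratedDeriv_succ, iteratedDeriv_one, he.deriv_eq,
      (hasDerivAt_deriv_saddlePhase s hslit).deriv,
      show -(s : ℂ) - 2 = -(s : ℂ) - 1 - 1 by ring, Complex.cpow_sub _ _ h0, saddlePoint_cpow_neg hs,
      Complex.cpow_one]
    ring
  have hO := han.hasFPowerSeriesAt.isBigO_sub_partialSum_pow 3
  obtain ⟨C, hC, hO⟩ := hO.exists_pos
  rw [Asymptotics.isBigOWith_iff] at hO
  obtain ⟨ε, hε, hball⟩ := Metric.eventually_nhds_iff.1 hO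
  refine ⟨C, hC, ε / 2, half_pos hε, fun τ hτ => ?_⟩
  have hn : ‖(τ : ℂ) * Complex.I‖ = |τ| := by simp
  have h := hball (y := τ * Complex.I) (by rw [dist_zero_right, hn]; linarith)
  rw [norm_pow, norm_norm, hn] at h
  refine le_trans (le_of_eq ?_) h
  congr 1
  simp only [FormalMultilinearSeries.partialSum, Finset.sum_range_succ, Finset.sum_range_zero,
    FormalMultilinearSeries.ofScalars_apply_eq, iteratedDeriv_zero, iteratedDeriv_one, hd1, hd2,
    smul_eq_mul]
  simp [mul_pow]
  ring

end

/-! ### Laplace's method. -/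

lemma norm_exp_sub_exp_le {a b : ℂ} {R : ℝ} (ha : a.re ≤ R) (hb : b.re ≤ R) :
    ‖Complex.exp a - Complex.exp b‖ ≤ Real.exp R * ‖a - b‖ := by
  refine (convex_halfSpace_re_le R).norm_image_sub_le_of_norm_hasDerivWithin_le
    (f' := Complex.exp) (fun z _ => (Complex.hasDerivAt_exp z).hasDerivWithinAt) (fun z hz => ?_) hb ha
  rw [Complex.norm_exp]
  exact Real.exp_le_exp.2 hz

/-- Laplace's method on a short symmetric interval, with relative error
`O(M ^ (-1/2)) + O(ρ)`. -/
lemma exists_gaussian_approx {A : ℂ} (hA : 0 < A.re) {C ε B : ℝ} (hC : 0 ≤ C) (hε : 0 < ε)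
    (hCε : C * ε ≤ A.re / 4) (hB : 0 ≤ B) {D : ℝ → ℂ}
    (hD : ∀ τ : ℝ, |τ| ≤ ε → ‖D τ + A * τ ^ 2 / 2‖ ≤ C * |τ| ^ 3) :
    ∃ C' : ℝ, 0 ≤ C' ∧ ∀ M ρ : ℝ, 1 ≤ M → 0 ≤ ρ → ρ ≤ 1 → ∀ F : ℝ → ℂ,
      IntervalIntegrable F volume (-ε) ε →
      (∀ τ : ℝ, |τ| ≤ ε → ∃ e : ℂ, F τ = Complex.exp (M * D τ + e) ∧ ‖e‖ ≤ B * ρ) →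
      ‖(∫ τ in (-ε)..ε, F τ) - (2 * Real.pi / (M * A)) ^ (1 / 2 : ℂ)‖
        ≤ C' * (M⁻¹ + ρ * M ^ (-(1 / 2 : ℝ))) := by
  -- Half of the decay rate of the Gaussian: the cubic remainder uses up at most the other half.
  set b : ℝ := A.re / 4 with hb
  have hb0 : 0 < b := by positivity
  -- The first summand pays for the cubic remainder inside the interval. The second pays for the
  -- tails of the Gaussian, where `1 ≤ ε^(-3) M |τ|³`.
  set K₁ : ℝ := Real.exp B * C + (ε ^ 3)⁻¹ with hK₁
  set K₂ : ℝ := Real.exp B * B with hK₂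
  have hK₁0 : 0 ≤ K₁ := by positivity
  have hK₂0 : 0 ≤ K₂ := by positivity
  set G₃ : ℝ → ℝ := fun y => |y| ^ 3 * Real.exp (-b * y ^ 2) with hG₃
  set G₀ : ℝ → ℝ := fun y => Real.exp (-b * y ^ 2) with hG₀
  have hi₀ : Integrable G₀ := integrable_exp_neg_mul_sq hb0
  have hi₃ : Integrable G₃ := by
    have := (integrable_rpow_mul_exp_neg_mul_sq hb0 (s := 3) (by norm_num)).norm
    refine this.congr (Eventually.of_forall fun y => ?_)
    simp only [hG₃]
    rw [norm_mul, Real.norm_of_nonneg (Real.exp_pos _).le,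
      show (3 : ℝ) = ((3 : ℕ) : ℝ) by norm_num, Real.rpow_natCast, norm_pow, Real.norm_eq_abs]
  set I₃ := ∫ y, G₃ y with hI₃
  set I₀ := ∫ y, G₀ y with hI₀
  have hI₃0 : 0 ≤ I₃ := integral_nonneg fun y => by positivity
  have hI₀0 : 0 ≤ I₀ := integral_nonneg fun y => by positivity
  refine ⟨K₁ * I₃ + K₂ * I₀, by positivity, fun M ρ hM hρ0 hρ1 F hF hFe => ?_⟩
  have hM0 : 0 < M := by linarith
  set m : ℝ := M ^ (1 / 2 : ℝ) with hm
  have hm0 : 0 < m := by positivity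
  have hmm : m ^ 2 = M := by
    rw [hm, ← Real.rpow_natCast, ← Real.rpow_mul hM0.le]; norm_num
  have hminv : M ^ (-(1 / 2 : ℝ)) = m⁻¹ := by rw [Real.rpow_neg hM0.le]
  set bound : ℝ → ℝ := fun τ => K₁ * (m⁻¹ * G₃ (m * τ)) + K₂ * (ρ * G₀ (m * τ)) with hbound
  have hbi : Integrable bound :=
    (((hi₃.comp_mul_left' hm0.ne').const_mul _).const_mul _).add
      (((hi₀.comp_mul_left' hm0.ne').const_mul _).const_mul _)
  have hbint : ∫ τ, bound τ = K₁ * I₃ * M⁻¹ + K₂ * I₀ * (ρ * m⁻¹) := by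
    simp only [hbound]
    rw [integral_add (((hi₃.comp_mul_left' hm0.ne').const_mul _).const_mul _)
      (((hi₀.comp_mul_left' hm0.ne').const_mul _).const_mul _), integral_const_mul,
      integral_const_mul, integral_const_mul, integral_const_mul,
      Measure.integral_comp_mul_left, Measure.integral_comp_mul_left, abs_of_pos (inv_pos.2 hm0),
      ← hmm, smul_eq_mul, smul_eq_mul, ← hI₃, ← hI₀]
    field_simp
  have hbb : ∀ τ : ℝ, bound τ = (K₁ * (M * |τ| ^ 3) + K₂ * ρ) * Real.exp (-(M * b * τ ^ 2)) := by
    intro τ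
    simp only [hbound, hG₃, hG₀]
    rw [abs_mul, abs_of_pos hm0, mul_pow, mul_pow, hmm,
      show -b * (M * τ ^ 2) = -(M * b * τ ^ 2) by ring]
    have : m⁻¹ * (m ^ 3 * |τ| ^ 3 * Real.exp (-(M * b * τ ^ 2)))
        = M * |τ| ^ 3 * Real.exp (-(M * b * τ ^ 2)) := by
      rw [← hmm]; field_simp
    rw [this]; ring
  have hcomplex : 0 < ((M : ℂ) * A / 2).re := by
    have : ((M : ℂ) * A / 2).re = M * A.re / 2 := by
      rw [show (M : ℂ) * A / 2 = ((M / 2 : ℝ) : ℂ) * A by push_cast; ring, Complex.re_ofReal_mul]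
      ring
    rw [this]; positivity
  have hgauss := integral_gaussian_complex hcomplex
  have hgi : Integrable fun τ : ℝ => Complex.exp (-((M : ℂ) * A / 2) * (τ : ℂ) ^ 2) :=
    integrable_cexp_neg_mul_sq hcomplex
  have e1 : (2 * Real.pi / (M * A) : ℂ) = Real.pi / (M * A / 2) := by field_simp
  rw [e1, ← hgauss, intervalIntegral.integral_of_le (by linarith),
    ← integral_indicator measurableSet_Ioc, ← integral_sub _ hgi]
  · have hfin : (K₁ * I₃ + K₂ * I₀) * (M⁻¹ + ρ * M ^ (-(1 / 2 : ℝ))) ≥ ∫ τ, bound τ := by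
      rw [hbint, hminv]
      have h1 : 0 ≤ K₁ * I₃ * (ρ * m⁻¹) := by positivity
      have h2 : 0 ≤ K₂ * I₀ * M⁻¹ := by positivity
      nlinarith
    refine le_trans (norm_integral_le_of_norm_le hbi (Eventually.of_forall fun τ => ?_)) hfin
    rw [hbb]
    have hre : (-((M : ℂ) * A / 2) * (τ : ℂ) ^ 2).re = -(2 * (M * b * τ ^ 2)) := by
      rw [show -((M : ℂ) * A / 2) * (τ : ℂ) ^ 2 = ((-(M * τ ^ 2 / 2) : ℝ) : ℂ) * A by push_cast; ring,
        Complex.re_ofReal_mul, hb]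
      ring
    have hMb : 0 ≤ M * b * τ ^ 2 := by positivity
    have hexp := Real.exp_pos (-(M * b * τ ^ 2))
    by_cases hτ : τ ∈ Ioc (-ε) ε
    · rw [indicator_of_mem hτ]
      have hτ' : |τ| ≤ ε := abs_le.2 ⟨hτ.1.le, hτ.2⟩
      obtain ⟨e, he, hen⟩ := hFe τ hτ'
      have hdiff : ((M : ℂ) * D τ + e) - (-((M : ℂ) * A / 2) * (τ : ℂ) ^ 2)
          = (M : ℂ) * (D τ + A * τ ^ 2 / 2) + e := by ring
      have hn : ‖((M : ℂ) * D τ + e) - (-((M : ℂ) * A / 2) * (τ : ℂ) ^ 2)‖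
          ≤ M * (C * |τ| ^ 3) + B * ρ := by
        rw [hdiff]
        refine (norm_add_le _ _).trans (add_le_add ?_ hen)
        rw [norm_mul, Complex.norm_real, Real.norm_of_nonneg hM0.le]
        exact mul_le_mul_of_nonneg_left (hD τ hτ') hM0.le
      have h3 : C * |τ| ^ 3 ≤ b * τ ^ 2 := by
        have : |τ| ^ 3 = |τ| * τ ^ 2 := by rw [pow_succ', sq_abs]
        rw [this, ← mul_assoc]
        refine mul_le_mul_of_nonneg_right ?_ (sq_nonneg τ)
        exact (mul_le_mul_of_nonneg_left hτ' hC).trans hCε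
      have h4 : M * (C * |τ| ^ 3) ≤ M * b * τ ^ 2 := by
        rw [mul_assoc]; exact mul_le_mul_of_nonneg_left h3 hM0.le
      have hBρ : B * ρ ≤ B := mul_le_of_le_one_right hB hρ1
      have hare : ((M : ℂ) * D τ + e).re ≤ -(M * b * τ ^ 2) + B := by
        have := (Complex.re_le_norm _).trans hn
        rw [Complex.sub_re, hre] at this
        linarith
      rw [he]
      refine (norm_exp_sub_exp_le hare (by rw [hre]; linarith)).trans ?_
      rw [Real.exp_add]
      have h5 : Real.exp B * (M * (C * |τ| ^ 3) + B * ρ) ≤ K₁ * (M * |τ| ^ 3) + K₂ * ρ := by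
        have : 0 ≤ (ε ^ 3)⁻¹ * (M * |τ| ^ 3) := by positivity
        rw [hK₁, hK₂]; nlinarith
      calc _ ≤ Real.exp (-(M * b * τ ^ 2)) * Real.exp B * (M * (C * |τ| ^ 3) + B * ρ) :=
            mul_le_mul_of_nonneg_left hn (by positivity)
        _ = Real.exp B * (M * (C * |τ| ^ 3) + B * ρ) * Real.exp (-(M * b * τ ^ 2)) := by ring
        _ ≤ _ := mul_le_mul_of_nonneg_right h5 hexp.le
    · rw [indicator_of_notMem hτ, zero_sub, norm_neg, Complex.norm_exp, hre]
      have hτ' : ε ≤ |τ| := by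
        by_contra hlt
        have := abs_lt.1 (not_le.1 hlt)
        exact hτ ⟨this.1, this.2.le⟩
      have h6 : 1 ≤ (ε ^ 3)⁻¹ * (M * |τ| ^ 3) := by
        have h7 : ε ^ 3 ≤ |τ| ^ 3 := pow_le_pow_left₀ hε.le hτ' 3
        have h8 : |τ| ^ 3 ≤ M * |τ| ^ 3 := le_mul_of_one_le_left (by positivity) hM
        rw [inv_mul_eq_div, one_le_div (by positivity)]
        linarith
      have h9 : 1 ≤ K₁ * (M * |τ| ^ 3) + K₂ * ρ := by
        have h10 : 0 ≤ Real.exp B * C * (M * |τ| ^ 3) := by positivity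
        have h11 : 0 ≤ K₂ * ρ := by positivity
        rw [hK₁, add_mul]; linarith
      calc Real.exp (-(2 * (M * b * τ ^ 2))) ≤ Real.exp (-(M * b * τ ^ 2)) :=
            Real.exp_le_exp.2 (by linarith)
        _ ≤ _ := le_mul_of_one_le_left hexp.le h9
  · rw [integrable_indicator_iff measurableSet_Ioc]
    exact (intervalIntegrable_iff_integrableOn_Ioc_of_le (by linarith)).1 hF

/-! ### Cauchy's integral: neighbourhood of the saddle point and the rest. -/

lemma saddlePoint_eq (s : ℝ) : saddlePoint s
    = (Real.cos (Real.pi / (s + 1)) : ℂ) + (Real.sin (Real.pi / (s + 1)) : ℂ) * Complex.I := by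
  rw [saddlePoint, Complex.exp_mul_I, Complex.ofReal_cos, Complex.ofReal_sin]

lemma continuous_eulerLog_circle (s : ℝ) {x : ℝ} (hx : |x| < 1) {r : ℝ} (hr : 0 < r) (N : ℝ) :
    Continuous fun θ : ℝ => Complex.exp (eulerLog s x (Complex.exp (-((r : ℂ) + θ * Complex.I)))
      + N * ((r : ℂ) + θ * Complex.I)) := by
  have : Continuous fun θ : ℝ => eulerLog s x (Complex.exp (-((r : ℂ) + θ * Complex.I))) := by
    refine (differentiableOn_eulerLog s (by simpa using hx)).continuousOn.comp_continuous
      (by fun_prop) (fun θ => ?_)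
    rw [mem_ball_zero_iff, Complex.norm_exp]
    simpa using hr
  fun_prop

/-- If `‖H‖ ≤ K` outside a subinterval, then the integral of `H` is that over the subinterval up to
`K` times the length. -/
lemma norm_integral_sub_middle_le {H : ℝ → ℂ} (hH : Continuous H) {a b c d K T : ℝ} {z : ℂ}
    (hab : a ≤ b) (hbc : b ≤ c) (hcd : c ≤ d) (hK : 0 ≤ K) (h1 : ∀ θ ∈ Ioc a b, ‖H θ‖ ≤ K)
    (h2 : ∀ θ ∈ Ioc c d, ‖H θ‖ ≤ K) (hT : ‖(∫ θ in b..c, H θ) - z‖ ≤ T) :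
    ‖(∫ θ in a..d, H θ) - z‖ ≤ T + (d - a) * K := by
  have i1 : ‖∫ θ in a..b, H θ‖ ≤ K * |b - a| :=
    intervalIntegral.norm_integral_le_of_norm_le_const (by rwa [uIoc_of_le hab])
  have i2 : ‖∫ θ in c..d, H θ‖ ≤ K * |d - c| :=
    intervalIntegral.norm_integral_le_of_norm_le_const (by rwa [uIoc_of_le hcd])
  rw [abs_of_nonneg (by linarith)] at i1 i2
  rw [← intervalIntegral.integral_add_adjacent_intervals (hH.intervalIntegrable a c)
    (hH.intervalIntegrable c d), ← intervalIntegral.integral_add_adjacent_intervals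
    (hH.intervalIntegrable a b) (hH.intervalIntegrable b c),
    show (∫ θ in a..b, H θ) + (∫ θ in b..c, H θ) + (∫ θ in c..d, H θ) - z
      = (∫ θ in a..b, H θ) + (∫ θ in c..d, H θ) + ((∫ θ in b..c, H θ) - z) by ring]
  refine (norm_add_le _ _).trans ((add_le_add ((norm_add_le _ _).trans (add_le_add i1 i2)) hT).trans ?_)
  have : 0 ≤ K * (c - b) := mul_nonneg hK (by linarith)
  linarith

/-- The part of Cauchy's integral near the saddle point. -/
lemma norm_integral_major_sub_le {H F : ℝ → ℂ} {Z P g : ℂ} (hZP : Z * P ≠ 0) {ρ ε t T : ℝ} (hρ : 0 ≤ ρ)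
    (hF : F = fun τ => (Z * P)⁻¹ * H (ρ * τ + ρ * t)) (h1 : ‖(∫ τ in (-ε)..ε, F τ) - g‖ ≤ T) :
    ‖(∫ θ in (ρ * -ε + ρ * t)..(ρ * ε + ρ * t), H θ) - Z * P * (ρ * g)‖
      ≤ ‖P‖ * (‖Z‖ * (ρ * T)) := by
  have h2 : (∫ θ in (ρ * -ε + ρ * t)..(ρ * ε + ρ * t), H θ) = Z * P * (ρ * ∫ τ in (-ε)..ε, F τ) := by
    rw [hF, intervalIntegral.integral_const_mul,
      ← intervalIntegral.smul_integral_comp_mul_add (f := H) ρ (ρ * t), Complex.real_smul,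
      mul_left_comm (ρ : ℂ), mul_inv_cancel_left₀ hZP]
  rw [h2, ← mul_sub, ← mul_sub, norm_mul, norm_mul, norm_mul, Complex.norm_real,
    Real.norm_of_nonneg hρ, mul_comm ‖Z‖ ‖P‖, mul_assoc]
  gcongr

section
variable {s : ℝ} (hs : 1 < s)
include hs

lemma sin_pi_div_pos : 0 < Real.sin (Real.pi / (s + 1)) :=
  Real.sin_pos_of_pos_of_lt_pi (div_pos Real.pi_pos (by linarith))
    (by linarith [pi_div_lt_pi_div_two hs, Real.pi_pos])

lemma saddlePhase_saddlePoint_re :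
    (saddlePhase s (saddlePoint s)).re = (s + 1) / s * Real.cos (Real.pi / (s + 1)) := by
  rw [saddlePhase_saddlePoint hs, Complex.re_ofReal_mul, saddlePoint, Complex.exp_ofReal_mul_I_re]

/-- The logarithm of the integrand of Cauchy's formula near the saddle point, in the scale of the
saddle point. -/
lemma eulerLog_near_saddle {ε : ℝ} (hε1 : ε ≤ 1) {ξ : ℝ}
    (hξ0 : 0 ≤ ξ) (hξ : ξ < 1) :
    ∃ B : ℝ, 0 ≤ B ∧ ∀ x : ℝ, |x| ≤ ξ → ∀ N ρ M : ℝ, 0 < ρ → N * ρ = M →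
      -gammaPolyLog s x * ρ ^ (-s) = M → ∀ τ : ℝ, |τ| ≤ ε → ∃ e : ℂ,
      eulerLog s x (Complex.exp (-(((Real.cos (Real.pi / (s + 1)) * ρ : ℝ) : ℂ)
          + ((ρ * τ + ρ * Real.sin (Real.pi / (s + 1)) : ℝ) : ℂ) * Complex.I)))
        + N * (((Real.cos (Real.pi / (s + 1)) * ρ : ℝ) : ℂ)
          + ((ρ * τ + ρ * Real.sin (Real.pi / (s + 1)) : ℝ) : ℂ) * Complex.I)
      = -riemannZeta (1 - (s : ℂ)) * Complex.log (1 - x) + M * saddlePhase s (saddlePoint s)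
        + (M * (saddlePhase s (saddlePoint s + τ * Complex.I) - saddlePhase s (saddlePoint s)) + e)
      ∧ ‖e‖ ≤ B * ρ := by
  have hc := cos_pi_div_pos hs
  have ht0 := sin_pi_div_pos hs
  have ht1 := Real.sin_le_one (Real.pi / (s + 1))
  have hv0 := saddlePoint_eq s
  set c := Real.cos (Real.pi / (s + 1)) with hcdef
  set t₀ := Real.sin (Real.pi / (s + 1)) with ht₀
  have hs0 : (s : ℂ) ≠ 0 := by exact_mod_cast (by linarith : s ≠ 0)
  -- In the scale of the saddle point the real part is `c` and the imaginary part at most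
  -- `sin(π/(s+1)) + ε ≤ 2`, so the slope `2/c` suffices.
  obtain ⟨C, hC, h⟩ := eulerLog_cone hs (K := 2 / c) (by positivity) hξ0 hξ
  refine ⟨C * 2, by positivity, fun x hx N ρ M hρ hNρ hΛ τ hτ => ?_⟩
  set v : ℂ := saddlePoint s + τ * Complex.I with hv
  set w : ℂ := ((c * ρ : ℝ) : ℂ) + ((ρ * τ + ρ * t₀ : ℝ) : ℂ) * Complex.I with hw
  have hwv : w = (ρ : ℂ) * v := by
    rw [hw, hv, hv0]; push_cast; ring
  have hwre : w.re = c * ρ := by simp [hw]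
  have hwim : w.im = ρ * (t₀ + τ) := by
    simp [hw]; ring
  have hvre : v.re = c := by
    rw [hv, hv0]; simp
  have hv_ne : v ≠ 0 := by
    intro h0; rw [h0] at hvre; simp at hvre; linarith
  have habs : |t₀ + τ| ≤ 2 := by
    refine (abs_add_le _ _).trans ?_
    rw [abs_of_pos ht0]; linarith
  have hnv : ‖v‖ ≤ 2 := by
    have h1 : ‖saddlePoint s‖ = 1 := Complex.norm_exp_ofReal_mul_I _
    have h2 : ‖(τ : ℂ) * Complex.I‖ ≤ 1 := by simpa using hτ.trans hε1
    exact (norm_add_le _ _).trans (by linarith)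
  have h1 := h x hx w (by rw [hwre]; positivity) (by
    rw [hwim, hwre, abs_mul, abs_of_pos hρ]
    have : 2 / c * (c * ρ) = ρ * 2 := by field_simp
    rw [this]
    exact mul_le_mul_of_nonneg_left habs hρ.le)
  have hpow : ((gammaPolyLog s x / s : ℝ) : ℂ) * w ^ (-(s : ℂ)) = -(M * (v ^ (-(s : ℂ)) / s)) := by
    rw [hwv, ofReal_mul_cpow hρ hv_ne, ← Complex.ofReal_neg, ← Complex.ofReal_cpow hρ.le, ← hΛ]
    push_cast
    field_simp
  have hNw : (N : ℂ) * w = M * v := by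
    rw [hwv, ← mul_assoc, ← Complex.ofReal_mul, hNρ]
  refine ⟨eulerLog s x (Complex.exp (-w)) - (((gammaPolyLog s x / s : ℝ) : ℂ) * w ^ (-(s : ℂ))
        - riemannZeta (1 - (s : ℂ)) * Complex.log (1 - x)), ?_, h1.trans ?_⟩
  · rw [hNw, hpow, saddlePhase, saddlePhase]
    ring
  · rw [hwv, norm_mul, Complex.norm_real, Real.norm_of_nonneg hρ.le]
    have : ρ * ‖v‖ ≤ ρ * 2 := mul_le_mul_of_nonneg_left hnv hρ.le
    nlinarith

/-- The integrand of Cauchy's formula away from the saddle point. -/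
lemma norm_integrand_minor_le {x N ρ M δ Λ₁ θ : ℝ} (hρ : 0 < ρ) (hM : 0 < M) (hδ : 0 < δ)
    (hΛ0 : 0 < -gammaPolyLog s x) (hΛle : -gammaPolyLog s x ≤ Λ₁) (hNρ : N * ρ = M)
    (hΛρ : -gammaPolyLog s x * ρ ^ (-s) = M)
    (h2 : (Real.cos (Real.pi / (s + 1)) * ρ) ^ s * (eulerLog s x (Complex.exp
        (-(((Real.cos (Real.pi / (s + 1)) * ρ : ℝ) : ℂ) + θ * Complex.I)))).re
      ≤ -gammaPolyLog s x * Real.cos (Real.pi / (s + 1)) ^ (s + 1) / s - δ) :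
    ‖Complex.exp (eulerLog s x (Complex.exp
            (-(((Real.cos (Real.pi / (s + 1)) * ρ : ℝ) : ℂ) + θ * Complex.I)))
          + N * (((Real.cos (Real.pi / (s + 1)) * ρ : ℝ) : ℂ) + θ * Complex.I))‖
      ≤ Real.exp (M * (saddlePhase s (saddlePoint s)).re) * Real.exp (-(δ / Λ₁ * M)) := by
  have hs0 : 0 < s := by linarith
  have hc := cos_pi_div_pos hs
  have hc1 := Real.cos_le_one (Real.pi / (s + 1))
  have hre := saddlePhase_saddlePoint_re hs
  set c := Real.cos (Real.pi / (s + 1)) with hcdef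
  set Λ := -gammaPolyLog s x with hΛ
  have hr : 0 < c * ρ := by positivity
  rw [Complex.norm_exp, ← Real.exp_add]
  refine Real.exp_le_exp.2 ?_
  rw [Complex.add_re, Complex.re_ofReal_mul, hre]
  have e3 : (((c * ρ : ℝ) : ℂ) + θ * Complex.I).re = c * ρ := by simp
  rw [e3]
  set L := (eulerLog s x (Complex.exp (-(((c * ρ : ℝ) : ℂ) + θ * Complex.I)))).re with hL
  have hpos : 0 < (c * ρ) ^ (-s) := by positivity
  have hinv : (c * ρ) ^ (-s) * (c * ρ) ^ s = 1 := by
    rw [← Real.rpow_add hr, neg_add_cancel, Real.rpow_zero]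
  have h3 := mul_le_mul_of_nonneg_left h2 hpos.le
  rw [← mul_assoc, hinv, one_mul] at h3
  have e4 : (c * ρ) ^ (-s) = c ^ (-s) * ρ ^ (-s) := Real.mul_rpow hc.le hρ.le
  have e5 : (c * ρ) ^ (-s) * (Λ * c ^ (s + 1) / s) = M * c / s := by
    rw [e4, ← hΛρ]
    have : c ^ (-s) * c ^ (s + 1) = c := by
      rw [← Real.rpow_add hc]; simp
    calc c ^ (-s) * ρ ^ (-s) * (Λ * c ^ (s + 1) / s)
        = Λ * ρ ^ (-s) * (c ^ (-s) * c ^ (s + 1)) / s := by ring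
      _ = _ := by rw [this]
  have e6 : δ / Λ₁ * M ≤ (c * ρ) ^ (-s) * δ := by
    have h5 : ρ ^ (-s) = M / Λ := by rw [← hΛρ]; field_simp
    have h6 : 1 ≤ c ^ (-s) := Real.one_le_rpow_of_pos_of_le_one_of_nonpos hc hc1 (by linarith)
    have h7 : M / Λ₁ ≤ M / Λ := by gcongr
    rw [e4, h5]
    calc δ / Λ₁ * M = M / Λ₁ * δ := by ring
      _ ≤ M / Λ * δ := by gcongr
      _ ≤ c ^ (-s) * (M / Λ) * δ := by
          gcongr
          exact le_mul_of_one_le_left (by positivity) h6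
  rw [mul_sub, e5] at h3
  have e7 : N * (c * ρ) = M * c := by rw [← hNρ]; ring
  have e8 : M * ((s + 1) / s * c) = M * c / s + M * c := by field_simp; ring
  rw [e7, e8]
  linarith

/-- The saddle point asymptotics of Cauchy's integral. -/
lemma integral_saddle_asymptotics {ξ : ℝ} (hξ0 : 0 ≤ ξ) (hξ : ξ < 1) {κ Λ₁ : ℝ} (hκ : 0 < κ)
    (hΛ₁ : 0 < Λ₁) :
    ∃ C : ℝ, 0 ≤ C ∧ ∃ a > 0, ∃ ρ₀ > 0, ∀ x : ℝ, -ξ ≤ x → x < 0 → κ ≤ -gammaPolyLog s x →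
      -gammaPolyLog s x ≤ Λ₁ →
      gammaPolyLog s (x ^ 2) * 2 ^ (-(s + 1))
        ≤ -gammaPolyLog s x * Real.cos (Real.pi / (s + 1)) ^ (s + 1) - κ →
      ∀ N ρ M : ℝ, 0 < ρ → ρ < ρ₀ → ρ ≤ 1 → 1 ≤ M → N * ρ = M →
      -gammaPolyLog s x * ρ ^ (-s) = M →
      ‖(∫ θ in (0 : ℝ)..Real.pi, Complex.exp (eulerLog s x (Complex.exp
            (-(((Real.cos (Real.pi / (s + 1)) * ρ : ℝ) : ℂ) + θ * Complex.I)))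
          + N * (((Real.cos (Real.pi / (s + 1)) * ρ : ℝ) : ℂ) + θ * Complex.I)))
        - Complex.exp (-riemannZeta (1 - (s : ℂ)) * Complex.log (1 - x))
          * Complex.exp (M * saddlePhase s (saddlePoint s)) * (ρ
            * (2 * Real.pi / (M * ((s + 1) / saddlePoint s))) ^ (1 / 2 : ℂ))‖
      ≤ Real.exp (M * (saddlePhase s (saddlePoint s)).re) *
        (‖Complex.exp (-riemannZeta (1 - (s : ℂ)) * Complex.log (1 - x))‖
            * (ρ * (C * (M⁻¹ + ρ * M ^ (-(1 / 2 : ℝ)))))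
          + Real.pi * Real.exp (-(a * M))) := by
  have hs0 : 0 < s := by linarith
  have hc := cos_pi_div_pos hs
  have hc1 := Real.cos_le_one (Real.pi / (s + 1))
  have ht0 := sin_pi_div_pos hs
  have ht1 := Real.sin_le_one (Real.pi / (s + 1))
  have htan : Real.tan (Real.pi / (s + 1)) = Real.sin (Real.pi / (s + 1)) / Real.cos (Real.pi / (s + 1)) :=
    Real.tan_eq_sin_div_cos _
  have hre := saddlePhase_saddlePoint_re hs
  have hv0 := saddlePoint_eq s
  have hA : 0 < (((s : ℂ) + 1) / saddlePoint s).re := by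
    have e : ((s : ℂ) + 1) / saddlePoint s = ((s + 1 : ℝ) : ℂ) * (saddlePoint s)⁻¹ := by
      push_cast; rw [div_eq_mul_inv]
    rw [e, Complex.re_ofReal_mul, Complex.inv_re]
    have := saddlePoint_re_pos hs
    have : 0 < Complex.normSq (saddlePoint s) := Complex.normSq_pos.2 (Complex.exp_ne_zero _)
    positivity
  set c := Real.cos (Real.pi / (s + 1)) with hcdef
  set t₀ := Real.sin (Real.pi / (s + 1)) with ht₀
  set v₀ := saddlePoint s with hv₀
  set A : ℂ := ((s : ℂ) + 1) / v₀ with hAdef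
  obtain ⟨C₁, hC₁, ε₀, hε₀, htay⟩ := saddlePhase_taylor hs
  -- The three bounds on `ε` serve the Taylor estimate, keep the interval around the saddle point
  -- inside `[0, π]`, and keep the cubic remainder below the Gaussian.
  obtain ⟨ε, hε, hεlt⟩ : ∃ ε > 0, ε ≤ ε₀ ∧ ε ≤ t₀ ∧ C₁ * ε ≤ A.re / 4 := by
    refine ⟨min ε₀ (min t₀ (A.re / 4 / C₁)), by positivity, min_le_left _ _,
      (min_le_right _ _).trans (min_le_left _ _), ?_⟩
    rw [mul_comm, ← le_div_iff₀ hC₁]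
    exact (min_le_right _ _).trans (min_le_right _ _)
  obtain ⟨hεε₀, hεt, hCε⟩ := hεlt
  have hε1 : ε ≤ 1 := hεt.trans ht1
  obtain ⟨B, hB, hnear⟩ := eulerLog_near_saddle hs hε1 hξ0 hξ
  obtain ⟨C, hC, hgauss⟩ := exists_gaussian_approx hA hC₁.le hε hCε hB
    (D := fun τ => saddlePhase s (v₀ + τ * Complex.I) - saddlePhase s v₀)
    (fun τ hτ => htay τ (hτ.trans hεε₀))
  obtain ⟨δ, hδ, r₀, hr₀, hminor⟩ := eulerLog_minor hs hξ0 hξ hκ (div_pos hε hc)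
  refine ⟨C, hC, δ / Λ₁, by positivity, r₀, hr₀, ?_⟩
  intro x hxξ hx0 hκ1 hΛle hmargin N ρ M hρ hρ₀ hρ1 hM hNρ hΛρ
  have hM0 : 0 < M := by linarith
  have hxabs : |x| ≤ ξ := abs_le.2 ⟨hxξ, by linarith⟩
  have hr : 0 < c * ρ := by positivity
  set Λ := -gammaPolyLog s x with hΛ
  have hΛ0 : 0 < Λ := hκ.trans_le hκ1
  set H : ℝ → ℂ := fun θ => Complex.exp (eulerLog s x (Complex.exp
            (-(((c * ρ : ℝ) : ℂ) + θ * Complex.I))) + N * (((c * ρ : ℝ) : ℂ) + θ * Complex.I)) with hH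
  have hHc : Continuous H := continuous_eulerLog_circle s (hxabs.trans_lt hξ) hr N
  set Z := Complex.exp (-riemannZeta (1 - (s : ℂ)) * Complex.log (1 - x)) with hZ
  set P := Complex.exp (M * saddlePhase s v₀) with hP
  set g := (2 * Real.pi / (M * A)) ^ (1 / 2 : ℂ) with hg
  set R := Real.exp (M * (saddlePhase s v₀).re) with hR
  have hPn : ‖P‖ = R := by rw [hP, Complex.norm_exp, Complex.re_ofReal_mul]
  -- the neighbourhood of the saddle point
  have hmajor : ‖(∫ θ in (ρ * -ε + ρ * t₀)..(ρ * ε + ρ * t₀), H θ) - Z * P * (ρ * g)‖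
      ≤ R * (‖Z‖ * (ρ * (C * (M⁻¹ + ρ * M ^ (-(1 / 2 : ℝ)))))) := by
    set F : ℝ → ℂ := fun τ => (Z * P)⁻¹ * H (ρ * τ + ρ * t₀) with hF
    have hZP : Z * P ≠ 0 := mul_ne_zero (Complex.exp_ne_zero _) (Complex.exp_ne_zero _)
    have hFc : Continuous F := by
      simp only [hF]; exact continuous_const.mul (hHc.comp (by fun_prop))
    have h1 := hgauss M ρ hM hρ.le hρ1 F (hFc.intervalIntegrable _ _) (fun τ hτ => by
      obtain ⟨e, he, hen⟩ := hnear x hxabs N ρ M hρ hNρ hΛρ τ hτ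
      refine ⟨e, ?_, hen⟩
      simp only [hF, hH]
      rw [he, Complex.exp_add, Complex.exp_add, ← hZ, ← hP, inv_mul_cancel_left₀ hZP])
    rw [← hPn]
    exact norm_integral_major_sub_le hZP hρ.le hF h1
  -- the rest of the circle
  have hpt : ∀ θ : ℝ, 0 ≤ θ → θ ≤ Real.pi → ρ * ε ≤ |θ - ρ * t₀| →
      ‖H θ‖ ≤ R * Real.exp (-(δ / Λ₁ * M)) := by
    intro θ h0 hpi hfar
    -- With `r = cρ`, an angular distance `ρε` from the saddle point becomes `ε/c` in the variable
    -- `θ/r`.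
    have h1 : ε / c ≤ |θ / (c * ρ) - Real.tan (Real.pi / (s + 1))| := by
      have e : θ / (c * ρ) - Real.tan (Real.pi / (s + 1)) = (θ - ρ * t₀) / (c * ρ) := by
        rw [htan]; field_simp
      rw [e, abs_div, abs_of_pos hr, div_le_div_iff₀ hc hr]
      have := mul_le_mul_of_nonneg_right hfar hc.le
      linarith
    have h2 := hminor (c * ρ) hr ((mul_le_of_le_one_left hρ.le hc1).trans_lt hρ₀) θ h0 hpi h1 x hxξ hx0 hκ1 hmargin
    simp only [hH]
    exact norm_integrand_minor_le hs hρ hM0 hδ hΛ0 hΛle hNρ hΛρ h2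
  have hlow : 0 ≤ ρ * -ε + ρ * t₀ := by
    have := mul_nonneg hρ.le (sub_nonneg.2 hεt)
    linarith
  have hhigh : ρ * ε + ρ * t₀ ≤ Real.pi := by
    have := Real.pi_gt_three
    have := mul_le_one₀ hρ1 hε.le hε1
    have := mul_le_one₀ hρ1 ht0.le ht1
    linarith
  have hX : 0 ≤ R * Real.exp (-(δ / Λ₁ * M)) := by positivity
  have hρε : 0 < ρ * ε := by positivity
  refine (norm_integral_sub_middle_le hHc hlow (by linarith) hhigh hX (fun θ hθ => ?_)
    (fun θ hθ => ?_) hmajor).trans (le_of_eq (by ring))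
  · refine hpt θ hθ.1.le (by linarith [hθ.2]) ?_
    rw [abs_of_nonpos (by linarith [hθ.2])]
    linarith [hθ.2]
  · have : 0 < ρ * t₀ := by positivity
    refine hpt θ (by linarith [hθ.1]) hθ.2 ?_
    rw [abs_of_nonneg (by linarith [hθ.1])]
    linarith [hθ.1]

end

/-! ### The main term in the scale of the saddle point. -/

lemma exists_pos_le_of_isCompact {X : Set ℝ} (hX : IsCompact X) {f : ℝ → ℝ} (hf : ContinuousOn f X)
    (hpos : ∀ x ∈ X, 0 < f x) : ∃ κ > 0, ∀ x ∈ X, κ ≤ f x := by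
  rcases X.eq_empty_or_nonempty with rfl | hne
  · exact ⟨1, one_pos, by simp⟩
  · obtain ⟨y, hy, hmin⟩ := hX.exists_isMinOn hne hf
    exact ⟨f y, hpos y hy, fun x hx => hmin hx⟩

/-- The real number `(1 - x) ^ (-ζ(1 - s))`. -/
noncomputable def zetaFactor (s x : ℝ) : ℝ :=
  Real.exp (-(riemannZeta (1 - (s : ℂ))).re * Real.log (1 - x))

lemma zetaFactor_pos (s x : ℝ) : 0 < zetaFactor s x := Real.exp_pos _

/-- Invariance under conjugation. Consequently `(1-x)^(-ζ(1-s))` is a positive real and can be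
divided by. -/
lemma riemannZeta_one_sub_ofReal (s : ℝ) :
    riemannZeta (1 - (s : ℂ)) = ((riemannZeta (1 - (s : ℂ))).re : ℂ) := by
  have h := riemannZeta_conj (1 - (s : ℂ))
  have e : (starRingEnd ℂ) (1 - (s : ℂ)) = 1 - (s : ℂ) := by simp
  rw [e] at h
  exact (Complex.conj_eq_iff_re.1 h.symm).symm

lemma exp_zeta_mul_log_eq (s : ℝ) {x : ℝ} (hx : x < 1) :
    Complex.exp (-riemannZeta (1 - (s : ℂ)) * Complex.log (1 - x)) = (zetaFactor s x : ℂ) := by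
  rw [zetaFactor, riemannZeta_one_sub_ofReal s]
  push_cast
  rw [Complex.ofReal_log (by linarith), Complex.ofReal_re]
  push_cast
  rfl

lemma one_sub_cpow_neg_zeta_eq (s : ℝ) {x : ℝ} (hx : x < 1) :
    (1 - (x : ℂ)) ^ (-riemannZeta (1 - (s : ℂ))) = (zetaFactor s x : ℂ) := by
  have h : (1 - (x : ℂ)) ≠ 0 := by
    rw [← Complex.ofReal_one, ← Complex.ofReal_sub]
    exact_mod_cast (by linarith : (1 - x) ≠ 0)
  rw [Complex.cpow_def_of_ne_zero h, mul_comm, exp_zeta_mul_log_eq s hx]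

lemma zetaFactor_ge (s : ℝ) {x : ℝ} (hx0 : -1 < x) (hx1 : x < 0) :
    Real.exp (-|(riemannZeta (1 - (s : ℂ))).re|) ≤ zetaFactor s x := by
  refine Real.exp_le_exp.2 ?_
  have h1 : 0 ≤ Real.log (1 - x) := Real.log_nonneg (by linarith)
  have h2 : Real.log (1 - x) ≤ 1 := (Real.log_le_sub_one_of_pos (by linarith)).trans (by linarith)
  have h3 := neg_abs_le (riemannZeta (1 - (s : ℂ))).re
  have h4 := le_abs_self (riemannZeta (1 - (s : ℂ))).re
  have h5 := abs_nonneg (riemannZeta (1 - (s : ℂ))).re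
  nlinarith

/-- The modulus of `L_{1,1}(x)` for negative `x`. -/
noncomputable def saddleRadius (s x : ℝ) : ℝ := (-gammaPolyLog s x) ^ (1 / (s + 1))

/-- The scale of the distance of the saddle point from the origin. -/
noncomputable def saddleScale (s x N : ℝ) : ℝ := saddleRadius s x * N ^ (-(1 / (s + 1)))

/-- The scale of the exponent at the saddle point. -/
noncomputable def saddleExponent (s x N : ℝ) : ℝ := saddleRadius s x * N ^ (s / (s + 1))

section
variable {s : ℝ}

lemma powerL_one_one_eq (hs : 0 < s) {x : ℝ} (hx0 : -1 < x) (hx1 : x < 0) :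
    powerL s 1 1 x = (saddleRadius s x : ℂ) * saddlePoint s := by
  have h2 := gammaPolyLog_neg hs hx0 hx1
  have hG := Real.Gamma_pos_of_pos (show 0 < s + 1 by linarith)
  rw [powerL_of_neg hs 1 1 (by rw [pow_one]; exact (pos_iff_neg_of_mul_neg h2).1 hG), saddleRadius,
    gammaPolyLog, saddlePoint, mul_neg]
  simp

lemma saddleRadius_pos {x : ℝ} (hΛ : 0 < -gammaPolyLog s x) : 0 < saddleRadius s x :=
  Real.rpow_pos_of_pos hΛ _

lemma mul_saddleScale (hs : 0 < s) {x N : ℝ} (hN : 0 < N) :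
    N * saddleScale s x N = saddleExponent s x N := by
  rw [saddleScale, saddleExponent, mul_left_comm]
  congr 1
  nth_rewrite 1 [← Real.rpow_one N]
  rw [← Real.rpow_add hN]
  congr 1
  field_simp
  ring

/-- Together with `mul_saddleScale` this is the balance `Λ ρ^(-s) = nρ = M` which makes both parts
of the exponent scale alike. -/
lemma mul_saddleScale_rpow (hs : 0 < s) {x N : ℝ} (hN : 0 < N) (hΛ : 0 < -gammaPolyLog s x) :
    -gammaPolyLog s x * saddleScale s x N ^ (-s) = saddleExponent s x N := by
  have hs1 : s + 1 ≠ 0 := by linarith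
  rw [saddleScale, saddleExponent, saddleRadius, Real.mul_rpow (by positivity) (by positivity),
    ← Real.rpow_mul hΛ.le, ← Real.rpow_mul hN.le, ← mul_assoc]
  congr 1
  · nth_rewrite 1 [← Real.rpow_one (-gammaPolyLog s x)]
    rw [← Real.rpow_add hΛ]
    congr 1
    field_simp
    ring
  · congr 1
    field_simp

variable (hs : 1 < s)
include hs

/-- Since `1/v₀` stands in the denominator, the Gaussian factor is a positive real times `v₀^(1/2)`,
the same root as in the main term. -/
lemma saddle_gaussian_eq {M : ℝ} (hM : 0 < M) :
    (2 * Real.pi / (M * ((s + 1) / saddlePoint s)) : ℂ) ^ (1 / 2 : ℂ)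
      = (((2 * Real.pi / (s + 1)) ^ (1 / 2 : ℝ) * M ^ (-(1 / 2 : ℝ)) : ℝ) : ℂ)
        * saddlePoint s ^ (1 / 2 : ℂ) := by
  have h0 : saddlePoint s ≠ 0 := Complex.exp_ne_zero _
  have hs1 : (0 : ℝ) < s + 1 := by linarith
  have hs1c : ((s : ℂ) + 1) ≠ 0 := by exact_mod_cast hs1.ne'
  have hMc : (M : ℂ) ≠ 0 := by exact_mod_cast hM.ne'
  have hp : 0 < 2 * Real.pi / (s + 1) * M⁻¹ := by positivity
  have e : (2 * Real.pi / (M * ((s + 1) / saddlePoint s)) : ℂ)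
      = ((2 * Real.pi / (s + 1) * M⁻¹ : ℝ) : ℂ) * saddlePoint s := by
    push_cast; field_simp
  rw [e, ofReal_mul_cpow hp h0, show (1 / 2 : ℂ) = ((1 / 2 : ℝ) : ℂ) by push_cast; ring,
    ← Complex.ofReal_cpow hp.le, Real.mul_rpow (by positivity) (by positivity),
    Real.inv_rpow hM.le, ← Real.rpow_neg hM.le]

lemma norm_saddlePoint_cpow_half : ‖saddlePoint s ^ (1 / 2 : ℂ)‖ = 1 := by
  rw [saddlePoint_cpow hs, show ((Real.pi / (s + 1) : ℝ) : ℂ) * Complex.I * (1 / 2)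
    = ((Real.pi / (s + 1) / 2 : ℝ) : ℂ) * Complex.I by push_cast; ring, Complex.norm_exp_ofReal_mul_I]

/-- The main term, in the scale of the saddle point. -/
lemma saddleTerm_eq {n : ℕ} (hn : 1 ≤ n) {x : ℝ} (hx0 : -1 < x) (hx1 : x < 0) :
    saddleTerm s n x = Complex.exp (saddleExponent s x n * saddlePhase s (saddlePoint s))
      * (saddleScale s x n * (2 * Real.pi / (saddleExponent s x n * ((s + 1) / saddlePoint s)))
        ^ (1 / 2 : ℂ)) / (2 * Real.pi) := by
  have hs0 : 0 < s := by linarith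
  have hN : (0 : ℝ) < n := by exact_mod_cast hn
  have hΛ : 0 < -gammaPolyLog s x := by have := gammaPolyLog_neg hs0 hx0 hx1; linarith
  have hℓ := saddleRadius_pos hΛ
  have hM : 0 < saddleExponent s x n := by rw [saddleExponent]; positivity
  have hρ : 0 < saddleScale s x n := by rw [saddleScale]; positivity
  have h0 : saddlePoint s ≠ 0 := Complex.exp_ne_zero _
  have hs1 : (0 : ℝ) < s + 1 := by linarith
  have hD : 0 < 2 * Real.pi * (s + 1) * (n : ℝ) ^ ((s + 2) / (s + 1)) := by positivity
  have hq : 0 < saddleRadius s x / (2 * Real.pi * (s + 1) * (n : ℝ) ^ ((s + 2) / (s + 1))) := by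
    positivity
  have e1 : powerL s 1 1 x / ((2 * Real.pi * (s + 1) * (n : ℝ) ^ ((s + 2) / (s + 1)) : ℝ) : ℂ)
      = ((saddleRadius s x / (2 * Real.pi * (s + 1) * (n : ℝ) ^ ((s + 2) / (s + 1))) : ℝ) : ℂ)
        * saddlePoint s := by
    rw [powerL_one_one_eq hs0 hx0 hx1, Complex.ofReal_div]; ring
  have e2 : (saddleRadius s x / (2 * Real.pi * (s + 1) * (n : ℝ) ^ ((s + 2) / (s + 1)))) ^ (1 / 2 : ℝ)
      = saddleScale s x n / (2 * Real.pi) * ((2 * Real.pi / (s + 1)) ^ (1 / 2 : ℝ)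
        * saddleExponent s x n ^ (-(1 / 2 : ℝ))) := by
    -- This identity matches the prefactor of the saddle point integral, divided by `2π`, with the
    -- square root in `saddleTerm`.
    have e3 : saddleRadius s x / (2 * Real.pi * (s + 1) * (n : ℝ) ^ ((s + 2) / (s + 1)))
        = (saddleScale s x n / (2 * Real.pi)) ^ (2 : ℝ)
          * (2 * Real.pi / (s + 1) * (saddleExponent s x n)⁻¹) := by
      have e4 : (n : ℝ) ^ ((s + 2) / (s + 1))
          = (n : ℝ) ^ (s / (s + 1)) * ((n : ℝ) ^ (1 / (s + 1)) * (n : ℝ) ^ (1 / (s + 1))) := by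
        rw [← Real.rpow_add hN, ← Real.rpow_add hN]; congr 1; field_simp; ring
      rw [e4, Real.rpow_two, saddleScale, saddleExponent, Real.rpow_neg hN.le]
      field_simp
    rw [e3, Real.mul_rpow (by positivity) (by positivity), ← Real.rpow_mul (by positivity),
      Real.mul_rpow (by positivity) (by positivity), Real.inv_rpow hM.le, ← Real.rpow_neg hM.le]
    norm_num
  have e5 : (((s + 1) / s * (n : ℝ) ^ (s / (s + 1)) : ℝ) : ℂ) * powerL s 1 1 x
      = saddleExponent s x n * saddlePhase s (saddlePoint s) := by
    rw [powerL_one_one_eq hs0 hx0 hx1, saddlePhase_saddlePoint hs, saddleExponent]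
    push_cast; ring
  rw [saddleTerm, e1, e5, ofReal_mul_cpow hq h0, saddle_gaussian_eq hs hM]
  have e6 : ((saddleRadius s x / (2 * Real.pi * (s + 1) * (n : ℝ) ^ ((s + 2) / (s + 1))) : ℝ) : ℂ)
      ^ (1 / 2 : ℂ) = ((saddleScale s x n / (2 * Real.pi) * ((2 * Real.pi / (s + 1)) ^ (1 / 2 : ℝ)
        * saddleExponent s x n ^ (-(1 / 2 : ℝ))) : ℝ) : ℂ) := by
    rw [← e2, Complex.ofReal_cpow hq.le]; norm_num
  rw [e6, Complex.ofReal_mul (saddleScale s x n / (2 * Real.pi)), Complex.ofReal_div]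
  push_cast
  ring

lemma norm_saddleTerm {n : ℕ} (hn : 1 ≤ n) {x : ℝ} (hx0 : -1 < x) (hx1 : x < 0) :
    ‖saddleTerm s n x‖ = Real.exp (saddleExponent s x n * (saddlePhase s (saddlePoint s)).re)
      * (saddleScale s x n * ((2 * Real.pi / (s + 1)) ^ (1 / 2 : ℝ)
        * saddleExponent s x n ^ (-(1 / 2 : ℝ)))) / (2 * Real.pi) := by
  have hs0 : 0 < s := by linarith
  have hN : (0 : ℝ) < n := by exact_mod_cast hn
  have hΛ : 0 < -gammaPolyLog s x := by have := gammaPolyLog_neg hs0 hx0 hx1; linarith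
  have hℓ := saddleRadius_pos hΛ
  have hM : 0 < saddleExponent s x n := by rw [saddleExponent]; positivity
  have hρ : 0 < saddleScale s x n := by rw [saddleScale]; positivity
  rw [saddleTerm_eq hs hn hx0 hx1, norm_div, norm_mul, norm_mul, Complex.norm_exp,
    Complex.re_ofReal_mul, saddle_gaussian_eq hs hM, norm_mul, norm_saddlePoint_cpow_half hs, mul_one,
    Complex.norm_real, Complex.norm_real, Real.norm_of_nonneg hρ.le,
    Real.norm_of_nonneg (by positivity)]
  congr 1
  rw [← Complex.ofReal_ofNat, ← Complex.ofReal_mul, Complex.norm_real,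
    Real.norm_of_nonneg (by positivity)]

end

/-! ### Error terms uniform in the coefficient index and in the point. -/

lemma norm_eulerLog_le (s : ℝ) {ξ : ℝ} (hξ : ξ < 1) {R : ℝ} (hR0 : 0 < R) (hR : R < 1) :
    ∃ B : ℝ, ∀ x : ℝ, |x| ≤ ξ → ∀ q : ℂ, ‖q‖ ≤ R → ‖eulerLog s x q‖ ≤ B := by
  have hS := summable_rpow_mul_pow_succ s hR0 hR
  refine ⟨(∑' m : ℕ, ((m + 1 : ℕ) : ℝ) ^ (s - 1) * R ^ (m + 1)) * ((1 - ξ)⁻¹ + 1),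
    fun x hx q hq => ?_⟩
  have hx' : ‖(x : ℂ)‖ = |x| := by simp
  rw [← tsum_mul_right]
  refine tsum_of_norm_bounded (hS.mul_right _).hasSum fun m => ?_
  refine (norm_eulerLog_term_le s (by rw [hx']; linarith) hq hR m).trans ?_
  refine mul_le_mul_of_nonneg_left ?_ (by positivity)
  rw [hx']
  gcongr

/-- The coefficients of the Euler product are real and locally bounded at real points. -/
lemma eulerCoeff_bounded (s : ℝ) {ξ : ℝ} (hξ : ξ < 1) (n : ℕ) :
    ∃ B : ℝ, ∀ x : ℝ, |x| ≤ ξ → |(eulerCoeff (powerSeq s) n x).re| ≤ B := by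
  obtain ⟨B, hB⟩ := norm_eulerLog_le s hξ (Real.exp_pos (-1)) (by simp : Real.exp (-1) < 1)
  refine ⟨Real.exp (B + n), fun x hx => ?_⟩
  rw [eulerCoeff_eq_integral s (hx.trans_lt hξ) n one_pos, Complex.ofReal_re, abs_mul,
    abs_of_pos (by positivity)]
  have h1 := intervalIntegral.norm_integral_le_of_norm_le_const (a := 0) (b := Real.pi)
      (f := fun θ : ℝ => Complex.exp (eulerLog s x (Complex.exp (-(((1 : ℝ) : ℂ) + θ * Complex.I)))
        + n * (((1 : ℝ) : ℂ) + θ * Complex.I))) (C := Real.exp (B + n)) (fun θ _ => by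
    rw [Complex.norm_exp, Complex.add_re]
    refine Real.exp_le_exp.2 (add_le_add ((Complex.re_le_norm _).trans (hB x hx _ ?_)) ?_)
    · rw [Complex.norm_exp]; simp
    · simp)
  rw [sub_zero, abs_of_pos Real.pi_pos] at h1
  rw [one_div, inv_mul_le_iff₀ Real.pi_pos, mul_comm]
  exact (Complex.abs_re_le_norm _).trans h1

lemma eulerCoeff_eq_ofReal_re (s : ℝ) {x : ℝ} (hx : |x| < 1) (n : ℕ) :
    eulerCoeff (powerSeq s) n x = ((eulerCoeff (powerSeq s) n x).re : ℂ) := by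
  rw [eulerCoeff_eq_integral s hx n one_pos, Complex.ofReal_re]

section
variable {s : ℝ} (hs : 1 < s)
include hs

/-- On a set which stays away from the ends of the phase, the coefficients are eventually close to
the contribution of the two conjugate saddle points. -/
lemma eventually_eulerCoeff_sub_le {ξ κ Λ₁ : ℝ} (hξ0 : 0 ≤ ξ) (hξ : ξ < 1) (hκ : 0 < κ)
    (hΛ₁ : 0 < Λ₁) :
    ∃ C : ℝ, 0 ≤ C ∧ ∀ᶠ n : ℕ in atTop, ∀ x : ℝ, -ξ ≤ x → x < 0 → κ ≤ -gammaPolyLog s x →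
      -gammaPolyLog s x ≤ Λ₁ →
      gammaPolyLog s (x ^ 2) * 2 ^ (-(s + 1))
        ≤ -gammaPolyLog s x * Real.cos (Real.pi / (s + 1)) ^ (s + 1) - κ →
      ∀ μ : ℝ, μ ≤ 1 / (s + 1) → μ ≤ s / (2 * s + 2) →
        |(eulerCoeff (powerSeq s) n x).re - 2 * zetaFactor s x * (saddleTerm s n x).re|
          ≤ C * (n : ℝ) ^ (-μ) * (2 * zetaFactor s x * ‖saddleTerm s n x‖) := by
  have hs0 : 0 < s := by linarith
  have hs1 : 0 < s + 1 := by linarith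
  obtain ⟨C, hC, a, ha, ρ₀, hρ₀, hmain⟩ := integral_saddle_asymptotics hs hξ0 hξ hκ hΛ₁
  set Z₀ := Real.exp (-|(riemannZeta (1 - (s : ℂ))).re|) with hZ₀
  have hZ₀p : 0 < Z₀ := Real.exp_pos _
  set k := (2 * Real.pi / (s + 1)) ^ (1 / 2 : ℝ) with hk
  have hkp : 0 < k := by have := Real.pi_pos; positivity
  set ℓ₀ := κ ^ (1 / (s + 1)) with hℓ₀
  set ℓ₁ := Λ₁ ^ (1 / (s + 1)) with hℓ₁
  have hℓ₀p : 0 < ℓ₀ := by positivity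
  have hℓ₁p : 0 < ℓ₁ := by positivity
  set A := ℓ₀ ^ (-(1 / 2 : ℝ)) + ℓ₁ with hA
  have hAp : 0 < A := by positivity
  have hcast : Tendsto (fun n : ℕ => (n : ℝ)) atTop atTop := tendsto_natCast_atTop_atTop
  have hpow : Tendsto (fun n : ℕ => (n : ℝ) ^ (s / (s + 1))) atTop atTop :=
    (tendsto_rpow_atTop (by positivity)).comp hcast
  have hscale : Tendsto (fun n : ℕ => ℓ₁ * (n : ℝ) ^ (-(1 / (s + 1)))) atTop (𝓝 0) := by
    simpa using ((tendsto_rpow_neg_atTop (y := 1 / (s + 1)) (by positivity)).comp hcast).const_mul ℓ₁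
  -- The exponent is chosen so that, at `n^(s/(s+1))`, the exponential is at most `n^(-2)`.
  have hexp := hpow.eventually
    ((isLittleO_exp_neg_mul_rpow_atTop (mul_pos ha hℓ₀p) (-(2 * ((s + 1) / s)))).bound one_pos)
  refine ⟨(2 * A * C + Real.pi / Z₀) / k, by have := Real.pi_pos; positivity, ?_⟩
  filter_upwards [hexp, hpow.eventually_ge_atTop ℓ₀⁻¹, hscale.eventually_lt_const (lt_min hρ₀ one_pos),
    eventually_ge_atTop 1] with n hn1 hn2 hn3 hn4 x hx0 hx1 hκx hΛx hmar μ hμ1 hμ2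
  have hx0' : -1 < x := by linarith
  have hN : (0 : ℝ) < n := by exact_mod_cast hn4
  have hN1 : (1 : ℝ) ≤ n := by exact_mod_cast hn4
  have hΛ : 0 < -gammaPolyLog s x := by linarith
  have hl0 : ℓ₀ ≤ saddleRadius s x := Real.rpow_le_rpow hκ.le hκx (by positivity)
  have hl1 : saddleRadius s x ≤ ℓ₁ := Real.rpow_le_rpow hΛ.le hΛx (by positivity)
  have hℓ := saddleRadius_pos hΛ
  set ρ := saddleScale s x n with hρdef
  set M := saddleExponent s x n with hMdef
  have hρ : 0 < ρ := by rw [hρdef, saddleScale]; positivity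
  have hρle : ρ ≤ ℓ₁ * (n : ℝ) ^ (-(1 / (s + 1))) := by rw [hρdef, saddleScale]; gcongr
  have hMge : ℓ₀ * (n : ℝ) ^ (s / (s + 1)) ≤ M := by rw [hMdef, saddleExponent]; gcongr
  have hM1 : 1 ≤ M := by
    refine le_trans ?_ hMge
    rw [mul_comm]
    exact (inv_le_iff_one_le_mul₀ hℓ₀p).1 hn2
  have hM : 0 < M := by linarith
  have hNρ : n * ρ = M := mul_saddleScale hs0 hN
  have hI := hmain x hx0 hx1 hκx hΛx hmar n ρ M hρ
    ((hρle.trans_lt hn3).trans_le (min_le_left _ _))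
    ((hρle.trans_lt hn3).trans_le (min_le_right _ _)).le hM1 hNρ (mul_saddleScale_rpow hs0 hN hΛ)
  rw [exp_zeta_mul_log_eq s (by linarith : x < 1), Complex.norm_real,
    Real.norm_of_nonneg (zetaFactor_pos s x).le] at hI
  have hZ : Z₀ ≤ zetaFactor s x := zetaFactor_ge s hx0' hx1
  have hZp := zetaFactor_pos s x
  have hc := cos_pi_div_pos hs
  have hQ := congrArg Complex.re (eulerCoeff_eq_integral s (abs_lt.2 ⟨hx0', by linarith⟩) n
    (mul_pos hc hρ))
  rw [Complex.ofReal_re] at hQ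
  have hb := saddleTerm_eq hs hn4 hx0' hx1
  have hnb := norm_saddleTerm hs hn4 hx0' hx1
  rw [← hMdef, ← hρdef] at hb hnb
  rw [← hk] at hnb
  set W := Real.exp (M * (saddlePhase s (saddlePoint s)).re) with hW
  have hWp : 0 < W := Real.exp_pos _
  set Z := zetaFactor s x
  rw [Complex.ofReal_natCast] at hI
  set I := ∫ θ in (0 : ℝ)..Real.pi, Complex.exp (eulerLog s x (Complex.exp
            (-(((Real.cos (Real.pi / (s + 1)) * ρ : ℝ) : ℂ) + θ * Complex.I)))
          + n * (((Real.cos (Real.pi / (s + 1)) * ρ : ℝ) : ℂ) + θ * Complex.I)) with hIdef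
  set T := (Z : ℂ) * Complex.exp (M * saddlePhase s (saddlePoint s))
          * (ρ * (2 * Real.pi / (M * ((s + 1) / saddlePoint s))) ^ (1 / 2 : ℂ)) with hT
  have hTb : T = ((2 * Real.pi * Z : ℝ) : ℂ) * saddleTerm s n x := by
    have hpi : (Real.pi : ℂ) ≠ 0 := by exact_mod_cast Real.pi_ne_zero
    rw [hb, hT]; push_cast; field_simp
  have hdiff : (eulerCoeff (powerSeq s) n x).re - 2 * Z * (saddleTerm s n x).re
      = 1 / Real.pi * (I - T).re := by
    rw [hQ, hTb, Complex.sub_re, Complex.re_ofReal_mul]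
    field_simp
  have hpow1 : (n : ℝ) ^ (-(1 / (s + 1))) ≤ (n : ℝ) ^ (-μ) :=
    Real.rpow_le_rpow_of_exponent_le hN1 (by linarith)
  have hpow2 : M ^ (-(1 / 2 : ℝ)) ≤ ℓ₀ ^ (-(1 / 2 : ℝ)) * (n : ℝ) ^ (-μ) := by
    calc M ^ (-(1 / 2 : ℝ)) ≤ (ℓ₀ * (n : ℝ) ^ (s / (s + 1))) ^ (-(1 / 2 : ℝ)) :=
          Real.rpow_le_rpow_of_nonpos (by positivity) hMge (by norm_num)
      _ = ℓ₀ ^ (-(1 / 2 : ℝ)) * (n : ℝ) ^ (-(s / (2 * s + 2))) := by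
          rw [Real.mul_rpow (by positivity) (by positivity), ← Real.rpow_mul hN.le]
          congr 2; field_simp
      _ ≤ _ := by gcongr
  have hpow3 : (n : ℝ)⁻¹ ≤ (n : ℝ) ^ (-μ) := by
    rw [← Real.rpow_neg_one]
    refine Real.rpow_le_rpow_of_exponent_le hN1 (neg_le_neg (hμ1.trans ?_))
    rw [div_le_one hs1]; linarith
  set ν := (n : ℝ) ^ (-μ) with hν
  have hνp : 0 < ν := by positivity
  set h := M ^ (-(1 / 2 : ℝ)) with hh
  have hhp : 0 < h := by positivity
  -- Factoring `h = M^(-1/2)` out of `M⁻¹ + ρh` leaves the relative error `h + ρ`, of orders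
  -- `n^(-s/(2s+2))` and `n^(-1/(s+1))`.
  have hMinv : M⁻¹ = h * h := by rw [hh, ← Real.rpow_add hM, ← Real.rpow_neg_one]; norm_num
  have hsum : h + ρ ≤ 2 * A * ν := by
    have h1 : ρ ≤ ℓ₁ * ν := hρle.trans (by gcongr)
    have h2 : 0 ≤ A * ν := by positivity
    have h3 : h + ρ ≤ A * ν := by rw [hA]; linarith
    linarith
  -- One factor `n⁻¹` gives the saving `n^(-μ)`; the other is `ρ M⁻¹ ≤ ρ M^(-1/2)`, the size of the
  -- main term without its exponential and zeta factor.
  have hsmall : Real.exp (-(a * M)) ≤ ν * (ρ * h) := by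
    have e1 : Real.exp (-(a * M)) ≤ (n : ℝ)⁻¹ * (n : ℝ)⁻¹ := by
      refine le_trans (Real.exp_le_exp.2 ?_) (le_trans (le_trans (le_abs_self _) hn1) (le_of_eq ?_))
      · have := mul_le_mul_of_nonneg_left hMge ha.le
        linarith
      · rw [one_mul, Real.norm_of_nonneg (by positivity), ← Real.rpow_mul hN.le, ← Real.rpow_neg_one,
          ← Real.rpow_add hN]
        congr 1; field_simp; ring
    have e2 : (n : ℝ)⁻¹ ≤ ρ * h := by
      have : (n : ℝ)⁻¹ = ρ * M⁻¹ := by rw [← hNρ]; field_simp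
      rw [this]
      refine mul_le_mul_of_nonneg_left ?_ hρ.le
      rw [← Real.rpow_neg_one]
      exact Real.rpow_le_rpow_of_exponent_le hM1 (by norm_num)
    exact e1.trans (mul_le_mul hpow3 e2 (by positivity) hνp.le)
  rw [hdiff, abs_mul, abs_of_pos (by have := Real.pi_pos; positivity), hnb]
  have hfin : Z * (ρ * (C * (M⁻¹ + ρ * h))) + Real.pi * Real.exp (-(a * M))
      ≤ (2 * A * C + Real.pi / Z₀) * ν * (Z * (ρ * h)) := by
    have h1 : Z * (ρ * (C * (M⁻¹ + ρ * h))) ≤ 2 * A * C * ν * (Z * (ρ * h)) := by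
      calc Z * (ρ * (C * (M⁻¹ + ρ * h))) = Z * (ρ * h) * C * (h + ρ) := by rw [hMinv]; ring
        _ ≤ Z * (ρ * h) * C * (2 * A * ν) := by gcongr
        _ = _ := by ring
    have h2 : Real.pi * Real.exp (-(a * M)) ≤ Real.pi / Z₀ * ν * (Z * (ρ * h)) := by
      have h3 : 1 ≤ Z / Z₀ := (one_le_div hZ₀p).2 hZ
      calc Real.pi * Real.exp (-(a * M)) ≤ Real.pi * (ν * (ρ * h)) * 1 := by
            rw [mul_one]; exact mul_le_mul_of_nonneg_left hsmall Real.pi_pos.le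
        _ ≤ Real.pi * (ν * (ρ * h)) * (Z / Z₀) :=
            mul_le_mul_of_nonneg_left h3 (by have := Real.pi_pos; positivity)
        _ = _ := by ring
    rw [add_mul, add_mul]
    exact add_le_add h1 h2
  have hpi := Real.pi_pos
  calc 1 / Real.pi * |(I - T).re|
      ≤ 1 / Real.pi * (W * ((2 * A * C + Real.pi / Z₀) * ν * (Z * (ρ * h)))) := by
        refine mul_le_mul_of_nonneg_left ?_ (by positivity)
        exact (Complex.abs_re_le_norm _).trans (hI.trans (mul_le_mul_of_nonneg_left hfin hWp.le))
    _ = _ := by field_simp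

/-- A bound for a single coefficient, in terms of the main term. -/
lemma eulerCoeff_sub_le {ξ κ Λ₁ : ℝ} (hξ : ξ < 1) (hκ : 0 < κ) {n : ℕ} (hn : 1 ≤ n) :
    ∃ C : ℝ, 0 ≤ C ∧ ∀ x : ℝ, -ξ ≤ x → x < 0 → κ ≤ -gammaPolyLog s x →
      -gammaPolyLog s x ≤ Λ₁ → ∀ μ : ℝ, μ ≤ 1 →
        |(eulerCoeff (powerSeq s) n x).re - 2 * zetaFactor s x * (saddleTerm s n x).re|
          ≤ C * (n : ℝ) ^ (-μ) * (2 * zetaFactor s x * ‖saddleTerm s n x‖) := by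
  have hs0 : 0 < s := by linarith
  have hs1 : 0 < s + 1 := by linarith
  have hpi := Real.pi_pos
  have hN : (0 : ℝ) < n := by exact_mod_cast hn
  have hN1 : (1 : ℝ) ≤ n := by exact_mod_cast hn
  obtain ⟨B, hB⟩ := eulerCoeff_bounded s hξ n
  rcases le_or_gt Λ₁ 0 with hΛ₁ | hΛ₁
  · exact ⟨0, le_rfl, fun x _ _ h1 h2 => by linarith⟩
  set Z₀ := Real.exp (-|(riemannZeta (1 - (s : ℂ))).re|) with hZ₀
  have hZ₀p : 0 < Z₀ := Real.exp_pos _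
  -- A positive lower bound, uniform in `x`, for the main term at this index; its growing
  -- exponential is bounded below by `1`.
  set m := 2 * Z₀ * (κ ^ (1 / (s + 1)) * (n : ℝ) ^ (-(1 / (s + 1)))
    * ((2 * Real.pi / (s + 1)) ^ (1 / 2 : ℝ)
      * (Λ₁ ^ (1 / (s + 1)) * (n : ℝ) ^ (s / (s + 1))) ^ (-(1 / 2 : ℝ))) / (2 * Real.pi)) with hm
  have hmp : 0 < m := by positivity
  -- The factor `n` absorbs `n^(-μ)` for every `μ ≤ 1`, so the constant is independent of `μ`.
  refine ⟨(|B| / m + 1) * n, by positivity, fun x hx0 hx1 hκx hΛx μ hμ => ?_⟩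
  have hx0' : -1 < x := by linarith
  have hΛ : 0 < -gammaPolyLog s x := by linarith
  have hl0 : κ ^ (1 / (s + 1)) ≤ saddleRadius s x := Real.rpow_le_rpow hκ.le hκx (by positivity)
  have hl1 : saddleRadius s x ≤ Λ₁ ^ (1 / (s + 1)) := Real.rpow_le_rpow hΛ.le hΛx (by positivity)
  have hℓ := saddleRadius_pos hΛ
  have hZ : Z₀ ≤ zetaFactor s x := zetaFactor_ge s hx0' hx1
  have hm' : m ≤ 2 * zetaFactor s x * ‖saddleTerm s n x‖ := by
    rw [hm, norm_saddleTerm hs hn hx0' hx1]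
    have h1 : 1 ≤ Real.exp (saddleExponent s x n * (saddlePhase s (saddlePoint s)).re) := by
      refine Real.one_le_exp (mul_nonneg (by rw [saddleExponent]; positivity) ?_)
      rw [saddlePhase_saddlePoint_re hs]
      have := cos_pi_div_pos hs
      positivity
    have h2 : (Λ₁ ^ (1 / (s + 1)) * (n : ℝ) ^ (s / (s + 1))) ^ (-(1 / 2 : ℝ))
        ≤ saddleExponent s x n ^ (-(1 / 2 : ℝ)) := by
      refine Real.rpow_le_rpow_of_nonpos (by rw [saddleExponent]; positivity) ?_ (by norm_num)
      rw [saddleExponent]; gcongr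
    have h3 : κ ^ (1 / (s + 1)) * (n : ℝ) ^ (-(1 / (s + 1))) ≤ saddleScale s x n := by
      rw [saddleScale]; gcongr
    have h4 : κ ^ (1 / (s + 1)) * (n : ℝ) ^ (-(1 / (s + 1)))
        * ((2 * Real.pi / (s + 1)) ^ (1 / 2 : ℝ)
          * (Λ₁ ^ (1 / (s + 1)) * (n : ℝ) ^ (s / (s + 1))) ^ (-(1 / 2 : ℝ)))
        ≤ Real.exp (saddleExponent s x n * (saddlePhase s (saddlePoint s)).re)
          * (saddleScale s x n * ((2 * Real.pi / (s + 1)) ^ (1 / 2 : ℝ)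
            * saddleExponent s x n ^ (-(1 / 2 : ℝ)))) := by
      refine le_trans ?_ (le_mul_of_one_le_left ?_ h1)
      · gcongr
        rw [saddleScale]; positivity
      · rw [saddleScale, saddleExponent]; positivity
    exact mul_le_mul (by linarith) (by gcongr) (by positivity) (by have := zetaFactor_pos s x; positivity)
  have hν : (n : ℝ)⁻¹ ≤ (n : ℝ) ^ (-μ) := by
    rw [← Real.rpow_neg_one]
    exact Real.rpow_le_rpow_of_exponent_le hN1 (by linarith)
  have hZp := zetaFactor_pos s x
  set Y := 2 * zetaFactor s x * ‖saddleTerm s n x‖ with hY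
  have hYp : 0 < Y := hmp.trans_le hm'
  have h1 : |(eulerCoeff (powerSeq s) n x).re| ≤ |B| / m * Y := by
    refine ((hB x (abs_le.2 ⟨hx0, by linarith⟩)).trans (le_abs_self B)).trans ?_
    rw [div_mul_eq_mul_div, le_div_iff₀ hmp]
    gcongr
  have h2 : |2 * zetaFactor s x * (saddleTerm s n x).re| ≤ Y := by
    rw [abs_mul, abs_of_pos (by positivity), hY]
    gcongr
    exact Complex.abs_re_le_norm _
  have h3 : 1 ≤ n * (n : ℝ) ^ (-μ) := by
    have := mul_le_mul_of_nonneg_left hν hN.le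
    rwa [mul_inv_cancel₀ hN.ne'] at this
  calc _ ≤ |B| / m * Y + Y := (abs_sub _ _).trans (add_le_add h1 h2)
    _ = (|B| / m + 1) * Y * 1 := by ring
    _ ≤ (|B| / m + 1) * Y * (n * (n : ℝ) ^ (-μ)) := by gcongr
    _ = _ := by ring

/-- The asymptotics of the coefficients with an error term which is uniform in both variables. -/
lemma eulerCoeff_asymptotics {ξ κ Λ₁ : ℝ} (hξ0 : 0 ≤ ξ) (hξ : ξ < 1) (hκ : 0 < κ)
    (hΛ₁ : 0 < Λ₁) :
    ∃ C : ℝ, ∀ n : ℕ, 1 ≤ n → ∀ x : ℝ, -ξ ≤ x → x < 0 → κ ≤ -gammaPolyLog s x →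
      -gammaPolyLog s x ≤ Λ₁ →
      gammaPolyLog s (x ^ 2) * 2 ^ (-(s + 1))
        ≤ -gammaPolyLog s x * Real.cos (Real.pi / (s + 1)) ^ (s + 1) - κ →
      ∀ μ : ℝ, μ ≤ 1 / (s + 1) → μ ≤ s / (2 * s + 2) →
        |(eulerCoeff (powerSeq s) n x).re - 2 * zetaFactor s x * (saddleTerm s n x).re|
          ≤ C * (n : ℝ) ^ (-μ) * (2 * zetaFactor s x * ‖saddleTerm s n x‖) := by
  obtain ⟨C, hC, hev⟩ := eventually_eulerCoeff_sub_le hs hξ0 hξ hκ hΛ₁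
  obtain ⟨n₀, hn₀⟩ := eventually_atTop.1 hev
  -- The finitely many indices before the asymptotic range have their own constants, all dominated
  -- by one sum.
  choose! D hD0 hD using fun (n : ℕ) (hn : 1 ≤ n) =>
    eulerCoeff_sub_le (Λ₁ := Λ₁) hs hξ hκ hn
  have hsum : 0 ≤ ∑ n ∈ Finset.Ico 1 n₀, D n :=
    Finset.sum_nonneg fun n hn => hD0 n (Finset.mem_Ico.1 hn).1
  refine ⟨C + ∑ n ∈ Finset.Ico 1 n₀, D n, fun n hn x hx0 hx1 hκx hΛx hmar μ hμ1 hμ2 => ?_⟩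
  have hZp := zetaFactor_pos s x
  rcases lt_or_ge n n₀ with h | h
  · refine (hD n hn x hx0 hx1 hκx hΛx μ (hμ1.trans ?_)).trans ?_
    · rw [div_le_one (by linarith)]; linarith
    · gcongr
      have := Finset.single_le_sum (f := D) (fun i hi => hD0 i (Finset.mem_Ico.1 hi).1)
        (Finset.mem_Ico.2 ⟨hn, h⟩)
      linarith
  · refine (hn₀ n h x hx0 hx1 hκx hΛx hmar μ hμ1 hμ2).trans ?_
    gcongr
    linarith

end

/-! ### Compact subsets of the phase and the conclusion. -/

/-- For `s ≤ 1` the angle `π/(s+1)` is at least `π/2`, so `Re L_{1,1} ≤ 0 < Re L_{1,2}`. -/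
lemma one_lt_of_powerL_re_lt {s : ℝ} (hs : 0 < s) {x : ℝ} (hx0 : -1 < x) (hx1 : x < 0)
    (h : (powerL s 1 2 x).re < (powerL s 1 1 x).re) : 1 < s := by
  have h2x := powerL_re_two_pos hs hx0 hx1 1
  by_contra hs1
  have := powerL_re_odd_nonpos hs hx0 hx1 1 odd_one (Real.cos_nonpos_of_pi_div_two_le_of_le
    (div_le_div_of_nonneg_left Real.pi_pos.le (by linarith) (by linarith))
    ((div_le_self Real.pi_pos.le (by linarith)).trans (by linarith [Real.pi_pos])))
  linarith

/-- The phase inequality raised to the power `s+1`: the left side is the maximal growth at the pole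
of denominator `2`, the right side the growth at the saddle point. -/
lemma gammaPolyLog_margin {s : ℝ} (hs : 1 < s) {x : ℝ} (hx0 : -1 < x) (hx1 : x < 0)
    (h : (powerL s 1 2 x).re < (powerL s 1 1 x).re) :
    gammaPolyLog s (x ^ 2) * 2 ^ (-(s + 1))
      < -gammaPolyLog s x * Real.cos (Real.pi / (s + 1)) ^ (s + 1) := by
  have hs0 : 0 < s := by linarith
  have hc := cos_pi_div_pos hs
  have hn := gammaPolyLog_neg hs0 hx0 hx1
  have hp := gammaPolyLog_pos hs0 (by nlinarith : 0 < x ^ 2) (by nlinarith)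
  have hp2 := Real.rpow_pos_of_pos hp (1 / (s + 1))
  have hn2 := Real.rpow_pos_of_pos (neg_pos.2 hn) (1 / (s + 1))
  rw [powerL_re_pos hs0 1 2 (by nlinarith) (by nlinarith), powerL_re_neg hs0 1 1 (by simpa) (by simpa),
    pow_one] at h
  have h' := Real.rpow_lt_rpow (z := s + 1) (by positivity) h (by linarith)
  rw [Real.mul_rpow (by positivity) hp2.le, ← Real.rpow_mul hp.le,
    one_div_mul_cancel (by linarith), Real.rpow_one, Real.mul_rpow (by positivity) hc.le,
    Real.mul_rpow (by positivity) hn2.le, ← Real.rpow_mul (neg_pos.2 hn).le,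
    one_div_mul_cancel (by linarith), Real.rpow_one] at h'
  rw [Real.rpow_neg (by norm_num), ← Real.inv_rpow (by norm_num)]
  norm_num at h' ⊢
  linarith

/-- The uniform asymptotics on compact subsets of `(x*, 0)`. -/
lemma eulerCoeff_asymptotics_of_isCompact {s : ℝ} (hs : 1 < s) {X : Set ℝ} (hX : IsCompact X)
    (hX0 : X ⊆ Ioo (-1) 0) (hlt : ∀ x ∈ X, (powerL s 1 2 x).re < (powerL s 1 1 x).re) :
    ∃ C : ℝ, ∀ n : ℕ, 1 ≤ n → ∀ x ∈ X, ∀ μ : ℝ, μ ≤ 1 / (s + 1) → μ ≤ s / (2 * s + 2) →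
      |(eulerCoeff (powerSeq s) n x).re - 2 * zetaFactor s x * (saddleTerm s n x).re|
        ≤ C * (n : ℝ) ^ (-μ) * (2 * zetaFactor s x * ‖saddleTerm s n x‖) := by
  have hs0 : 0 < s := by linarith
  have hcont := continuousOn_gammaPolyLog hs0
  have hc1 : ContinuousOn (gammaPolyLog s) X :=
    hcont.mono fun x hx => ⟨(hX0 hx).1, (hX0 hx).2.trans one_pos⟩
  have hc2 : ContinuousOn (fun x : ℝ => gammaPolyLog s (x ^ 2)) X := by
    refine hcont.comp (by fun_prop) fun x hx => ?_
    have := hX0 hx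
    constructor <;> nlinarith [this.1, this.2]
  obtain ⟨κ₁, hκ₁, h1⟩ := exists_pos_le_of_isCompact hX (f := fun x => 1 + x) (by fun_prop)
    fun x hx => by linarith [(hX0 hx).1]
  obtain ⟨κ₂, hκ₂, h2⟩ := exists_pos_le_of_isCompact hX (f := fun x => -gammaPolyLog s x) hc1.neg
    fun x hx => by linarith [gammaPolyLog_neg hs0 (hX0 hx).1 (hX0 hx).2]
  obtain ⟨κ₃, hκ₃, h3⟩ := exists_pos_le_of_isCompact hX
    (f := fun x => -gammaPolyLog s x * Real.cos (Real.pi / (s + 1)) ^ (s + 1)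
      - gammaPolyLog s (x ^ 2) * 2 ^ (-(s + 1)))
    ((hc1.neg.mul continuousOn_const).sub (hc2.mul continuousOn_const))
    fun x hx => sub_pos.2 (gammaPolyLog_margin hs (hX0 hx).1 (hX0 hx).2 (hlt x hx))
  obtain ⟨B, hB⟩ := hX.exists_bound_of_continuousOn hc1
  obtain ⟨C, hC⟩ := eulerCoeff_asymptotics hs (ξ := max 0 (1 - κ₁)) (κ := min κ₂ κ₃)
    (Λ₁ := max B 1) (le_max_left _ _) (max_lt one_pos (by linarith)) (lt_min hκ₂ hκ₃)
    (lt_max_of_lt_right one_pos)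
  refine ⟨C, fun n hn x hx μ => hC n hn x ?_ (hX0 hx).2 ((min_le_left _ _).trans (h2 x hx)) ?_ ?_ μ⟩
  · have := h1 x hx
    linarith [le_max_right 0 (1 - κ₁)]
  · exact (neg_le_abs _).trans ((hB x hx).trans (le_max_left _ _))
  · have := h3 x hx
    linarith [min_le_right κ₂ κ₃]

theorem mainTheorem5 (s₀ : ℝ) (hs₀ : 0 < s₀) :
    ∃ xstar ∈ Icc (-1 : ℝ) 0,
      phase (powerL s₀) (Complex.ofReal '' Ioo (-1 : ℝ) 1) 1 1
          = Complex.ofReal '' (Ioo 0 1 ∪ Ioo xstar 0) ∧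
      phase (powerL s₀) (Complex.ofReal '' Ioo (-1 : ℝ) 1) 1 2
          = Complex.ofReal '' Ioo (-1) xstar ∧
      ∀ X : Set ℝ, IsCompact X → X ⊆ Ioo xstar 0 →
        ∃ E : ℕ → ℝ → ℝ,
          (∀ n : ℕ, 1 ≤ n → ∀ x ∈ X,
            eulerCoeff (powerSeq s₀) n (x : ℂ) =
              2 * (1 - (x : ℂ)) ^ (-riemannZeta (1 - (s₀ : ℂ))) *
                ((‖saddleTerm s₀ n x‖ *
                  (Real.cos (Complex.arg (saddleTerm s₀ n x)) + E n x) : ℝ) : ℂ)) ∧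
          ∀ σ₀ ∈ Ioo (-1 : ℝ) 0, ∃ C : ℝ, ∀ n : ℕ, 1 ≤ n → ∀ x ∈ X,
            |E n x| ≤ C * (n : ℝ) ^ (-min (-σ₀ / (s₀ + 1)) (s₀ / (2 * s₀ + 2))) := by
  obtain ⟨c, hc, hthr⟩ := exists_phase_threshold hs₀
  refine ⟨c, hc, phase_one_one hs₀ hc fun x hx => (hthr x hx).1,
    phase_one_two hs₀ hc fun x hx => (hthr x hx).2, fun X hX hXc => ?_⟩
  -- A point of `X` forces `s₀ > 1`; for `s₀ ≤ 1` only the empty set occurs.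
  rcases X.eq_empty_or_nonempty with rfl | ⟨y, hy⟩
  · exact ⟨0, by simp, fun _ _ => ⟨0, by simp⟩⟩
  have hX0 : X ⊆ Ioo (-1) 0 := fun x hx => ⟨hc.1.trans_lt (hXc hx).1, (hXc hx).2⟩
  have hlt : ∀ x ∈ X, (powerL s₀ 1 2 x).re < (powerL s₀ 1 1 x).re := fun x hx =>
    ((hthr x (hX0 hx)).1).2 (hXc hx).1
  have hs : 1 < s₀ := one_lt_of_powerL_re_lt hs₀ (hX0 hy).1 (hX0 hy).2 (hlt y hy)
  obtain ⟨C, hC⟩ := eulerCoeff_asymptotics_of_isCompact hs hX hX0 hlt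
  have hpos : ∀ n : ℕ, 1 ≤ n → ∀ x ∈ X, 0 < ‖saddleTerm s₀ n x‖ := fun n hn x hx => by
    have hN : (0 : ℝ) < n := by exact_mod_cast hn
    have hℓ := saddleRadius_pos (neg_pos.2 (gammaPolyLog_neg hs₀ (hX0 hx).1 (hX0 hx).2))
    have hpi := Real.pi_pos
    rw [norm_saddleTerm hs hn (hX0 hx).1 (hX0 hx).2, saddleScale, saddleExponent]
    positivity
  have hre : ∀ n : ℕ, 1 ≤ n → ∀ x ∈ X, ∀ e : ℝ,
      e = (eulerCoeff (powerSeq s₀) n x).re / (2 * zetaFactor s₀ x * ‖saddleTerm s₀ n x‖)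
        - Real.cos (Complex.arg (saddleTerm s₀ n x)) →
      2 * zetaFactor s₀ x * (‖saddleTerm s₀ n x‖ *
        (Real.cos (Complex.arg (saddleTerm s₀ n x)) + e))
        = (eulerCoeff (powerSeq s₀) n x).re := fun n hn x hx e he => by
    have h1 := hpos n hn x hx
    have h2 := zetaFactor_pos s₀ x
    rw [he]; field_simp; ring
  -- `E` is obtained by solving the required identity for it, which is possible because the main
  -- term has non-zero modulus. One `C` serves all `σ₀`, since `-σ₀/(s₀+1) ≤ 1/(s₀+1)`.
  refine ⟨fun n x => (eulerCoeff (powerSeq s₀) n x).re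
      / (2 * zetaFactor s₀ x * ‖saddleTerm s₀ n x‖)
      - Real.cos (Complex.arg (saddleTerm s₀ n x)), fun n hn x hx => ?_, fun σ₀ hσ₀ => ⟨C, ?_⟩⟩
  · have hx1 := hX0 hx
    rw [eulerCoeff_eq_ofReal_re s₀ (abs_lt.2 ⟨hx1.1, hx1.2.trans one_pos⟩),
      one_sub_cpow_neg_zeta_eq s₀ (hx1.2.trans one_pos), ← hre n hn x hx _ rfl]
    push_cast
    ring
  · intro n hn x hx
    have h1 := hpos n hn x hx
    have h2 := zetaFactor_pos s₀ x
    have hs1 : 0 < s₀ + 1 := by linarith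
    have h3 := hC n hn x hx (min (-σ₀ / (s₀ + 1)) (s₀ / (2 * s₀ + 2)))
      ((min_le_left _ _).trans (by gcongr; linarith [hσ₀.1])) (min_le_right _ _)
    refine le_of_mul_le_mul_right (le_trans (le_of_eq ?_) h3)
      (by positivity : 0 < 2 * zetaFactor s₀ x * ‖saddleTerm s₀ n x‖)
    have hY : 0 < 2 * zetaFactor s₀ x * ‖saddleTerm s₀ n x‖ := by positivity
    refine (congrArg (_ * ·) (abs_of_pos hY).symm).trans ?_
    beta_reduce
    rw [← abs_mul, sub_mul, div_mul_cancel₀ _ hY.ne', ← Complex.norm_mul_cos_arg (saddleTerm s₀ n x)]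
    congr 1
    ring
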